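/- A planning instance is a tuple $\Pi=(V,I,G,A)$, where $V$ is a finite set of variables, each $v\in V$ with a finite domain $D(v)$; a partial state is a map $s$ defined on a set $\mathrm{vars}(s)\subseteq V$ with $s(v)\in D(v)$, and a state is a partial state with $\mathrm{vars}(s)=V$; $I$ is a state, $G$ is a partial state, and $A$ is a set of actions $a=(\mathrm{pre}(a)\Rightarrow\mathrm{post}(a))$ with partial states $\mathrm{pre}(a),\mathrm{post}(a)$. Applying $a$ to a state $s$ leaves $s$ unchanged if $s$ does not agree with $\mathrm{pre}(a)$ on $\mathrm{vars}(\mathrm{pre}(a))$, and otherwise resets $s$ to $\mathrm{post}(a)$ on $\mathrm{vars}(\mathrm{post}(a))$. For a sequence $p$ of actions of $A$, $s[p]$ is the state obtained by applying them in turn; $p$ is a solution plan for $\Pi$ if $I[p]$ agrees with $G$ on $\mathrm{vars}(G)$. An instance of CaseMod consists of a planning instance $\Pi=(V,I,G,A)$, a case $(\Pi',c)$ consisting of a planning instance $\Pi'=(V,J,H,A)$ (with the same domains) and a solution plan $c$ of $\Pi'$, a set $A'\subseteq A$, and an integer $M\ge 0$. The question is whether there are $m\le M$, actions $g_1,\dots,g_m\in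 A'$ and $0\le i\le m$ such that $I[(g_1,\dots,g_i)]=J$ and the sequence consisting of $g_1,\dots,g_i$, then $c$, then $g_{i+1},\dots,g_m$ is a solution plan for $\Pi$. The parameterized problem $\{L,V\}$-CaseMod is CaseMod with the parameter $M+\ell$, where $\ell$ is the number of variables that occur in the preconditions and postconditions of the actions in $A'$. An fpt-reduction from a parameterized problem $P$ to a parameterized problem $Q$ maps instances $(x,k)$ of $P$ to instances $(x',k')$ of $Q$ with the same answer, such that $k'\le g(k)$ for a computable function $g$, and is computable in time $f(k)\cdot|x|^{c}$ for a computable function $f$ and a constant $c$. For $q\in\mathbb N$, weighted $q$-CNF satisfiability asks, given a CNF formula with at most $q$ literals in each clause and a number $k$ (the parameter), whether the formula has a satisfying assignment that sets exactly $k$ of its variables to true. The class $\mathrm{W}[1]$ consists of the parameterized problems that are fpt-reducible to weighted $q$-CNF satisfiability for some $q$. **Theorem.** $\{L,V\}$-CaseMod is $\mathrm{W}[1]$-complete: it belongs to $\mathrm{W}[1]$, and every problem in $\mathrm{W}[1]$ is fpt-reducible to it. -/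

import Mathlib

namespace CaseReuse

/-! ## Data and a programming language with a step count

Instances are encoded as finite binary trees, and algorithms are programs of the WHILE language
over such trees.  Every evaluation of an expression is charged the total size of all values that
occur in it, so that a run of cost `t` can be simulated by a Turing machine in time polynomial in
`t` and in the size of the input, and conversely. -/

/-- Finite binary trees with unlabelled nodes. They also serve as the names of variables and
values, in the role that strings over a fixed alphabet play elsewhere. -/
inductive Data : Type where
  | nil : Data
  | cons : Data → Data → Data
  deriving DecidableEq

/-- The number of nodes of a tree, leaves included. -/
def Data.size : Data → ℕ
  | .nil => 1
  | .cons a b => a.size + b.size + 1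

/-- The first component; `nil` at `nil`. -/
def Data.hd : Data → Data
  | .nil => .nil
  | .cons a _ => a

/-- The second component; `nil` at `nil`. -/
def Data.tl : Data → Data
  | .nil => .nil
  | .cons _ b => b

/-- A memory state of a program: one tree in each of the registers `0, 1, 2, …`. -/
abbrev Store : Type := ℕ → Data

/-- Expressions of the WHILE language. -/
inductive Expr : Type where
  | reg : ℕ → Expr
  | nil : Expr
  | cons : Expr → Expr → Expr
  | hd : Expr → Expr
  | tl : Expr → Expr
  | eq : Expr → Expr → Expr

/-- The value of an expression. An equality test yields `cons nil nil` (true) or `nil` (false). -/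
def Expr.eval (σ : Store) : Expr → Data
  | .reg i => σ i
  | .nil => .nil
  | .cons e f => .cons (e.eval σ) (f.eval σ)
  | .hd e => (e.eval σ).hd
  | .tl e => (e.eval σ).tl
  | .eq e f => if e.eval σ = f.eval σ then .cons .nil .nil else .nil

/-- The cost of evaluating an expression: the sum of the sizes of the values of all its
subexpressions. -/
def Expr.cost (σ : Store) : Expr → ℕ
  | .reg i => (σ i).size
  | .nil => 1
  | .cons e f => e.cost σ + f.cost σ + (Expr.eval σ (.cons e f)).size
  | .hd e => e.cost σ + (Expr.eval σ (.hd e)).size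
  | .tl e => e.cost σ + (Expr.eval σ (.tl e)).size
  | .eq e f => e.cost σ + f.cost σ + (Expr.eval σ (.eq e f)).size

/-- Programs of the WHILE language. The tests of `ite` and `loop` succeed on all trees other
than `nil`. -/
inductive Prog : Type where
  | assign : ℕ → Expr → Prog
  | seq : Prog → Prog → Prog
  | ite : Expr → Prog → Prog → Prog
  | loop : Expr → Prog → Prog

/-- `Exec p σ τ t`: the program `p`, started in the store `σ`, halts in the store `τ`, and the
cost of this run is `t`. -/
inductive Exec : Prog → Store → Store → ℕ → Prop where
  | assign (i : ℕ) (e : Expr) (σ : Store) :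
      Exec (.assign i e) σ (Function.update σ i (e.eval σ)) (e.cost σ + 1)
  | seq {p q : Prog} {σ τ υ : Store} {s t : ℕ} :
      Exec p σ τ s → Exec q τ υ t → Exec (.seq p q) σ υ (s + t)
  | ite_true {e : Expr} {p q : Prog} {σ τ : Store} {t : ℕ} :
      e.eval σ ≠ .nil → Exec p σ τ t → Exec (.ite e p q) σ τ (e.cost σ + 1 + t)
  | ite_false {e : Expr} {p q : Prog} {σ τ : Store} {t : ℕ} :
      e.eval σ = .nil → Exec q σ τ t → Exec (.ite e p q) σ τ (e.cost σ + 1 + t)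
  | loop_false {e : Expr} {p : Prog} {σ : Store} :
      e.eval σ = .nil → Exec (.loop e p) σ σ (e.cost σ + 1)
  | loop_true {e : Expr} {p : Prog} {σ τ υ : Store} {s t : ℕ} :
      e.eval σ ≠ .nil → Exec p σ τ s → Exec (.loop e p) τ υ t →
      Exec (.loop e p) σ υ (e.cost σ + 1 + s + t)

/-- The initial store on an input: the input is in register `0`, all other registers hold
`nil`. -/
def inputStore (x : Data) : Store := Function.update (fun _ => Data.nil) 0 x

/-- On input `x` the program `p` halts at cost at most `T` with output `y` in register `0`. -/
def Prog.OutputsWithin (p : Prog) (x y : Data) (T : ℕ) : Prop :=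
  ∃ (τ : Store) (t : ℕ), Exec p (inputStore x) τ t ∧ τ 0 = y ∧ t ≤ T

/-! ## Encodings -/

/-- The encoding of a list whose entries are encoded by `f`. -/
def encList {α : Type} (f : α → Data) : List α → Data
  | [] => .nil
  | a :: l => .cons (f a) (encList f l)

/-- The encoding of a pair. -/
def encPair {α β : Type} (f : α → Data) (g : β → Data) (x : α × β) : Data := .cons (f x.1) (g x.2)

/-- The encoding of a truth value. -/
def encBool : Bool → Data
  | false => .nil
  | true => .cons .nil .nil

/-- Unary encoding of numbers. It is used only for numbers that are bounded by the parameter. -/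
def encNat : ℕ → Data
  | 0 => .nil
  | n + 1 => .cons .nil (encNat n)

theorem encList_injective {α : Type} {f : α → Data} (hf : Function.Injective f) :
    Function.Injective (encList f) := by
  intro l
  induction l with
  | nil => intro m h; cases m with
    | nil => rfl
    | cons b m => simp [encList] at h
  | cons a l ih => intro m h; cases m with
    | nil => simp [encList] at h
    | cons b m =>
      simp only [encList, Data.cons.injEq] at h
      rw [hf h.1, ih h.2]

theorem encPair_injective {α β : Type} {f : α → Data} {g : β → Data}
    (hf : Function.Injective f) (hg : Function.Injective g) :
    Function.Injective (encPair f g) := by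
  rintro ⟨a, b⟩ ⟨c, d⟩ h
  simp only [encPair, Data.cons.injEq] at h
  rw [hf h.1, hg h.2]

theorem encBool_injective : Function.Injective encBool := by
  intro a b h
  cases a <;> cases b <;> simp [encBool] at h ⊢

theorem encNat_injective : Function.Injective encNat := by
  intro m
  induction m with
  | zero => intro n h; cases n with
    | zero => rfl
    | succ n => simp [encNat] at h
  | succ m ih => intro n h; cases n with
    | zero => simp [encNat] at h
    | succ n =>
      simp only [encNat, Data.cons.injEq, true_and] at h
      rw [ih h]

/-! ## Parameterized problems and fpt-reductions -/

/-- A parameterized decision problem. The instance `x` stands for the pair `(I, k)` whose main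
part `I` is encoded by `enc x` and whose parameter `k` is `param x`. -/
structure ParamProblem where
  Inst : Type
  enc : Inst → Data
  param : Inst → ℕ
  enc_param_injective : Function.Injective fun x => (enc x, param x)
  Yes : Inst → Prop

/-- What an algorithm for the problem is given: the main part together with the parameter. -/
def ParamProblem.input (P : ParamProblem) (x : P.Inst) : Data :=
  .cons (P.enc x) (encNat (P.param x))

/-- Existence of an fpt-reduction: a map `R` between instances that preserves the answers,
bounds the new parameter by a computable function of the old one, and is computed in time
`f(k) * n ^ c`, where `f` is computable, `k` is the parameter, `n` the size of the main part. -/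
def FPTReducible (P Q : ParamProblem) : Prop :=
  ∃ R : P.Inst → Q.Inst,
    (∀ x, P.Yes x ↔ Q.Yes (R x)) ∧
    (∃ g : ℕ → ℕ, Computable g ∧ ∀ x, Q.param (R x) ≤ g (P.param x)) ∧
    (∃ (p : Prog) (f : ℕ → ℕ) (c : ℕ), Computable f ∧
      ∀ x, p.OutputsWithin (P.input x) (Q.input (R x)) (f (P.param x) * (P.enc x).size ^ c))

/-! ## The class W[1] -/

/-- A literal: a sign (`true` for a positive literal) and a propositional variable. -/
abbrev Literal : Type := Bool × Data

/-- A clause is the disjunction of its literals. -/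
abbrev Clause : Type := List Literal

/-- A formula in conjunctive normal form is the conjunction of its clauses. -/
abbrev CNF : Type := List Clause

/-- The propositional variables that occur in a formula. -/
def CNF.vars (φ : CNF) : Finset Data := ((List.flatten φ).map Prod.snd).toFinset

/-- The assignment that makes exactly the variables in `S` true satisfies the formula. -/
def CNF.SatisfiedBy (φ : CNF) (S : Finset Data) : Prop :=
  ∀ c ∈ φ, ∃ l ∈ c, (l.1 = true ↔ l.2 ∈ S)

/-- Formulas in conjunctive normal form with at most `q` literals in each clause. -/
def BoundedCNF (q : ℕ) : Type := {φ : CNF // ∀ c ∈ φ, c.length ≤ q}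

/-- Weighted satisfiability of `q`-CNF formulas: given a formula and a number `k`, the parameter,
is there a satisfying assignment that sets exactly `k` of its variables to true? -/
def WSatCNF (q : ℕ) : ParamProblem where
  Inst := BoundedCNF q × ℕ
  enc x := encList (encList (encPair encBool id)) x.1.1
  param x := x.2
  enc_param_injective := by
    rintro ⟨φ, k⟩ ⟨ψ, m⟩ h
    have h1 := encList_injective (encList_injective
      (encPair_injective encBool_injective Function.injective_id)) (Prod.ext_iff.mp h).1
    have h2 : k = m := (Prod.ext_iff.mp h).2
    exact Prod.ext (Subtype.ext h1) h2
  Yes x := ∃ S : Finset Data, S ⊆ CNF.vars x.1.1 ∧ S.card = x.2 ∧ CNF.SatisfiedBy x.1.1 S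

/-- The class W[1]: the problems that are fpt-reducible to weighted satisfiability of formulas in
conjunctive normal form with clauses of bounded size. -/
def InW1 (P : ParamProblem) : Prop := ∃ q : ℕ, FPTReducible P (WSatCNF q)

/-- All problems in W[1] are fpt-reducible to `P`. -/
def W1Hard (P : ParamProblem) : Prop := ∀ Q : ParamProblem, InW1 Q → FPTReducible Q P

def W1Complete (P : ParamProblem) : Prop := InW1 P ∧ W1Hard P

/-! ## Planning -/

/-- A partial state, as an explicit list of mappings `v ↦ d`. -/
abbrev PState : Type := List (Data × Data)

/-- The variables on which a partial state is defined, in the order of the list. -/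
def PState.vars (s : PState) : List Data := List.map Prod.fst s

/-- The partial function that a partial state stands for. -/
def PState.val (s : PState) (v : Data) : Option Data := List.lookup v s

/-- `s` restricted to the variables of `p` equals `p`. -/
def Agrees (s : Data → Option Data) (p : PState) : Prop := ∀ v ∈ PState.vars p, s v = PState.val p v

instance (s : Data → Option Data) (p : PState) : Decidable (Agrees s p) :=
  inferInstanceAs (Decidable (∀ v ∈ PState.vars p, s v = PState.val p v))

/-- An action: a precondition and a postcondition. -/
structure Action : Type where
  pre : PState
  post : PState

/-- The effect of an action on a state. An action that is not applicable changes nothing. -/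
def Action.apply (a : Action) (s : Data → Option Data) : Data → Option Data :=
  if Agrees s a.pre then
    fun v => if v ∈ PState.vars a.post then PState.val a.post v else s v
  else s

/-- The state `s[p]` that results from a sequence `p` of actions. -/
def run (p : List Action) (s : Data → Option Data) : Data → Option Data :=
  p.foldl (fun s a => a.apply s) s

/-- The variables that an action mentions. -/
def Action.vars (a : Action) : List Data := PState.vars a.pre ++ PState.vars a.post

/-- The data of a planning instance `(V, I, G, A)`. The list `doms` holds the variables, each with
the list of the values in its domain. -/
structure PlanningInstance : Type where
  doms : List (Data × List Data)
  init : PState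
  goal : PState
  actions : List Action

namespace PlanningInstance

/-- The variables of a planning instance. -/
def vars (P : PlanningInstance) : List Data := P.doms.map Prod.fst

/-- `s` is a partial state of the instance: it has at most one value for each variable, and all
its mappings `v ↦ d` satisfy `v ∈ V` and `d ∈ D(v)`. -/
def IsPartialState (P : PlanningInstance) (s : PState) : Prop :=
  (PState.vars s).Nodup ∧ ∀ x ∈ s, ∃ y ∈ P.doms, y.1 = x.1 ∧ x.2 ∈ y.2

/-- `s` is a state of the instance: a partial state that is defined on all variables. -/
def IsState (P : PlanningInstance) (s : PState) : Prop :=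
  P.IsPartialState s ∧ ∀ v ∈ P.vars, v ∈ PState.vars s

/-- The data form a planning instance. -/
def Valid (P : PlanningInstance) : Prop :=
  P.vars.Nodup ∧ P.IsState P.init ∧ P.IsPartialState P.goal ∧
    ∀ a ∈ P.actions, P.IsPartialState a.pre ∧ P.IsPartialState a.post

/-- `p` is a solution plan. -/
def IsSolution (P : PlanningInstance) (p : List Action) : Prop :=
  (∀ a ∈ p, a ∈ P.actions) ∧ Agrees (run p (PState.val P.init)) P.goal

end PlanningInstance

/-! ## Case modification -/

/-- The data of a CaseMod instance: the planning instance `(V, I, G, A)` to be solved, the initial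
state `J` and the goal `H` of the case, its plan `c`, the actions `A'` allowed for glue steps, and
the allowed number `M` of glue steps. -/
structure CaseModData : Type where
  target : PlanningInstance
  caseInit : PState
  caseGoal : PState
  casePlan : List Action
  glueActions : List Action
  maxGlue : ℕ

namespace CaseModData

/-- The planning instance `(V, J, H, A)` of the case. -/
def caseInstance (x : CaseModData) : PlanningInstance :=
  { x.target with init := x.caseInit, goal := x.caseGoal }

/-- The data form a CaseMod instance; in particular `c` is a solution plan of the case. -/
def Valid (x : CaseModData) : Prop :=
  x.target.Valid ∧ x.caseInstance.Valid ∧ x.caseInstance.IsSolution x.casePlan ∧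
    ∀ a ∈ x.glueActions, a ∈ x.target.actions

/-- The question of CaseMod: is there a sequence `g` of at most `M` glue steps from `A'` such that,
for some position `i`, its first `i` steps lead from `I` to exactly `J`, and these steps followed
by `c` and by the remaining steps of `g` form a solution plan? -/
def Yes (x : CaseModData) : Prop :=
  ∃ g : List Action, g.length ≤ x.maxGlue ∧ (∀ a ∈ g, a ∈ x.glueActions) ∧
    ∃ i ≤ g.length,
      x.target.IsSolution (g.take i ++ x.casePlan ++ g.drop i) ∧
      run (g.take i) (PState.val x.target.init) = PState.val x.caseInit

/-- The variables mentioned in the actions in `A'`. -/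
def glueVars (x : CaseModData) : Finset Data := (x.glueActions.flatMap Action.vars).toFinset

end CaseModData

def encPState : PState → Data := encList (encPair id id)

def encAction (a : Action) : Data := .cons (encPState a.pre) (encPState a.post)

def encPlanningInstance (P : PlanningInstance) : Data :=
  .cons (encList (encPair id (encList id)) P.doms)
    (.cons (encPState P.init) (.cons (encPState P.goal) (encList encAction P.actions)))

def encCaseMod (x : CaseModData) : Data :=
  .cons (encPlanningInstance x.target)
    (.cons (encPState x.caseInit) (.cons (encPState x.caseGoal)
      (.cons (encList encAction x.casePlan)
        (.cons (encList encAction x.glueActions) (encNat x.maxGlue)))))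

theorem encPState_injective : Function.Injective encPState :=
  encList_injective (encPair_injective Function.injective_id Function.injective_id)

theorem encAction_injective : Function.Injective encAction := by
  rintro ⟨a, b⟩ ⟨c, d⟩ h
  simp only [encAction, Data.cons.injEq] at h
  rw [encPState_injective h.1, encPState_injective h.2]

theorem encPlanningInstance_injective : Function.Injective encPlanningInstance := by
  rintro ⟨a, b, c, d⟩ ⟨a', b', c', d'⟩ h
  simp only [encPlanningInstance, Data.cons.injEq] at h
  obtain ⟨h1, h2, h3, h4⟩ := h
  rw [encList_injective (encPair_injective Function.injective_id
    (encList_injective Function.injective_id)) h1, encPState_injective h2,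
    encPState_injective h3, encList_injective encAction_injective h4]

theorem encCaseMod_injective : Function.Injective encCaseMod := by
  rintro ⟨a, b, c, d, e, m⟩ ⟨a', b', c', d', e', m'⟩ h
  simp only [encCaseMod, Data.cons.injEq] at h
  obtain ⟨h1, h2, h3, h4, h5, h6⟩ := h
  rw [encPlanningInstance_injective h1, encPState_injective h2, encPState_injective h3,
    encList_injective encAction_injective h4, encList_injective encAction_injective h5,
    encNat_injective h6]

/-- The problem {L, V}-CaseMod: the parameter is the allowed number of glue steps plus the number
of variables mentioned in the actions in `A'`. -/
def LVCaseMod : ParamProblem where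
  Inst := {x : CaseModData // x.Valid}
  enc x := encCaseMod x.1
  param x := x.1.maxGlue + x.1.glueVars.card
  enc_param_injective := fun _ _ h =>
    Subtype.ext (encCaseMod_injective (Prod.ext_iff.mp h).1)
  Yes x := x.1.Yes

end CaseReuse

/-! Hardness. Given a formula with at most `q` literals per clause and a weight `k`, a plan guesses
`k` true variables by writing them into `k` position variables, each writable only once. It must
then be verified, using a number of planning variables bounded in terms of `k`, that the guessed
variables are distinct and satisfy the formula. For every list `t` of at most `q + 2` distinct
positions there is a task variable. It is set by actions whose precondition is a partial assignment
`A` to positions that covers `t`, has no repeated values, and violates no clause when exactly its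
own values count as true. Suppose all tasks are achieved and the guess violates a clause. Let `t` be
the positions that hold the variables negated in the clause. The witness `A` for `t` makes all of
these variables true, and its true variables belong to the guess, so `A` violates the clause as
well, a contradiction (`Reachable.satisfiable`). Conversely, the restriction of a correct guess to
`t` extends to such an `A` inside the guess: while `A` violates a clause, the guess must satisfy it
by a positive literal not yet in `A`, and adding this literal can happen at most `k` times
(`exists_witness`). A search tree of depth `k` with branching bounded in terms of `q` and `k`
therefore lists enough actions in fpt time (`searchStep_iterate_bound`), while the number of
variables depends on `k` and `q` alone (`satCaseMod_param_le`). The case is empty, so the glue steps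
carry all of the hardness.

Membership. The plan of the case is condensed into one action, guarded by a fresh phase variable
that goes from `nil` to `one`. A solution is then a sequence of `M + 1` steps, each a glue action,
the case action or a no-op. Only the phase and the `ℓ` glue variables need to be followed over time;
the remaining variables are settled by a condition that can be checked beforehand. Taking the event
at each time and the value of each followed variable at each time as unknowns gives a constraint
satisfaction problem with `(M + 1) + (M + 2)(ℓ + 1)` slots and constraints on at most three slots
(`schedulable_iff`). With one propositional variable per slot and value, at most one value per slot,
and weight equal to the number of slots, it becomes weighted 3-CNF satisfiability
(`cspCNF_satisfiable_iff`).

Running times. `FC` is a calculus of functions computable at fpt cost, closed under composition,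
pairing, branching, folds and the usual list operations. Both constructions are shown to be
computable by following the shape of their definitions, and `FPTReducible.trans_FC` converts the
outcome into an fpt-reduction. -/

namespace CaseReuse

/-! ## Bounds of the form `f(κ) * n ^ c` -/

/-- `b` is bounded by `f(κ) * (s + 1) ^ c` for some monotone primitive recursive `f`. -/
def FB {ι : Type} (κ s b : ι → ℕ) : Prop :=
  ∃ (f : ℕ → ℕ) (c : ℕ), Primrec f ∧ Monotone f ∧ ∀ x, b x ≤ f (κ x) * (s x + 1) ^ c

namespace FB

variable {ι ι' : Type} {κ s s' b b' : ι → ℕ}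

theorem mono (h : FB κ s b) (hb : ∀ x, b' x ≤ b x) : FB κ s b' := by
  obtain ⟨f, c, hf, hm, h⟩ := h
  exact ⟨f, c, hf, hm, fun x => (hb x).trans (h x)⟩

theorem of_param {f : ℕ → ℕ} (hf : Primrec f) (hm : Monotone f) : FB κ s (fun x => f (κ x)) :=
  ⟨f, 0, hf, hm, fun x => by simp⟩

theorem const (n : ℕ) : FB κ s (fun _ => n) := of_param (Primrec.const n) monotone_const

theorem param : FB κ s κ := of_param (f := id) Primrec.id monotone_id

theorem self : FB κ s s :=
  ⟨fun _ => 1, 1, Primrec.const 1, monotone_const, fun x => by simp⟩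

theorem add (h : FB κ s b) (h' : FB κ s b') : FB κ s (fun x => b x + b' x) := by
  obtain ⟨f, c, hf, hm, h⟩ := h
  obtain ⟨g, d, hg, hn, h'⟩ := h'
  refine ⟨fun n => f n + g n, c + d, Primrec.nat_add.comp hf hg, hm.add hn, fun x => ?_⟩
  have h1 : (s x + 1) ^ c ≤ (s x + 1) ^ (c + d) := Nat.pow_le_pow_right (by omega) (by omega)
  have h2 : (s x + 1) ^ d ≤ (s x + 1) ^ (c + d) := Nat.pow_le_pow_right (by omega) (by omega)
  calc b x + b' x ≤ f (κ x) * (s x + 1) ^ c + g (κ x) * (s x + 1) ^ d := add_le_add (h x) (h' x)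
    _ ≤ f (κ x) * (s x + 1) ^ (c + d) + g (κ x) * (s x + 1) ^ (c + d) := by gcongr
    _ = _ := by ring

theorem mul (h : FB κ s b) (h' : FB κ s b') : FB κ s (fun x => b x * b' x) := by
  obtain ⟨f, c, hf, hm, h⟩ := h
  obtain ⟨g, d, hg, hn, h'⟩ := h'
  refine ⟨fun n => f n * g n, c + d, Primrec.nat_mul.comp hf hg, hm.mul' hn, fun x => ?_⟩
  calc b x * b' x ≤ (f (κ x) * (s x + 1) ^ c) * (g (κ x) * (s x + 1) ^ d) :=
        Nat.mul_le_mul (h x) (h' x)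
    _ = _ := by ring

theorem pow (h : FB κ s b) (n : ℕ) : FB κ s (fun x => b x ^ n) := by
  induction n with
  | zero => simpa using const 1
  | succ n ih => simpa [pow_succ] using ih.mul h

theorem trans (h : FB κ s' b) (h' : FB κ s s') : FB κ s b := by
  obtain ⟨f, c, hf, hm, h⟩ := h
  exact ((of_param hf hm).mul ((h'.add (const 1)).pow c)).mono h

theorem comp (h : FB κ s b) (g : ι' → ι) :
    FB (fun x => κ (g x)) (fun x => s (g x)) (fun x => b (g x)) := by
  obtain ⟨f, c, hf, hm, h⟩ := h
  exact ⟨f, c, hf, hm, fun x => h (g x)⟩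

/-- A bound that holds uniformly over a product, where the size is bounded in the first factor. -/
theorem uniform {β : Type} {s b : ι × β → ℕ} {B : ι → ℕ} {s' : ι → ℕ} {D : ι → β → Prop}
    (h : FB (fun y : ι × β => κ y.1) s b) (hB : FB κ s' B) (hs : ∀ x y, D x y → s (x, y) ≤ B x) :
    ∃ C, FB κ s' C ∧ ∀ x y, D x y → b (x, y) ≤ C x := by
  obtain ⟨f, c, hf, hm, h⟩ := h
  refine ⟨fun x => f (κ x) * (B x + 1) ^ c, (of_param hf hm).mul ((hB.add (const 1)).pow c),
    fun x y hy => (h (x, y)).trans ?_⟩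
  have := hs x y hy
  dsimp only
  gcongr

end FB

/-! ## Types with an encoding -/

/-- Types whose elements are encoded by trees. -/
class Enc (α : Type) where
  enc : α → Data
  enc_injective : Function.Injective enc

open Enc (enc)

instance : Enc Data := ⟨id, Function.injective_id⟩
instance : Enc ℕ := ⟨encNat, encNat_injective⟩
instance : Enc Bool := ⟨encBool, encBool_injective⟩
instance {α : Type} [Enc α] : Enc (List α) := ⟨encList enc, encList_injective Enc.enc_injective⟩
instance {α β : Type} [Enc α] [Enc β] : Enc (α × β) :=
  ⟨encPair enc enc, encPair_injective Enc.enc_injective Enc.enc_injective⟩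
instance : Enc Action := ⟨encAction, encAction_injective⟩
instance : Enc CaseModData := ⟨encCaseMod, encCaseMod_injective⟩

/-- The size of the encoding. -/
def sz {α : Type} [Enc α] (a : α) : ℕ := (enc a).size

section Sizes

variable {α β : Type} [Enc α] [Enc β]

theorem Data.one_le_size (d : Data) : 1 ≤ d.size := by cases d <;> simp [Data.size]

theorem one_le_sz (a : α) : 1 ≤ sz a := Data.one_le_size _

theorem sz_pair (a : α) (b : β) : sz (a, b) = sz a + sz b + 1 := rfl

@[simp] theorem sz_nil : sz ([] : List α) = 1 := rfl

theorem sz_cons (a : α) (l : List α) : sz (a :: l) = sz a + sz l + 1 := rfl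

theorem sz_append (l l' : List α) : sz (l ++ l') + 1 = sz l + sz l' := by
  induction l with
  | nil => simp [add_comm]
  | cons a l ih => simp only [List.cons_append, sz_cons]; omega

theorem sz_reverse (l : List α) : sz l.reverse = sz l := by
  induction l with
  | nil => rfl
  | cons a l ih =>
    have := sz_append l.reverse [a]
    simp only [List.reverse_cons, sz_cons, sz_nil] at *; omega

theorem sz_le_of_mem {a : α} {l : List α} (h : a ∈ l) : sz a < sz l := by
  induction l with
  | nil => simp at h
  | cons b l ih =>
    rw [sz_cons]
    rcases List.mem_cons.1 h with rfl | h
    · have := one_le_sz l; omega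
    · have := ih h; omega

theorem length_le_sz (l : List α) : l.length < sz l := by
  induction l with
  | nil => simp
  | cons a l ih => rw [sz_cons, List.length_cons]; omega

theorem sz_le_of_forall {l : List α} {B : ℕ} (h : ∀ a ∈ l, sz a ≤ B) :
    sz l ≤ l.length * (B + 1) + 1 := by
  induction l with
  | nil => simp
  | cons a l ih =>
    have h1 := h a (by simp)
    have h2 := ih (fun b hb => h b (by simp [hb]))
    rw [sz_cons, List.length_cons, Nat.succ_mul]; omega

theorem sz_nat (n : ℕ) : sz n = 2 * n + 1 := by
  induction n with
  | zero => rfl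
  | succ n ih =>
    have : sz (n + 1) = 1 + sz n + 1 := rfl
    omega

end Sizes

/-! ## Computation at bounded cost -/

theorem Expr.size_eval_le_cost (σ : Store) (E : Expr) : (E.eval σ).size ≤ E.cost σ := by
  cases E <;> simp only [Expr.eval, Expr.cost, Data.size] <;> omega

/-- Within cost `f(κ) * size(e) ^ c` one can compute `F` from `e`. The program may use the
registers from a given one on, which holds the argument and receives the result. -/
def FC {ι α β : Type} [Enc α] [Enc β] (κ : ι → ℕ) (e : ι → α) (F : ι → β) : Prop :=
  ∃ b : ι → ℕ, FB κ (fun x => sz (e x)) b ∧ (∀ x, sz (F x) ≤ b x) ∧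
    ∀ m : ℕ, ∃ p : Prog, ∀ (x : ι) (σ : Store), σ m = enc (e x) →
      ∃ (τ : Store) (t : ℕ), Exec p σ τ t ∧ (∀ j < m, τ j = σ j) ∧ τ m = enc (F x) ∧ t ≤ b x

namespace FC

/-- The parameter in the body of a loop. -/
def lift {ι β : Type} (κ : ι → ℕ) : ι × β → ℕ := fun y => κ y.1

/-- The argument in the body of a loop. -/
def ext {ι α β : Type} (e : ι → α) : ι × β → α × β := fun y => (e y.1, y.2)

variable {ι ι' α β γ δ : Type} [Enc α] [Enc β] [Enc γ] [Enc δ] {κ : ι → ℕ} {e : ι → α}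

theorem size_bound {F : ι → β} (h : FC κ e F) : FB κ (fun x => sz (e x)) (fun x => sz (F x)) := by
  obtain ⟨b, hb, hs, -⟩ := h
  exact hb.mono hs

/-- Evaluation of a single expression. -/
theorem of_expr {F : ι → β} (E : ℕ → Expr) {b : ι → ℕ} (hb : FB κ (fun x => sz (e x)) b)
    (hE : ∀ m x σ, σ m = enc (e x) → (E m).eval σ = enc (F x) ∧ (E m).cost σ ≤ b x) : FC κ e F := by
  refine ⟨fun x => b x + 1, hb.add (FB.const 1), fun x => ?_, fun m => ⟨.assign m (E m), ?_⟩⟩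
  · have h := hE 0 x (fun _ => enc (e x)) rfl
    have := Expr.size_eval_le_cost (fun _ => enc (e x)) (E 0)
    rw [h.1] at this
    exact (this.trans h.2).trans (Nat.le_succ _)
  · intro x σ hσ
    refine ⟨_, _, .assign m (E m) σ, fun j hj => ?_, ?_, ?_⟩
    · simp [Function.update_of_ne hj.ne]
    · simp [(hE m x σ hσ).1]
    · have := (hE m x σ hσ).2; dsimp only; omega

/-- Change of the types of argument and result, with the same encodings. -/
theorem recode {e' : ι → γ} {F : ι → β} {F' : ι → δ} (h : FC κ e F)
    (he : ∀ x, enc (e' x) = enc (e x)) (hF : ∀ x, enc (F' x) = enc (F x)) : FC κ e' F' := by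
  obtain ⟨b, hb, hs, hp⟩ := h
  have he' : (fun x => sz (e' x)) = fun x => sz (e x) := funext fun x => by simp only [sz, he]
  refine ⟨b, he' ▸ hb, fun x => by simpa only [sz, hF] using hs x, fun m => ?_⟩
  obtain ⟨p, hp⟩ := hp m
  refine ⟨p, fun x σ hσ => ?_⟩
  rw [hF]
  exact hp x σ (hσ.trans (he x))

theorem reindex {F : ι → β} (h : FC κ e F) (g : ι' → ι) :
    FC (fun x => κ (g x)) (fun x => e (g x)) (fun x => F (g x)) := by
  obtain ⟨b, hb, hs, hp⟩ := h
  refine ⟨fun x => b (g x), hb.comp g, fun x => hs _, fun m => ?_⟩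
  obtain ⟨p, hp⟩ := hp m
  exact ⟨p, fun x => hp (g x)⟩

/-- The second cost is bounded in terms of the size of the intermediate value, which the first bound
controls. This is why `FC` includes a bound on the size of the result. -/
theorem comp {F : ι → β} {G : ι → γ} (h : FC κ e F) (h' : FC κ F G) : FC κ e G := by
  obtain ⟨b, hb, hs, hp⟩ := h
  obtain ⟨b', hb', hs', hp'⟩ := h'
  have hb'' : FB κ (fun x => sz (e x)) b' := hb'.trans (hb.mono hs)
  refine ⟨fun x => b x + b' x, hb.add hb'', fun x => (hs' x).trans (Nat.le_add_left _ _),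
    fun m => ?_⟩
  obtain ⟨p, hp⟩ := hp m
  obtain ⟨p', hp'⟩ := hp' m
  refine ⟨.seq p p', fun x σ hσ => ?_⟩
  obtain ⟨τ, t, h1, h2, h3, h4⟩ := hp x σ hσ
  obtain ⟨υ, u, h5, h6, h7, h8⟩ := hp' x τ h3
  exact ⟨υ, t + u, .seq h1 h5, fun j hj => (h6 j hj).trans (h2 j hj), h7, add_le_add h4 h8⟩

protected theorem id : FC κ e e :=
  of_expr (fun m => .reg m) FB.self fun m x σ hσ => ⟨hσ, by simp [Expr.cost, hσ, sz]⟩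

theorem const (c : β) : FC κ e (fun _ => c) := by
  have key : ∀ d : Data, ∃ E : Expr, ∃ n, ∀ σ, E.eval σ = d ∧ E.cost σ = n := by
    intro d
    induction d with
    | nil => exact ⟨.nil, 1, fun σ => ⟨rfl, rfl⟩⟩
    | cons a b iha ihb =>
      obtain ⟨E, n, hE⟩ := iha
      obtain ⟨E', n', hE'⟩ := ihb
      refine ⟨.cons E E', n + n' + (Data.cons a b).size, fun σ => ?_⟩
      simp [Expr.eval, Expr.cost, (hE σ).1, (hE σ).2, (hE' σ).1, (hE' σ).2]
  obtain ⟨E, n, hE⟩ := key (enc c)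
  exact of_expr (fun _ => E) (FB.const n) fun m x σ _ => ⟨(hE σ).1, (hE σ).2.le⟩

theorem fst_snd_self {F : ι → β} {G : ι → γ} :
    FC κ (fun x => (F x, G x)) F ∧ FC κ (fun x => (F x, G x)) G := by
  have hb : FB κ (fun x => sz (F x, G x)) (fun x => 2 * sz (F x, G x)) := (FB.const 2).mul FB.self
  constructor
  · refine of_expr (fun m => .hd (.reg m)) hb fun m x σ hσ => ?_
    simp only [Expr.eval, Expr.cost, hσ]
    refine ⟨rfl, ?_⟩
    change sz (F x, G x) + sz (F x) ≤ _
    rw [sz_pair]; omega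
  · refine of_expr (fun m => .tl (.reg m)) hb fun m x σ hσ => ?_
    simp only [Expr.eval, Expr.cost, hσ]
    refine ⟨rfl, ?_⟩
    change sz (F x, G x) + sz (G x) ≤ _
    rw [sz_pair]; omega

theorem fst {F : ι → β × γ} (h : FC κ e F) : FC κ e (fun x => (F x).1) :=
  h.comp (fst_snd_self (F := fun x => (F x).1) (G := fun x => (F x).2)).1

theorem snd {F : ι → β × γ} (h : FC κ e F) : FC κ e (fun x => (F x).2) :=
  h.comp (fst_snd_self (F := fun x => (F x).1) (G := fun x => (F x).2)).2

/-- In the body of a loop: a value from outside of the loop. -/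
theorem wk {F : ι → β} (h : FC κ e F) :
    FC (lift κ) (ext e) (fun y : ι × γ => F y.1) :=
  fst_snd_self.1.comp (h.reindex Prod.fst)

/-- In the body of a loop: the loop variable. -/
theorem arg : FC (lift κ) (ext e) (fun y : ι × γ => y.2) :=
  fst_snd_self.2

/-- The two programs run on copies of the argument in registers `m + 1` and `m + 2`. A program
working from register `m + 2` on leaves the first result alone. -/
theorem pair {F : ι → β} {G : ι → γ} (h : FC κ e F) (h' : FC κ e G) :
    FC κ e (fun x => (F x, G x)) := by
  obtain ⟨b, hb, hs, hp⟩ := h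
  obtain ⟨b', hb', hs', hp'⟩ := h'
  refine ⟨fun x => 2 * sz (e x) + 3 * (b x + b' x) + 4,
    (((FB.const 2).mul FB.self).add ((FB.const 3).mul (hb.add hb'))).add (FB.const 4),
    fun x => ?_, fun m => ?_⟩
  · have := hs x; have := hs' x
    dsimp only
    rw [sz_pair]; omega
  obtain ⟨p, hp⟩ := hp (m + 1)
  obtain ⟨p', hp'⟩ := hp' (m + 2)
  refine ⟨.seq (.seq (.assign (m + 1) (.reg m)) p) (.seq (.seq (.assign (m + 2) (.reg m)) p')
    (.assign m (.cons (.reg (m + 1)) (.reg (m + 2))))), fun x σ hσ => ?_⟩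
  obtain ⟨τ, t, h1, h2, h3, h4⟩ := hp x (Function.update σ (m + 1) (σ m)) (by simp [hσ])
  have h2m : τ m = σ m := by rw [h2 m (by omega), Function.update_of_ne (by omega)]
  obtain ⟨υ, u, h5, h6, h7, h8⟩ := hp' x (Function.update τ (m + 2) (τ m)) (by simp [h2m, hσ])
  have h6m : υ (m + 1) = τ (m + 1) := by rw [h6 _ (by omega), Function.update_of_ne (by omega)]
  refine ⟨_, _, .seq (.seq (.assign _ _ _) h1) (.seq (.seq (.assign _ _ _) h5) (.assign _ _ _)),
    fun j hj => ?_, ?_, ?_⟩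
  · rw [Function.update_of_ne (by omega), h6 j (by omega), Function.update_of_ne (by omega),
      h2 j (by omega), Function.update_of_ne (by omega)]
  · simp only [Function.update_self, Expr.eval, h6m, h3, h7]; rfl
  · simp only [Expr.cost, Expr.eval, h6m, h3, h7, h2m, hσ, Data.size]
    have := hs x; have := hs' x
    simp only [sz] at *
    omega

theorem ite {c : ι → Prop} [∀ x, Decidable (c x)] {F G : ι → β}
    (hc : FC κ e (fun x => decide (c x))) (h : FC κ e F) (h' : FC κ e G) :
    FC κ e (fun x => if c x then F x else G x) := by
  obtain ⟨a, ha, -, hq⟩ := hc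
  obtain ⟨b, hb, hs, hp⟩ := h
  obtain ⟨b', hb', hs', hp'⟩ := h'
  refine ⟨fun x => sz (e x) + a x + b x + b' x + 5,
    (((FB.self.add ha).add hb).add hb').add (FB.const 5), fun x => ?_, fun m => ?_⟩
  · have := hs x; have := hs' x
    dsimp only
    split_ifs <;> omega
  obtain ⟨q, hq⟩ := hq (m + 1)
  obtain ⟨p, hp⟩ := hp m
  obtain ⟨p', hp'⟩ := hp' m
  refine ⟨.seq (.seq (.assign (m + 1) (.reg m)) q) (.ite (.reg (m + 1)) p p'), fun x σ hσ => ?_⟩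
  obtain ⟨τ, t, h1, h2, h3, h4⟩ := hq x (Function.update σ (m + 1) (σ m)) (by simp [hσ])
  have h2m : τ m = enc (e x) := by rw [h2 m (by omega), Function.update_of_ne (by omega), hσ]
  have h2j : ∀ j < m, τ j = σ j := fun j hj => by
    rw [h2 j (by omega), Function.update_of_ne (by omega)]
  by_cases hx : c x
  · obtain ⟨υ, u, h5, h6, h7, h8⟩ := hp x τ h2m
    refine ⟨υ, _, .seq (.seq (.assign _ _ _) h1) (.ite_true ?_ h5),
      fun j hj => (h6 j hj).trans (h2j j hj), by simp [h7, hx], ?_⟩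
    · simp [Expr.eval, h3, hx, enc, encBool]
    · simp only [Expr.cost, hσ, h3, hx, decide_true, sz]
      have : (enc true).size = 3 := rfl
      omega
  · obtain ⟨υ, u, h5, h6, h7, h8⟩ := hp' x τ h2m
    refine ⟨υ, _, .seq (.seq (.assign _ _ _) h1) (.ite_false ?_ h5),
      fun j hj => (h6 j hj).trans (h2j j hj), by simp [h7, hx], ?_⟩
    · simp [Expr.eval, h3, hx, enc, encBool]
    · simp only [Expr.cost, hσ, h3, hx, decide_false, sz]
      have : (enc false).size = 1 := rfl
      omega

theorem eq [DecidableEq β] {F G : ι → β} (h : FC κ e F) (h' : FC κ e G) :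
    FC κ e (fun x => decide (F x = G x)) := by
  refine (h.pair h').comp (of_expr (b := fun x => 4 * sz (F x, G x) + 3)
    (fun m => .eq (.hd (.reg m)) (.tl (.reg m)))
    (((FB.const 4).mul FB.self).add (FB.const 3)) fun m x σ hσ => ?_)
  have h1 : (Data.hd (σ m)) = enc (F x) := by rw [hσ]; rfl
  have h2 : (Data.tl (σ m)) = enc (G x) := by rw [hσ]; rfl
  have h3 : (σ m).size = sz (F x, G x) := by rw [hσ]; rfl
  have h4 : sz (F x, G x) = (enc (F x)).size + (enc (G x)).size + 1 := sz_pair _ _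
  simp only [Expr.eval, Expr.cost, h1, h2, h3, Enc.enc_injective.eq_iff]
  by_cases hx : F x = G x
  · simp only [hx, if_true, decide_true, Data.size] at *
    refine ⟨rfl, by omega⟩
  · simp only [hx, if_false, decide_false, Data.size] at *
    refine ⟨rfl, by omega⟩

end FC

/-! ### Loops over lists -/

namespace FC

variable {ι ι' α β γ δ : Type} [Enc α] [Enc β] [Enc γ] [Enc δ] {κ : ι → ℕ} {e : ι → α}

/-- The loop keeps the outer argument in register `m`, the rest of the list in `m + 1` and the
accumulator in `m + 2`; register `m + 3` is the argument and result of the body. The induction is on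
the unprocessed suffix, and `B` only has to bound the accumulators reached after prefixes of `l`. -/
theorem exec_loop {m : ℕ} {p : Prog} {l : List β} {init : γ} {step : γ → β → γ} {E : Data}
    {B C S : ℕ} (hE : E.size ≤ S) (hl : sz l ≤ S)
    (hB : ∀ pre, pre <+: l → sz (pre.foldl step init) ≤ B)
    (hp : ∀ a b, sz a ≤ B → sz b ≤ S → ∀ σ : Store, σ (m + 3) = .cons E (.cons (enc a) (enc b)) →
      ∃ (τ : Store) (t : ℕ), Exec p σ τ t ∧ (∀ j < m + 3, τ j = σ j) ∧ τ (m + 3) = enc (step a b) ∧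
        t ≤ C) :
    ∀ (pre suf : List β), pre ++ suf = l → ∀ σ : Store, σ m = E → σ (m + 1) = enc suf →
      σ (m + 2) = enc (pre.foldl step init) →
      ∃ (τ : Store) (t : ℕ),
        Exec (.loop (.reg (m + 1))
          (.seq (.assign (m + 3) (.cons (.reg m) (.cons (.reg (m + 2)) (.hd (.reg (m + 1))))))
            (.seq (.assign (m + 1) (.tl (.reg (m + 1))))
              (.seq p (.assign (m + 2) (.reg (m + 3))))))) σ τ t ∧
        (∀ j < m, τ j = σ j) ∧ τ (m + 2) = enc (l.foldl step init) ∧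
        t ≤ (suf.length + 1) * (10 * S + 5 * B + C + 10) := by
  intro pre suf
  induction suf generalizing pre with
  | nil =>
    intro h σ h0 h1 h2
    refine ⟨σ, _, .loop_false h1, fun _ _ => rfl, ?_, ?_⟩
    · rw [h2, ← h, List.append_nil]
    · simp only [Expr.cost, h1]
      have : (enc ([] : List β)).size = 1 := rfl
      simp only [List.length_nil]
      omega
  | cons b suf ih =>
    intro h σ h0 h1 h2
    have h1' : σ (m + 1) = .cons (enc b) (enc suf) := h1
    have hpre := hB pre ⟨_, h⟩
    have hb : sz b < sz l := sz_le_of_mem (by simp [← h])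
    have hsuf : sz (b :: suf) ≤ sz l := by
      have := sz_append pre (b :: suf)
      rw [h] at this
      have := one_le_sz pre
      omega
    set σ1 := Function.update σ (m + 3) (.cons E (.cons (enc (pre.foldl step init)) (enc b)))
      with hσ1
    set σ2 := Function.update σ1 (m + 1) (enc suf) with hσ2
    obtain ⟨τ, t, e1, e2, e3, e4⟩ := hp (pre.foldl step init) b hpre (by omega) σ2
      (by simp [hσ2, hσ1])
    obtain ⟨υ, u, f1, f2, f3, f4⟩ := ih (pre ++ [b]) (by simp [← h])
      (Function.update τ (m + 2) (τ (m + 3)))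
      (by rw [Function.update_of_ne (by omega), e2 _ (by omega)]; simp [hσ2, hσ1, h0])
      (by rw [Function.update_of_ne (by omega), e2 _ (by omega)]; simp [hσ2])
      (by simp [e3])
    have hx1 : Exec (.assign (m + 3) (.cons (.reg m) (.cons (.reg (m + 2)) (.hd (.reg (m + 1)))))) σ
        σ1 (Expr.cost σ (.cons (.reg m) (.cons (.reg (m + 2)) (.hd (.reg (m + 1))))) + 1) := by
      have := Exec.assign (m + 3) (.cons (.reg m) (.cons (.reg (m + 2)) (.hd (.reg (m + 1))))) σ
      simpa only [Expr.eval, h0, h1', h2, Data.hd] using this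
    have hx2 : Exec (.assign (m + 1) (.tl (.reg (m + 1)))) σ1 σ2
        (Expr.cost σ1 (.tl (.reg (m + 1))) + 1) := by
      have := Exec.assign (m + 1) (.tl (.reg (m + 1))) σ1
      have h : σ1 (m + 1) = .cons (enc b) (enc suf) := by simp [hσ1, h1']
      simpa only [Expr.eval, h, Data.tl] using this
    refine ⟨υ, _, .loop_true ?_ (.seq hx1 (.seq hx2 (.seq e1 (.assign _ _ _)))) f1, ?_, f3, ?_⟩
    · simp [Expr.eval, h1']
    · intro j hj
      rw [f2 j hj, Function.update_of_ne (by omega), e2 j (by omega)]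
      simp [hσ2, hσ1, Function.update_of_ne (show j ≠ m + 1 by omega),
        Function.update_of_ne (show j ≠ m + 3 by omega)]
    · have hs3 : τ (m + 3) = enc (((pre ++ [b]).foldl step init)) := by simp [e3]
      have hB' := hB (pre ++ [b]) ⟨suf, by simp [← h]⟩
      have g1 : σ1 (m + 1) = .cons (enc b) (enc suf) := by simp [hσ1, h1']
      simp only [Expr.cost, Expr.eval, h0, h1', h2, hs3, g1, Data.hd, Data.tl, Data.size]
      rw [sz_cons] at hsuf
      simp only [List.length_cons]
      have : (suf.length + 1 + 1) * (10 * S + 5 * B + C + 10) =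
        (suf.length + 1) * (10 * S + 5 * B + C + 10) + (10 * S + 5 * B + C + 10) := by ring
      rw [this]
      simp only [sz] at *
      omega

/-- An fpt bound on one step does not prevent the accumulator from growing with each iteration, so
an fpt bound `B` on all accumulators is required separately. -/
theorem foldl {l : ι → List β} {init : ι → γ} {step : ι → γ → β → γ} {B : ι → ℕ}
    (hB : FB κ (fun x => sz (e x)) B)
    (hacc : ∀ x pre, pre <+: l x → sz (pre.foldl (step x) (init x)) ≤ B x)
    (hl : FC κ e l) (hi : FC κ e init)
    (hstep : FC (lift κ) (ext e)
      (fun y : ι × γ × β => step y.1 y.2.1 y.2.2)) :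
    FC κ e (fun x => (l x).foldl (step x) (init x)) := by
  obtain ⟨bl, hbl, hsl, hpl⟩ := hl
  obtain ⟨bi, hbi, hsi, hpi⟩ := hi
  obtain ⟨bs, hbs, hss, hps⟩ := hstep
  have hS : FB κ (fun x => sz (e x)) (fun x => sz (e x) + bl x) := FB.self.add hbl
  -- The cost of the body depends on the accumulator and the entry. Both have bounded size, so a
  -- single bound `C x` serves all iterations.
  obtain ⟨C, hC, hbC⟩ := hbs.uniform (D := fun x (y : γ × β) => sz y.1 ≤ B x ∧
      sz y.2 ≤ sz (e x) + bl x) (((hS.add hB).add hS).add (FB.const 2)) (fun x y hy => by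
    have h1 : sz (ext e (x, y)) = sz (e x) + (sz y.1 + sz y.2 + 1) + 1 := rfl
    omega)
  refine ⟨fun x => (bl x + 1) * (10 * (sz (e x) + bl x) + 5 * B x + C x + 10) +
      (2 * sz (e x) + bl x + bi x + B x + 10),
    ((hbl.add (FB.const 1)).mul
      (((((FB.const 10).mul hS).add ((FB.const 5).mul hB)).add hC).add (FB.const 10))).add
      ((((((FB.const 2).mul FB.self).add hbl).add hbi).add hB).add (FB.const 10)),
    fun x => ?_, fun m => ?_⟩
  · have := hacc x (l x) (List.prefix_refl _)
    dsimp only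
    omega
  obtain ⟨pl, hpl⟩ := hpl (m + 1)
  obtain ⟨pi, hpi⟩ := hpi (m + 2)
  obtain ⟨ps, hps⟩ := hps (m + 3)
  refine ⟨.seq (.seq (.assign (m + 1) (.reg m)) pl) (.seq (.seq (.assign (m + 2) (.reg m)) pi)
    (.seq (.loop (.reg (m + 1))
          (.seq (.assign (m + 3) (.cons (.reg m) (.cons (.reg (m + 2)) (.hd (.reg (m + 1))))))
            (.seq (.assign (m + 1) (.tl (.reg (m + 1))))
              (.seq ps (.assign (m + 2) (.reg (m + 3)))))))
      (.assign m (.reg (m + 2))))), fun x σ hσ => ?_⟩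
  obtain ⟨τ, t, h1, h2, h3, h4⟩ := hpl x (Function.update σ (m + 1) (σ m)) (by simp [hσ])
  have h2m : τ m = enc (e x) := by rw [h2 m (by omega), Function.update_of_ne (by omega), hσ]
  obtain ⟨υ, u, h5, h6, h7, h8⟩ := hpi x (Function.update τ (m + 2) (τ m)) (by simp [h2m])
  have h6m : υ m = enc (e x) := by rw [h6 _ (by omega), Function.update_of_ne (by omega), h2m]
  have h6m' : υ (m + 1) = enc (l x) := by
    rw [h6 _ (by omega), Function.update_of_ne (by omega), h3]
  obtain ⟨ω, w, g1, g2, g3, g4⟩ := exec_loop (m := m) (p := ps) (l := l x) (init := init x)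
    (step := step x) (E := enc (e x)) (B := B x) (C := C x) (S := sz (e x) + bl x)
    (Nat.le_add_right _ _) ((hsl x).trans (Nat.le_add_left _ _)) (hacc x)
    (fun a b ha hb σ hσ => by
      obtain ⟨τ, t, k1, k2, k3, k4⟩ := hps (x, a, b) σ hσ
      exact ⟨τ, t, k1, k2, k3, k4.trans (hbC x (a, b) ⟨ha, hb⟩)⟩)
    [] (l x) rfl υ h6m h6m' h7
  refine ⟨_, _, .seq (.seq (.assign _ _ _) h1) (.seq (.seq (.assign _ _ _) h5)
    (.seq g1 (.assign _ _ _))), fun j hj => ?_, ?_, ?_⟩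
  · rw [Function.update_of_ne (by omega), g2 j hj, h6 j (by omega),
      Function.update_of_ne (by omega), h2 j (by omega), Function.update_of_ne (by omega)]
  · simp [Expr.eval, g3]
  · have hw : w ≤ (bl x + 1) * (10 * (sz (e x) + bl x) + 5 * B x + C x + 10) := by
      refine g4.trans (Nat.mul_le_mul_right _ ?_)
      have := length_le_sz (l x); have := hsl x
      omega
    have := hacc x (l x) (List.prefix_refl _)
    simp only [Expr.cost, hσ, h2m, g3]
    simp only [sz] at *
    omega

/-! ### Lists -/

theorem cons {a : ι → β} {l : ι → List β} (ha : FC κ e a) (hl : FC κ e l) :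
    FC κ e (fun x => a x :: l x) :=
  (ha.pair hl).recode (fun _ => rfl) (fun _ => rfl)

theorem nil : FC κ e (fun _ => ([] : List β)) := const _

theorem reverse_append {l l' : ι → List β} (hl : FC κ e l) (hl' : FC κ e l') :
    FC κ e (fun x => (l x).reverse ++ l' x) := by
  have key : ∀ (l l' : List β), l.foldl (fun acc b => b :: acc) l' = l.reverse ++ l' := by
    intro l
    induction l with
    | nil => intro l'; rfl
    | cons a l ih => intro l'; simp [ih]
  have h := FC.foldl (e := e) (κ := κ) (l := l) (init := l') (step := fun _ acc b => b :: acc)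
    (B := fun x => sz (l x) + sz (l' x)) (hl.size_bound.add hl'.size_bound) ?_ hl hl' ?_
  · simpa only [key] using h
  · rintro x pre ⟨suf, h⟩
    have h1 := sz_append pre.reverse (l' x)
    have h2 := sz_append pre suf
    rw [key]
    rw [h] at h2
    rw [sz_reverse] at h1
    have := one_le_sz suf
    omega
  · exact arg.snd.cons arg.fst

theorem reverse {l : ι → List β} (hl : FC κ e l) : FC κ e (fun x => (l x).reverse) := by
  simpa using hl.reverse_append (nil (β := β))

theorem append {l l' : ι → List β} (hl : FC κ e l) (hl' : FC κ e l') :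
    FC κ e (fun x => l x ++ l' x) := by
  simpa using hl.reverse.reverse_append hl'

theorem flatMap {l : ι → List β} {f : ι → β → List γ} (hl : FC κ e l)
    (hf : FC (lift κ) (ext e) (fun y : ι × β => f y.1 y.2)) :
    FC κ e (fun x => (l x).flatMap (f x)) := by
  -- Entries of `l x` are smaller than `l x`, so all blocks `f x b` share the size bound `C x`.
  obtain ⟨C, hC, hbC⟩ := hf.size_bound.uniform (s' := fun x => sz (e x))
    (B := fun x => sz (e x) + sz (l x) + 1)
    (D := fun x (b : β) => b ∈ l x) ((FB.self.add hl.size_bound).add (FB.const 1))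
    (fun x b hb => by have := sz_le_of_mem hb; have h : sz (ext e (x, b)) = sz (e x) + sz b + 1 := rfl; rw [h]; omega)
  have h := FC.foldl (e := e) (κ := κ) (l := l) (init := fun _ => ([] : List γ))
    (step := fun x acc b => acc ++ f x b) (B := fun x => sz (l x) * C x + 1)
    ((hl.size_bound.mul hC).add (FB.const 1)) ?_ hl nil ?_
  · simpa only [List.flatMap_eq_foldl] using h
  · rintro x pre ⟨suf, h⟩
    have key : ∀ pre : List β, (∀ b ∈ pre, b ∈ l x) →
        sz (pre.flatMap (f x)) ≤ pre.length * C x + 1 := by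
      intro pre
      induction pre with
      | nil => intro _; simp
      | cons a pre ih =>
        intro hp
        have h1 := ih (fun b hb => hp b (by simp [hb]))
        have h2 := hbC x a (hp a (by simp))
        have h3 := sz_append (f x a) (pre.flatMap (f x))
        rw [List.flatMap_cons, List.length_cons, Nat.succ_mul]
        dsimp only at h2
        omega
    rw [← List.flatMap_eq_foldl]
    refine (key pre fun b hb => by simp [← h, hb]).trans ?_
    have := length_le_sz (l x)
    have h4 : pre.length ≤ sz (l x) := by rw [← h] at *; simp at *; omega
    gcongr
  · refine arg.fst.append ?_
    have := (hf.reindex (ι' := ι × List γ × β) (fun y => (y.1, y.2.2)))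
    refine FC.comp ?_ this
    exact FC.id.wk.pair arg.snd

theorem map {l : ι → List β} {f : ι → β → γ} (hl : FC κ e l)
    (hf : FC (lift κ) (ext e) (fun y : ι × β => f y.1 y.2)) :
    FC κ e (fun x => (l x).map (f x)) := by
  simpa only [← List.map_eq_flatMap] using hl.flatMap (f := fun x b => [f x b]) (hf.cons nil)

theorem filter {l : ι → List β} {p : ι → β → Bool} (hl : FC κ e l)
    (hp : FC (lift κ) (ext e) (fun y : ι × β => p y.1 y.2)) :
    FC κ e (fun x => (l x).filter (p x)) := by
  have h := hl.flatMap (f := fun x b => if p x b then [b] else [])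
    (ite (by simpa using hp) (arg.cons nil) nil)
  refine h.recode (fun _ => rfl) fun x => congrArg _ ?_
  induction l x with
  | nil => rfl
  | cons a l ih => by_cases h : p x a <;> simp [h, ih]

theorem not {c : ι → Prop} [∀ x, Decidable (c x)] (hc : FC κ e (fun x => decide (c x))) :
    FC κ e (fun x => decide (¬ c x)) := by
  have := hc.ite (const false) (const true)
  refine this.recode (fun _ => rfl) fun x => congrArg _ ?_
  by_cases h : c x <;> simp [h]

theorem and {c d : ι → Prop} [∀ x, Decidable (c x)] [∀ x, Decidable (d x)]
    (hc : FC κ e (fun x => decide (c x))) (hd : FC κ e (fun x => decide (d x))) :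
    FC κ e (fun x => decide (c x ∧ d x)) := by
  have := hc.ite hd (const false)
  refine this.recode (fun _ => rfl) fun x => congrArg _ ?_
  by_cases h : c x <;> simp [h]

theorem or {c d : ι → Prop} [∀ x, Decidable (c x)] [∀ x, Decidable (d x)]
    (hc : FC κ e (fun x => decide (c x))) (hd : FC κ e (fun x => decide (d x))) :
    FC κ e (fun x => decide (c x ∨ d x)) := by
  have := hc.ite (const true) hd
  refine this.recode (fun _ => rfl) fun x => congrArg _ ?_
  by_cases h : c x <;> simp [h]

theorem bool {c : ι → Bool} (hc : FC κ e c) : FC κ e (fun x => decide (c x = true)) := by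
  simpa using hc

theorem forall_mem [DecidableEq β] {l : ι → List β} {p : ι → β → Prop}
    [∀ x b, Decidable (p x b)] (hl : FC κ e l)
    (hp : FC (lift κ) (ext e) (fun y : ι × β => decide (p y.1 y.2))) :
    FC κ e (fun x => decide (∀ b ∈ l x, p x b)) := by
  have h := (hl.filter (p := fun x b => decide (¬ p x b)) hp.not).eq (nil (β := β))
  refine h.recode (fun _ => rfl) fun x => congrArg _ ?_
  simp

theorem mem [DecidableEq β] {a : ι → β} {l : ι → List β} (ha : FC κ e a) (hl : FC κ e l) :
    FC κ e (fun x => decide (a x ∈ l x)) := by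
  have h := (hl.forall_mem (p := fun x b => ¬ a x = b) (ha.wk.eq arg).not).not
  refine h.recode (fun _ => rfl) fun x => congrArg _ ?_
  simp

/-- Replacing all entries by `nil` turns the encoding of a list into the unary numeral of its
length. -/
theorem length {l : ι → List β} (hl : FC κ e l) : FC κ e (fun x => (l x).length) := by
  refine (hl.map (f := fun _ _ => Data.nil) (const _)).recode (fun _ => rfl) fun x => ?_
  induction l x with
  | nil => rfl
  | cons a l ih => exact congrArg (Data.cons Data.nil) ih

theorem dedup [DecidableEq β] {l : ι → List β} (hl : FC κ e l) :
    FC κ e (fun x => (l x).dedup) := by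
  -- `List.dedup` keeps the last of equal entries, hence the traversal from the end.
  have key : ∀ l : List β, l.reverse.foldl (fun acc b => if b ∈ acc then acc else b :: acc) [] =
      l.dedup := by
    intro l
    induction l with
    | nil => rfl
    | cons a l ih =>
      rw [List.reverse_cons, List.foldl_append, ih, List.foldl_cons, List.foldl_nil]
      by_cases h : a ∈ l
      · rw [if_pos (List.mem_dedup.2 h), List.dedup_cons_of_mem h]
      · rw [if_neg (mt List.mem_dedup.1 h), List.dedup_cons_of_notMem h]
  have h := FC.foldl (e := e) (κ := κ) (l := fun x => (l x).reverse) (init := fun _ => [])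
    (step := fun _ acc b => if b ∈ acc then acc else b :: acc) (B := fun x => sz (l x))
    hl.size_bound ?_ hl.reverse nil ?_
  · simpa only [key] using h
  · rintro x pre ⟨suf, h⟩
    have h1 : sz pre ≤ sz (l x) := by
      have := sz_append pre suf
      rw [h, sz_reverse] at this
      have := one_le_sz suf
      omega
    refine le_trans ?_ h1
    have : pre.foldl (fun acc b => if b ∈ acc then acc else b :: acc) [] = pre.reverse.dedup := by
      rw [← key, List.reverse_reverse]
    rw [this, ← sz_reverse pre]
    generalize pre.reverse = r
    induction r with
    | nil => simp
    | cons a r ih =>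
      by_cases h : a ∈ r
      · rw [List.dedup_cons_of_mem h, sz_cons]; omega
      · rw [List.dedup_cons_of_notMem h, sz_cons, sz_cons]; omega
  · exact ite (arg.snd.mem arg.fst) arg.fst (arg.snd.cons arg.fst)

/-- `Data.hd` returns `nil` on the empty list, so a default encoded by `nil` costs no case
distinction. -/
theorem headD {l : ι → List β} (hl : FC κ e l) {d : β} (hd : enc d = Data.nil) :
    FC κ e (fun x => (l x).headD d) := by
  refine hl.comp (of_expr (fun m => .hd (.reg m)) ((FB.const 2).mul FB.self) fun m x σ hσ => ?_)
  simp only [Expr.eval, Expr.cost, hσ]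
  cases h : l x with
  | nil => exact ⟨hd.symm, by simp [sz, enc, encList, Data.hd, Data.size]⟩
  | cons a t =>
    refine ⟨rfl, ?_⟩
    change sz (a :: t) + sz a ≤ 2 * sz (a :: t)
    rw [sz_cons]; omega

theorem enc_replicate (n : ℕ) : enc (List.replicate n Data.nil) = enc n := by
  induction n with
  | zero => rfl
  | succ n ih => exact congrArg (Data.cons Data.nil) ih

theorem add {a b : ι → ℕ} (ha : FC κ e a) (hb : FC κ e b) : FC κ e (fun x => a x + b x) := by
  have key : ∀ {a : ι → ℕ}, FC κ e a → FC κ e (fun x => List.replicate (a x) Data.nil) :=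
    fun h => h.recode (fun _ => rfl) fun x => enc_replicate _
  refine ((key ha).append (key hb)).recode (fun _ => rfl) fun x => ?_
  rw [← List.replicate_add, enc_replicate]

/-- Bounded iteration. -/
theorem iterate {k : ι → ℕ} {init : ι → γ} {step : ι → γ → γ} {B : ι → ℕ}
    (hB : FB κ (fun x => sz (e x)) B)
    (hacc : ∀ x, ∀ j ≤ k x, sz ((step x)^[j] (init x)) ≤ B x)
    (hk : FC κ e k) (hi : FC κ e init)
    (hstep : FC (lift κ) (ext e) (fun y : ι × γ => step y.1 y.2)) :
    FC κ e (fun x => (step x)^[k x] (init x)) := by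
  -- A unary numeral is the encoding of a list of `nil`s, so the iteration is a fold over the
  -- counter.
  have hl : FC κ e (fun x => List.replicate (k x) Data.nil) :=
    hk.recode (fun _ => rfl) fun x => enc_replicate _
  have key : ∀ x j, (List.replicate j Data.nil).foldl (fun a _ => step x a) (init x) =
      (step x)^[j] (init x) := by
    intro x j
    induction j with
    | zero => rfl
    | succ n ih =>
      rw [List.replicate_succ', List.foldl_append, ih, Function.iterate_succ_apply']
      rfl
  have h := FC.foldl (e := e) (κ := κ) (l := fun x => List.replicate (k x) Data.nil) (init := init)
    (step := fun x a _ => step x a) (B := B) hB ?_ hl hi ?_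
  · simpa only [key] using h
  · rintro x pre hpre
    obtain ⟨h1, h2⟩ := List.prefix_replicate_iff.1 hpre
    rw [h2, key]
    exact hacc x _ h1
  · refine FC.comp ?_ (hstep.reindex (ι' := ι × γ × Data) (fun y => (y.1, y.2.1)))
    exact FC.id.wk.pair arg.fst

theorem succ {a : ι → ℕ} (ha : FC κ e a) : FC κ e (fun x => a x + 1) :=
  ((const Data.nil).pair ha).recode (fun _ => rfl) (fun _ => rfl)

theorem range {k : ι → ℕ} (hk : FC κ e k) : FC κ e (fun x => List.range (k x)) := by
  have key : ∀ n, (fun y : ℕ × List ℕ => (y.1 + 1, y.1 :: y.2))^[n] (0, []) =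
      (n, (List.range n).reverse) := by
    intro n
    induction n with
    | zero => rfl
    | succ n ih => rw [Function.iterate_succ_apply', ih, List.range_succ]; simp
  have h := FC.iterate (e := e) (κ := κ) (k := k) (init := fun _ => (0, []))
    (step := fun _ y => (y.1 + 1, y.1 :: y.2))
    (B := fun x => sz (k x) + (sz (k x) * (sz (k x) + 1) + 1) + 1)
    ((hk.size_bound.add ((hk.size_bound.mul (hk.size_bound.add (FB.const 1))).add
      (FB.const 1))).add (FB.const 1))
    ?_ hk (const _) (arg.fst.succ.pair (arg.fst.cons arg.snd))
  · simp only [key] at h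
    simpa using h.snd.reverse
  · intro x j hj
    have h1 : sz (List.range j).reverse ≤ j * (2 * j + 1 + 1) + 1 := by
      simpa using sz_le_of_forall (l := (List.range j).reverse) (B := 2 * j + 1) fun n hn => by
        rw [sz_nat]
        have : n < j := by simpa using hn
        omega
    have h2 : j * (2 * j + 1 + 1) ≤ (2 * k x + 1) * (2 * k x + 1 + 1) :=
      Nat.mul_le_mul (by omega) (by omega)
    rw [key, sz_pair, sz_nat, sz_nat]
    omega

/-! ### Pairs with constructors as encodings -/

theorem dataCons {a b : ι → Data} (ha : FC κ e a) (hb : FC κ e b) :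
    FC κ e (fun x => Data.cons (a x) (b x)) :=
  (ha.pair hb).recode (fun _ => rfl) (fun _ => rfl)

theorem encode {a : ι → β} (ha : FC κ e a) : FC κ e (fun x => enc (a x)) :=
  ha.recode (fun _ => rfl) (fun _ => rfl)

theorem action {a b : ι → PState} (ha : FC κ e a) (hb : FC κ e b) :
    FC κ e (fun x => Action.mk (a x) (b x)) :=
  (ha.pair hb).recode (fun _ => rfl) (fun _ => rfl)

theorem pre {a : ι → Action} (ha : FC κ e a) : FC κ e (fun x => (a x).pre) := by
  have h : FC κ e (fun x => ((a x).pre, (a x).post)) := ha.recode (fun _ => rfl) (fun _ => rfl)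
  exact h.fst

theorem post {a : ι → Action} (ha : FC κ e a) : FC κ e (fun x => (a x).post) := by
  have h : FC κ e (fun x => ((a x).pre, (a x).post)) := ha.recode (fun _ => rfl) (fun _ => rfl)
  exact h.snd

theorem keys {A : ι → PState} (hA : FC κ e A) : FC κ e (fun x => (A x).map Prod.fst) :=
  hA.map arg.fst

theorem values {A : ι → PState} (hA : FC κ e A) : FC κ e (fun x => (A x).map Prod.snd) :=
  hA.map arg.snd

theorem action_vars {a : ι → Action} (ha : FC κ e a) : FC κ e (fun x => (a x).vars) :=
  ha.pre.keys.append ha.post.keys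

end FC

/-! ### Output sizes and reductions -/

/-- Writing a value costs at least its size, so no register outgrows the largest initial one by more
than the cost of the run. -/
theorem Exec.size_le {p : Prog} {σ τ : Store} {t : ℕ} (h : Exec p σ τ t) :
    ∀ B, (∀ i, (σ i).size ≤ B) → ∀ i, (τ i).size ≤ B + t := by
  induction h with
  | assign i e σ =>
    intro B hB j
    have := Expr.size_eval_le_cost σ e
    by_cases hj : j = i
    · subst hj; simp only [Function.update_self]; omega
    · rw [Function.update_of_ne hj]; have := hB j; omega
  | seq _ _ ih1 ih2 => intro B hB j; have := ih2 _ (ih1 B hB) j; omega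
  | ite_true _ _ ih => intro B hB j; have := ih B hB j; omega
  | ite_false _ _ ih => intro B hB j; have := ih B hB j; omega
  | loop_false _ => intro B hB j; have := hB j; omega
  | loop_true _ _ _ ih1 ih2 => intro B hB j; have := ih2 _ (ih1 B hB) j; omega

theorem Prog.OutputsWithin.size_le {p : Prog} {x y : Data} {T : ℕ} (h : p.OutputsWithin x y T) :
    y.size ≤ x.size + T := by
  obtain ⟨τ, t, h1, rfl, h3⟩ := h
  refine (h1.size_le x.size (fun i => ?_) 0).trans (by omega)
  by_cases hi : i = 0
  · subst hi; simp [inputStore]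
  · simpa [inputStore, Function.update_of_ne hi, Data.size] using Data.one_le_size x

theorem ParamProblem.size_input (P : ParamProblem) (x : P.Inst) :
    (P.input x).size = (P.enc x).size + 2 * P.param x + 2 := by
  have : (encNat (P.param x)).size = 2 * P.param x + 1 := sz_nat _
  simp only [ParamProblem.input, Data.size, this]; omega

/-- Followed by `trans_FC`, this turns a reduction computed in the sense of `FC` into an
fpt-reduction. -/
theorem FPTReducible.refl (P : ParamProblem) : FPTReducible P P := by
  refine ⟨id, fun _ => Iff.rfl, ⟨id, Computable.id, fun _ => le_rfl⟩,
    .assign 0 (.reg 0), fun k => 2 * k + 4, 1,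
    (Primrec.nat_add.comp (Primrec.nat_mul.comp (Primrec.const 2) Primrec.id)
      (Primrec.const 4)).to_comp, fun x => ⟨_, _, .assign _ _ _, ?_, ?_⟩⟩
  · simp [Expr.eval, inputStore]
  · have h := P.size_input x
    have h1 := Data.one_le_size (P.enc x)
    simp only [Expr.cost, inputStore, Function.update_self, h, pow_one]
    nlinarith

/-- An fpt-reduction followed by a reduction in terms of `FC`. -/
theorem FPTReducible.trans_FC {P Q R : ParamProblem} (h : FPTReducible P Q) (r : Q.Inst → R.Inst)
    (hr : ∀ x, Q.Yes x ↔ R.Yes (r x)) {g : ℕ → ℕ} (hg : Primrec g) (hgm : Monotone g)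
    (hrg : ∀ x, R.param (r x) ≤ g (Q.param x))
    (hFC : FC Q.param Q.input (fun x => R.input (r x))) : FPTReducible P R := by
  obtain ⟨s, hs, ⟨g', hg', hsg⟩, p, f, c, hf, hp⟩ := h
  obtain ⟨b, ⟨f', c', hf', hm', hb⟩, -, hq⟩ := hFC
  obtain ⟨q, hq⟩ := hq 0
  have hadd {a b : ℕ → ℕ} (ha : Computable a) (hb : Computable b) :
    Computable fun k => a k + b k := Primrec.nat_add.to_comp.comp ha hb
  have hmul {a b : ℕ → ℕ} (ha : Computable a) (hb : Computable b) :
    Computable fun k => a k * b k := Primrec.nat_mul.to_comp.comp ha hb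
  have hpow {a : ℕ → ℕ} (n : ℕ) (ha : Computable a) : Computable fun k => a k ^ n :=
    (Primrec₂.unpaired'.1 Nat.Primrec.pow).to_comp.comp ha (Computable.const n)
  refine ⟨fun x => r (s x), fun x => (hs x).trans (hr _),
    ⟨fun k => g (g' k), hg.to_comp.comp hg', fun x => (hrg _).trans (hgm (hsg x))⟩,
    .seq p q, fun k => f k + f' (g' k) * (2 * k + 5 + f k) ^ c', c + (c + 1) * c',
    hadd hf (hmul (hf'.to_comp.comp hg') (hpow c' (hadd (hadd (hmul (Computable.const 2)
      Computable.id) (Computable.const 5)) hf))), fun x => ?_⟩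
  have hsize := (hp x).size_le
  obtain ⟨τ, t, h1, h2, h3⟩ := hp x
  -- The first program may leave arbitrary data in the other registers; `FC` only asks for the right
  -- argument in register `0`.
  obtain ⟨υ, u, h4, -, h6, h7⟩ := hq (s x) τ h2
  refine ⟨υ, t + u, .seq h1 h4, h6, ?_⟩
  have hn := Data.one_le_size (P.enc x)
  rw [P.size_input] at hsize
  set n := (P.enc x).size
  set k := P.param x
  have e1 : n ^ c ≤ n ^ (c + (c + 1) * c') := Nat.pow_le_pow_right hn (by omega)
  have e2 : n ^ ((c + 1) * c') ≤ n ^ (c + (c + 1) * c') := Nat.pow_le_pow_right hn (by omega)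
  -- The intermediate instance is at most as large as the input plus the cost of the first run.
  have e3 : sz (Q.input (s x)) + 1 ≤ (2 * k + 5 + f k) * n ^ (c + 1) := by
    have a1 : n ^ c ≤ n ^ (c + 1) := Nat.pow_le_pow_right hn (by omega)
    have a2 : n ≤ n ^ (c + 1) := by simpa using Nat.pow_le_pow_right hn (show 1 ≤ c + 1 by omega)
    have a3 : 1 ≤ n ^ (c + 1) := hn.trans a2
    have a4 : f k * n ^ c ≤ f k * n ^ (c + 1) := Nat.mul_le_mul_left _ a1
    change (Q.input (s x)).size + 1 ≤ _
    nlinarith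
  calc t + u ≤ f k * n ^ c + b (s x) := add_le_add h3 h7
    _ ≤ f k * n ^ c + f' (g' k) * ((2 * k + 5 + f k) * n ^ (c + 1)) ^ c' := by
        refine Nat.add_le_add_left ((hb (s x)).trans ?_) _
        exact Nat.mul_le_mul (hm' (hsg x)) (Nat.pow_le_pow_left e3 _)
    _ = f k * n ^ c + f' (g' k) * (2 * k + 5 + f k) ^ c' * n ^ ((c + 1) * c') := by
        rw [mul_pow, ← pow_mul]; ring
    _ ≤ f k * n ^ (c + (c + 1) * c') +
        f' (g' k) * (2 * k + 5 + f k) ^ c' * n ^ (c + (c + 1) * c') := by gcongr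
    _ = _ := by ring

/-! ## From weighted satisfiability to case modification: the construction -/

/-- The variables that hold the elements of a set of `k` propositional variables. -/
def positions (k : ℕ) : List Data := (List.range k).map fun i => enc (i + 1)

/-- The value of a position that holds the propositional variable `u`. The value of the other
positions is `nil`. -/
def chosen (u : Data) : Data := .cons .nil u

/-- The variable that records that the positions in `t` have passed their test. -/
def taskName (t : List Data) : Data := .cons (.cons .nil .nil) (enc t)

def one : Data := .cons .nil .nil

/-- The propositional variables that occur in a formula, as a list. -/
def occurring (φ : CNF) : List Data := φ.flatMap fun C => C.map Prod.snd

/-- The clauses violated by the set of the values of a partial assignment to the positions. -/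
def violated (φ : CNF) (A : PState) : CNF :=
  φ.filter fun C => decide (∀ l ∈ C, l.1 ≠ decide (chosen l.2 ∈ A.map Prod.snd))

/-- The ways to satisfy the first violated clause by one more value. -/
def branch (φ : CNF) (V : List Data) (A : PState) : List PState :=
  ((violated φ A).headD []).flatMap fun l =>
    if l.1 = true then
      V.flatMap fun p => if p ∈ A.map Prod.fst then [] else [(p, chosen l.2) :: A]
    else []

/-- A step of the search for extensions that violate no clause. -/
def expand (φ : CNF) (V : List Data) (A : PState) : List PState :=
  if violated φ A = [] then [A] else branch φ V A

/-- The partial assignments of values to at most `n` positions, without repeated values. -/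
def roots (V U : List Data) : ℕ → List PState
  | 0 => [[]]
  | n + 1 => (roots V U n).flatMap fun A => A :: V.flatMap fun p => U.flatMap fun u =>
      if p ∈ A.map Prod.fst ∨ chosen u ∈ A.map Prod.snd then [] else [(p, chosen u) :: A]

/-- The lists of at most `n` positions. -/
def tests (V : List Data) : ℕ → List (List Data)
  | 0 => [[]]
  | n + 1 => (tests V n).flatMap fun t => t :: V.flatMap fun p => if p ∈ t then [] else [p :: t]

/-- The first component is carried along unchanged: it names the task that an eventual witness will
serve. -/
def searchStep (φ : CNF) (V : List Data) (L : List (List Data × PState)) :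
    List (List Data × PState) :=
  L.flatMap fun y => (expand φ V y.2).map fun A => (y.1, A)

def searchInit (V U : List Data) (n : ℕ) : List (List Data × PState) :=
  (roots V U n).map fun A => (A.map Prod.fst, A)

/-- The extensions found by the search, each with the positions that it started from. -/
def search (φ : CNF) (k n : ℕ) : List (List Data × PState) :=
  (searchStep φ (positions k))^[k] (searchInit (positions k) (occurring φ) n)

/-- The extensions that violate no clause. -/
def witnesses (φ : CNF) (k n : ℕ) : List (List Data × PState) :=
  (search φ k n).filter fun y => decide (violated φ y.2 = [])

/-- A position can be written only while it is `nil`. Choices are therefore final, and a test once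
passed stays justified. -/
def chooseAction (p u : Data) : Action := ⟨[(p, .nil)], [(p, chosen u)]⟩

def testAction (y : List Data × PState) : Action := ⟨y.2, [(taskName y.1, one)]⟩

def satActions (φ : CNF) (k n : ℕ) : List Action :=
  ((positions k).flatMap fun p => (occurring φ).map fun u => chooseAction p u) ++
    (witnesses φ k n).map testAction

/-- `tests` repeats lists, because each round keeps those of the previous one; keys of domains and
goals must not repeat. -/
def satTests (k n : ℕ) : List (List Data) := (tests (positions k) n).dedup

def satDoms (φ : CNF) (k n : ℕ) : List (Data × List Data) :=
  ((positions k).map fun p => (p, Data.nil :: (occurring φ).map chosen)) ++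
    (satTests k n).map fun t => (taskName t, [Data.nil, one])

def satTarget (φ : CNF) (k n : ℕ) : PlanningInstance where
  doms := satDoms φ k n
  init := (satDoms φ k n).map fun y => (y.1, Data.nil)
  goal := (satTests k n).map fun t => (taskName t, one)
  actions := satActions φ k n

/-- The case has the initial state of the target, no goal and the empty plan. The glue budget is one
choice per position and one test per task. -/
def satCaseMod (φ : CNF) (k n : ℕ) : CaseModData where
  target := satTarget φ k n
  caseInit := (satTarget φ k n).init
  caseGoal := []
  casePlan := []
  glueActions := satActions φ k n
  maxGlue := (positions k).length + (satTests k n).length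

/-! ### The construction can be computed -/

/-! ### Size of the search tree -/

section Bounds

theorem length_positions (k : ℕ) : (positions k).length = k := by simp [positions]

theorem length_flatMap_le {α β : Type} {l : List α} {f : α → List β} {N : ℕ}
    (h : ∀ a ∈ l, (f a).length ≤ N) : (l.flatMap f).length ≤ l.length * N := by
  induction l with
  | nil => simp
  | cons a l ih =>
    have h1 := h a (by simp)
    have h2 := ih fun b hb => h b (by simp [hb])
    rw [List.flatMap_cons, List.length_append, List.length_cons, Nat.succ_mul]
    omega

theorem length_tests_le (V : List Data) (n : ℕ) : (tests V n).length ≤ (V.length + 1) ^ n := by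
  induction n with
  | zero => simp [tests]
  | succ n ih =>
    rw [pow_succ]
    refine (length_flatMap_le (N := V.length + 1) fun t _ => ?_).trans (Nat.mul_le_mul_right _ ih)
    rw [List.length_cons]
    refine Nat.succ_le_succ ((length_flatMap_le (N := 1) fun p _ => ?_).trans_eq (mul_one _))
    split_ifs <;> simp

theorem mem_of_mem_violated {φ : CNF} {A : PState} {C : Clause} (h : C ∈ violated φ A) : C ∈ φ :=
  List.mem_of_mem_filter h

theorem headD_violated_mem {φ : CNF} {A : PState} (h : violated φ A ≠ []) :
    (violated φ A).headD [] ∈ violated φ A := by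
  cases hv : violated φ A with
  | nil => exact absurd hv h
  | cons C l => simp

/-- One violated clause is enough for branching: a child is given by one of its at most `q` literals
and a free position. -/
theorem length_expand_le {φ : CNF} {q : ℕ} (hφ : ∀ C ∈ φ, C.length ≤ q) (V : List Data)
    (A : PState) : (expand φ V A).length ≤ q * V.length + 1 := by
  unfold expand
  split_ifs with h
  · simp
  · refine (length_flatMap_le (N := V.length) fun l _ => ?_).trans ?_
    · split_ifs
      · refine (length_flatMap_le (N := 1) fun p _ => ?_).trans_eq (mul_one _)
        split_ifs <;> simp
      · simp
    · have := hφ _ (mem_of_mem_violated (headD_violated_mem h))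
      exact (Nat.mul_le_mul_right _ this).trans (Nat.le_succ _)

theorem mem_branch {φ : CNF} {V : List Data} {A B : PState} (h : B ∈ branch φ V A) :
    ∃ C ∈ violated φ A, ∃ u, (true, u) ∈ C ∧ ∃ p ∈ V, p ∉ A.map Prod.fst ∧
      B = (p, chosen u) :: A := by
  have hv : violated φ A ≠ [] := by
    intro hv
    simp [branch, hv] at h
  refine ⟨_, headD_violated_mem hv, ?_⟩
  obtain ⟨⟨b, u⟩, hl, h⟩ := List.mem_flatMap.1 h
  split_ifs at h with hb
  · obtain ⟨p, hp, h⟩ := List.mem_flatMap.1 h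
    split_ifs at h with hA
    · simp at h
    · dsimp only at hb
      subst hb
      exact ⟨u, hl, p, hp, hA, by simpa using h⟩
  · simp at h

theorem sz_le_of_mem_expand {φ : CNF} {V : List Data} {A B : PState} (h : B ∈ expand φ V A) :
    sz B ≤ sz A + (sz φ + sz V + 5) := by
  unfold expand at h
  split_ifs at h
  · simp only [List.mem_singleton] at h
    subst h; omega
  · obtain ⟨C, hC, u, hu, p, hp, -, rfl⟩ := mem_branch h
    have h1 := sz_le_of_mem (mem_of_mem_violated hC)
    have h2 := sz_le_of_mem hu
    have h3 := sz_le_of_mem hp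
    have h4 : sz (chosen u) = 1 + sz u + 1 := rfl
    have h5 : sz (true, u) = 3 + sz u + 1 := rfl
    rw [sz_cons, sz_pair, h4]
    omega

/-- The number of entries is multiplied by a factor depending on `q` and the number of positions
only, while their sizes grow additively. Over `k` steps with `k` positions this stays within an fpt
bound. -/
theorem searchStep_iterate_bound {φ : CNF} {q : ℕ} (hφ : ∀ C ∈ φ, C.length ≤ q) (V : List Data)
    (L : List (List Data × PState)) (j : ℕ) :
    ((searchStep φ V)^[j] L).length ≤ L.length * (q * V.length + 1) ^ j ∧
      ∀ y ∈ (searchStep φ V)^[j] L, sz y ≤ sz L + j * (sz φ + sz V + 5) := by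
  induction j with
  | zero => exact ⟨by simp, fun y hy => by have := sz_le_of_mem hy; simp only [Function.iterate_zero, id] at *; omega⟩
  | succ j ih =>
    rw [Function.iterate_succ_apply']
    constructor
    · rw [pow_succ, ← mul_assoc]
      refine (length_flatMap_le fun y _ => ?_).trans (Nat.mul_le_mul_right _ ih.1)
      rw [List.length_map]
      exact length_expand_le hφ V y.2
    · intro y hy
      obtain ⟨z, hz, hy⟩ := List.mem_flatMap.1 hy
      obtain ⟨B, hB, rfl⟩ := List.mem_map.1 hy
      have h1 := ih.2 z hz
      have h2 := sz_le_of_mem_expand hB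
      have h3 : sz z = sz z.1 + sz z.2 + 1 := rfl
      rw [sz_pair, Nat.succ_mul]
      omega

end Bounds

/-! ### Cost of building the instance -/

namespace FC

variable {ι α : Type} [Enc α] {κ : ι → ℕ} {e : ι → α}

theorem positions {k : ι → ℕ} (hk : FC κ e k) : FC κ e (fun x => positions (k x)) :=
  hk.range.map arg.succ.encode

theorem occurring {φ : ι → CNF} (hφ : FC κ e φ) : FC κ e (fun x => occurring (φ x)) :=
  hφ.flatMap (arg.map arg.snd)

theorem chosen {u : ι → Data} (hu : FC κ e u) : FC κ e (fun x => chosen (u x)) :=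
  (const _).dataCons hu

theorem taskName {t : ι → List Data} (ht : FC κ e t) : FC κ e (fun x => taskName (t x)) :=
  (const _).dataCons ht.encode

theorem violated {φ : ι → CNF} {A : ι → PState} (hφ : FC κ e φ) (hA : FC κ e A) :
    FC κ e (fun x => violated (φ x) (A x)) :=
  hφ.filter (arg.forall_mem (arg.fst.eq (arg.snd.chosen.mem hA.values.wk.wk)).not)

theorem extend {p u : ι → Data} {A : ι → PState} (hp : FC κ e p) (hu : FC κ e u)
    (hA : FC κ e A) : FC κ e (fun x => (p x, CaseReuse.chosen (u x)) :: A x) :=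
  (hp.pair hu.chosen).cons hA

theorem branch {φ : ι → CNF} {V : ι → List Data} {A : ι → PState} (hφ : FC κ e φ)
    (hV : FC κ e V) (hA : FC κ e A) : FC κ e (fun x => branch (φ x) (V x) (A x)) :=
  ((hφ.violated hA).headD rfl).flatMap (ite arg.fst.bool
    (hV.wk.flatMap (ite (arg.mem hA.wk.wk.keys) nil ((arg.extend arg.wk.snd hA.wk.wk).cons nil)))
    nil)

theorem expand {φ : ι → CNF} {V : ι → List Data} {A : ι → PState} (hφ : FC κ e φ)
    (hV : FC κ e V) (hA : FC κ e A) : FC κ e (fun x => expand (φ x) (V x) (A x)) :=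
  ite ((hφ.violated hA).eq nil) (hA.cons nil) (hφ.branch hV hA)

/-- Here `n` is a constant, not part of the input: the program, and the degree of its cost bound,
may depend on it. -/
theorem roots {V U : ι → List Data} (hV : FC κ e V) (hU : FC κ e U) (n : ℕ) :
    FC κ e (fun x => roots (V x) (U x) n) := by
  induction n with
  | zero => exact const _
  | succ n ih =>
    exact ih.flatMap (arg.cons (hV.wk.flatMap (hU.wk.wk.flatMap (ite
      ((arg.wk.mem arg.wk.wk.keys).or (arg.chosen.mem arg.wk.wk.values)) nil
      ((arg.wk.extend arg arg.wk.wk).cons nil)))))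

theorem tests {V : ι → List Data} (hV : FC κ e V) (n : ℕ) :
    FC κ e (fun x => tests (V x) n) := by
  induction n with
  | zero => exact const _
  | succ n ih =>
    exact ih.flatMap (arg.cons (hV.wk.flatMap (ite (arg.mem arg.wk) nil
      ((arg.cons arg.wk).cons nil))))

theorem search {φ : ι → CNF} {k : ι → ℕ} {q : ℕ} (hq : ∀ x, ∀ C ∈ φ x, C.length ≤ q)
    (hφ : FC κ e φ) (hk : FC κ e k) (hkκ : ∀ x, k x ≤ κ x) (n : ℕ) :
    FC κ e (fun x => search (φ x) (k x) n) := by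
  have hV := hk.positions
  have hi : FC κ e (fun x =>
      searchInit (CaseReuse.positions (k x)) (CaseReuse.occurring (φ x)) n) :=
    (hV.roots hφ.occurring n).map (arg.keys.pair arg)
  have hpow : FB κ (fun x => sz (e x)) (fun x => (q * κ x + 1) ^ κ x) :=
    FB.of_param (f := fun k => (q * k + 1) ^ k)
      ((Primrec₂.unpaired'.1 Nat.Primrec.pow).comp (Primrec.nat_add.comp
        (Primrec.nat_mul.comp (Primrec.const q) Primrec.id) (Primrec.const 1)) Primrec.id)
      (fun a b h => (Nat.pow_le_pow_left (Nat.succ_le_succ (Nat.mul_le_mul_left q h)) _).trans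
        (Nat.pow_le_pow_right (Nat.succ_pos _) h))
  refine FC.iterate (B := fun x =>
      (sz (searchInit (CaseReuse.positions (k x)) (CaseReuse.occurring (φ x)) n) *
        (q * κ x + 1) ^ κ x) *
      (sz (searchInit (CaseReuse.positions (k x)) (CaseReuse.occurring (φ x)) n) +
        κ x * (sz (φ x) + sz (CaseReuse.positions (k x)) + 5) + 1) + 1)
    (((hi.size_bound.mul hpow).mul ((hi.size_bound.add (FB.param.mul
      ((hφ.size_bound.add hV.size_bound).add (FB.const 5)))).add (FB.const 1))).add (FB.const 1))
    (fun x j hj => ?_) hk hi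
    (arg.flatMap ((hφ.wk.wk.expand hV.wk.wk arg.snd).map (arg.wk.fst.pair arg)))
  obtain ⟨h1, h2⟩ := searchStep_iterate_bound (hq x) (CaseReuse.positions (k x))
    (searchInit (CaseReuse.positions (k x)) (CaseReuse.occurring (φ x)) n) j
  have hj' := hj.trans (hkκ x)
  refine (sz_le_of_forall h2).trans (Nat.succ_le_succ (Nat.mul_le_mul (h1.trans ?_) ?_))
  · rw [length_positions]
    refine Nat.mul_le_mul (length_le_sz _).le ?_
    refine (Nat.pow_le_pow_left ?_ _).trans (Nat.pow_le_pow_right (Nat.succ_pos _) hj')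
    exact Nat.succ_le_succ (Nat.mul_le_mul_left _ (hkκ x))
  · gcongr

/-- The second function is the new parameter, which a reduction has to output along with the
instance. -/
theorem satCaseMod {φ : ι → CNF} {k : ι → ℕ} {q : ℕ} (hq : ∀ x, ∀ C ∈ φ x, C.length ≤ q)
    (hφ : FC κ e φ) (hk : FC κ e k) (hkκ : ∀ x, k x ≤ κ x) (n : ℕ) :
    FC κ e (fun x => CaseReuse.satCaseMod (φ x) (k x) n) ∧
      FC κ e (fun x => (CaseReuse.satCaseMod (φ x) (k x) n).maxGlue +
        (CaseReuse.satCaseMod (φ x) (k x) n).glueVars.card) := by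
  have hV := hk.positions
  have hU := hφ.occurring
  have hw : FC κ e (fun x => witnesses (φ x) (k x) n) :=
    (FC.search hq hφ hk hkκ n).filter ((hφ.wk.violated arg.snd).eq nil)
  have hact : FC κ e (fun x => satActions (φ x) (k x) n) :=
    (hV.flatMap (hU.wk.map (((arg.wk.pair (const Data.nil)).cons nil).action
      ((arg.wk.pair arg.chosen).cons nil)))).append
    (hw.map (arg.snd.action ((arg.fst.taskName.pair (const one)).cons nil)))
  have htest : FC κ e (fun x => satTests (k x) n) := (hV.tests n).dedup
  have hdoms : FC κ e (fun x => satDoms (φ x) (k x) n) :=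
    (hV.map (arg.pair ((const Data.nil).cons (hU.wk.map arg.chosen)))).append
      (htest.map (arg.taskName.pair (const _)))
  have hinit : FC κ e (fun x => (satTarget (φ x) (k x) n).init) :=
    hdoms.map (arg.fst.pair (const _))
  have hgoal : FC κ e (fun x => (satTarget (φ x) (k x) n).goal) :=
    htest.map (arg.taskName.pair (const _))
  have hM : FC κ e (fun x => (CaseReuse.satCaseMod (φ x) (k x) n).maxGlue) :=
    hV.length.add htest.length
  refine ⟨?_, ?_⟩
  · exact ((hdoms.pair (hinit.pair (hgoal.pair hact))).pair
      (hinit.pair ((const ([] : PState)).pair ((const ([] : List Action)).pair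
        (hact.pair hM))))).recode (fun _ => rfl) fun _ => rfl
  · have hvars := (hact.flatMap (f := fun _ a => Action.vars a) arg.action_vars).dedup
    refine (hM.add hvars.length).recode (fun _ => rfl) fun x => congrArg _ ?_
    rw [← List.card_toFinset]
    rfl
end FC

/-! ### The constructed instance is a valid instance of case modification -/

theorem positions_nodup (k : ℕ) : (positions k).Nodup :=
  List.nodup_range.map fun _ _ h => Nat.succ_injective (Enc.enc_injective h)

theorem taskName_injective : Function.Injective taskName := fun s t h => by
  simp only [taskName, Data.cons.injEq, true_and] at h
  exact Enc.enc_injective h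

theorem chosen_injective : Function.Injective chosen := fun s t h => by
  simpa [chosen] using h

theorem chosen_ne_nil (u : Data) : chosen u ≠ .nil := nofun

theorem taskName_notMem_positions (t : List Data) (k : ℕ) : taskName t ∉ positions k := by
  intro h
  obtain ⟨i, -, h⟩ := List.mem_map.1 h
  simp [taskName, enc, encNat] at h

theorem mem_occurring {φ : CNF} {u : Data} : u ∈ occurring φ ↔ ∃ C ∈ φ, ∃ b, (b, u) ∈ C := by
  simp [occurring]

theorem mem_vars {φ : CNF} {u : Data} : u ∈ CNF.vars φ ↔ ∃ C ∈ φ, ∃ b, (b, u) ∈ C := by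
  simp only [CNF.vars, List.mem_toFinset, List.mem_map, List.mem_flatten, Prod.exists,
    exists_eq_right]
  exact ⟨fun ⟨b, C, h1, h2⟩ => ⟨C, h1, b, h2⟩, fun ⟨C, h1, b, h2⟩ => ⟨b, C, h1, h2⟩⟩

/-- The partial assignments of distinct values from `U` to distinct positions in `V`. -/
structure IsPartial (V U : List Data) (A : PState) : Prop where
  keys_nodup : (A.map Prod.fst).Nodup
  values_nodup : (A.map Prod.snd).Nodup
  mem : ∀ y ∈ A, y.1 ∈ V ∧ ∃ u ∈ U, y.2 = chosen u

theorem IsPartial.cons {V U : List Data} {A : PState} (h : IsPartial V U A) {p u : Data}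
    (hp : p ∈ V) (hu : u ∈ U) (hpA : p ∉ A.map Prod.fst) (huA : chosen u ∉ A.map Prod.snd) :
    IsPartial V U ((p, chosen u) :: A) := by
  refine ⟨List.nodup_cons.2 ⟨hpA, h.keys_nodup⟩, List.nodup_cons.2 ⟨huA, h.values_nodup⟩,
    fun y hy => ?_⟩
  rcases List.mem_cons.1 hy with rfl | hy
  · exact ⟨hp, u, hu, rfl⟩
  · exact h.mem y hy

theorem mem_roots_succ {V U : List Data} {n : ℕ} {B : PState} :
    B ∈ roots V U (n + 1) ↔ B ∈ roots V U n ∨ ∃ A ∈ roots V U n, ∃ p ∈ V, ∃ u ∈ U,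
      p ∉ A.map Prod.fst ∧ chosen u ∉ A.map Prod.snd ∧ B = (p, chosen u) :: A := by
  simp only [roots, List.mem_flatMap, List.mem_cons]
  constructor
  · rintro ⟨A, hA, rfl | ⟨p, hp, u, hu, h⟩⟩
    · exact .inl hA
    · split_ifs at h with hc
      · simp at h
      · rw [not_or] at hc
        exact .inr ⟨A, hA, p, hp, u, hu, hc.1, hc.2, by simpa using h⟩
  · rintro (h | ⟨A, hA, p, hp, u, hu, h1, h2, rfl⟩)
    · exact ⟨B, h, .inl rfl⟩
    · refine ⟨A, hA, .inr ⟨p, hp, u, hu, ?_⟩⟩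
      rw [if_neg (not_or.2 ⟨h1, h2⟩)]
      simp

theorem mem_tests_succ {V : List Data} {n : ℕ} {s : List Data} :
    s ∈ tests V (n + 1) ↔ s ∈ tests V n ∨ ∃ t ∈ tests V n, ∃ p ∈ V, p ∉ t ∧ s = p :: t := by
  simp only [tests, List.mem_flatMap, List.mem_cons]
  constructor
  · rintro ⟨t, ht, rfl | ⟨p, hp, h⟩⟩
    · exact .inl ht
    · split_ifs at h with hc
      · simp at h
      · exact .inr ⟨t, ht, p, hp, hc, by simpa using h⟩
  · rintro (h | ⟨t, ht, p, hp, h1, rfl⟩)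
    · exact ⟨s, h, .inl rfl⟩
    · exact ⟨t, ht, .inr ⟨p, hp, by simp [h1]⟩⟩

theorem isPartial_of_mem_roots {V U : List Data} {n : ℕ} {A : PState} (h : A ∈ roots V U n) :
    IsPartial V U A ∧ A.map Prod.fst ∈ tests V n := by
  induction n generalizing A with
  | zero =>
    obtain rfl : A = [] := by simpa [roots] using h
    exact ⟨⟨by simp, by simp, by simp⟩, by simp [tests]⟩
  | succ n ih =>
    rcases mem_roots_succ.1 h with h | ⟨B, hB, p, hp, u, hu, h1, h2, rfl⟩
    · exact ⟨(ih h).1, mem_tests_succ.2 (.inl (ih h).2)⟩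
    · exact ⟨(ih hB).1.cons hp hu h1 h2, mem_tests_succ.2 (.inr ⟨_, (ih hB).2, p, hp, h1, rfl⟩)⟩

theorem mem_tests {V t : List Data} (ht : t.Nodup) (hV : ∀ p ∈ t, p ∈ V) {n : ℕ}
    (hn : t.length ≤ n) : t ∈ tests V n := by
  induction n generalizing t with
  | zero => simp [List.length_eq_zero_iff.1 (Nat.le_zero.1 hn), tests]
  | succ n ih =>
    cases t with
    | nil => exact mem_tests_succ.2 (.inl (ih (by simp) (by simp) (by simp)))
    | cons p t =>
      obtain ⟨h1, h2⟩ := List.nodup_cons.1 ht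
      exact mem_tests_succ.2 (.inr ⟨t, ih h2 (fun q hq => hV q (by simp [hq])) (by simpa using hn),
        p, hV p (by simp), h1, rfl⟩)

theorem subset_of_mem_tests {V t : List Data} {n : ℕ} (h : t ∈ tests V n) :
    t.Nodup ∧ (∀ p ∈ t, p ∈ V) ∧ t.length ≤ n := by
  induction n generalizing t with
  | zero =>
    obtain rfl : t = [] := by simpa [tests] using h
    simp
  | succ n ih =>
    rcases mem_tests_succ.1 h with h | ⟨s, hs, p, hp, h1, rfl⟩
    · exact ⟨(ih h).1, (ih h).2.1, (ih h).2.2.trans (Nat.le_succ n)⟩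
    · obtain ⟨i1, i2, i3⟩ := ih hs
      refine ⟨List.nodup_cons.2 ⟨h1, i1⟩, fun q hq => ?_, by simpa using i3⟩
      rcases List.mem_cons.1 hq with rfl | hq
      · exact hp
      · exact i2 q hq

theorem mem_violated {φ : CNF} {A : PState} {C : Clause} :
    C ∈ violated φ A ↔ C ∈ φ ∧ ∀ l ∈ C, ¬ (l.1 = true ↔ chosen l.2 ∈ A.map Prod.snd) := by
  rw [violated, List.mem_filter, decide_eq_true_iff]
  refine and_congr_right fun _ => forall₂_congr fun l _ => ?_
  by_cases h : chosen l.2 ∈ A.map Prod.snd <;> simp [h]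

/-- `branch` does not check that the added value is new. It is, because a positive literal of a
violated clause is false under `A`. -/
theorem expand_isPartial {φ : CNF} {V : List Data} {A B : PState}
    (hA : IsPartial V (occurring φ) A) (h : B ∈ expand φ V A) :
    IsPartial V (occurring φ) B ∧ A <:+ B := by
  unfold expand at h
  split_ifs at h
  · obtain rfl : B = A := by simpa using h
    exact ⟨hA, List.suffix_refl _⟩
  · obtain ⟨C, hC, u, hu, p, hp, hpA, rfl⟩ := mem_branch h
    obtain ⟨hC, hv⟩ := mem_violated.1 hC
    have := hv _ hu
    simp only [true_iff] at this
    exact ⟨hA.cons hp (mem_occurring.2 ⟨C, hC, true, hu⟩) hpA this, List.suffix_cons _ _⟩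

theorem search_iterate_isPartial {φ : CNF} {V : List Data} {n j : ℕ} {y : List Data × PState}
    (h : y ∈ (searchStep φ V)^[j] (searchInit V (occurring φ) n)) :
    IsPartial V (occurring φ) y.2 ∧ y.1 ∈ tests V n ∧ ∀ p ∈ y.1, p ∈ y.2.map Prod.fst := by
  induction j generalizing y with
  | zero =>
    obtain ⟨A, hA, rfl⟩ := List.mem_map.1 h
    obtain ⟨h1, h2⟩ := isPartial_of_mem_roots hA
    exact ⟨h1, h2, fun p hp => hp⟩
  | succ j ih =>
    rw [Function.iterate_succ_apply'] at h
    obtain ⟨z, hz, h⟩ := List.mem_flatMap.1 h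
    obtain ⟨B, hB, rfl⟩ := List.mem_map.1 h
    obtain ⟨h1, h2, h3⟩ := ih hz
    obtain ⟨h4, h5⟩ := expand_isPartial h1 hB
    exact ⟨h4, h2, fun p hp => (h5.map Prod.fst).subset (h3 p hp)⟩

theorem witnesses_spec {φ : CNF} {k n : ℕ} {y : List Data × PState} (h : y ∈ witnesses φ k n) :
    IsPartial (positions k) (occurring φ) y.2 ∧ y.1 ∈ satTests k n ∧
      (∀ p ∈ y.1, p ∈ y.2.map Prod.fst) ∧ violated φ y.2 = [] := by
  obtain ⟨h1, h2⟩ := List.mem_filter.1 h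
  obtain ⟨h3, h4, h5⟩ := search_iterate_isPartial h1
  exact ⟨h3, List.mem_dedup.2 h4, h5, by simpa using h2⟩

theorem satDoms_position {φ : CNF} {k n : ℕ} {p : Data} (hp : p ∈ positions k) :
    (p, Data.nil :: (occurring φ).map chosen) ∈ satDoms φ k n :=
  List.mem_append_left _ (List.mem_map.2 ⟨p, hp, rfl⟩)

theorem satDoms_task {φ : CNF} {k n : ℕ} {t : List Data} (ht : t ∈ satTests k n) :
    (taskName t, [Data.nil, one]) ∈ satDoms φ k n :=
  List.mem_append_right _ (List.mem_map.2 ⟨t, ht, rfl⟩)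

theorem satDoms_keys (φ : CNF) (k n : ℕ) :
    (satDoms φ k n).map Prod.fst = positions k ++ (satTests k n).map taskName := by
  simp [satDoms, Function.comp_def]

theorem satTarget_valid (φ : CNF) (k n : ℕ) : (satTarget φ k n).Valid := by
  have hnd : ((satDoms φ k n).map Prod.fst).Nodup := by
    rw [satDoms_keys]
    refine (positions_nodup k).append ((List.nodup_dedup _).map taskName_injective) ?_
    intro p hp h
    obtain ⟨t, -, rfl⟩ := List.mem_map.1 h
    exact taskName_notMem_positions t k hp
  have hinit : (satTarget φ k n).init.map Prod.fst = (satDoms φ k n).map Prod.fst := by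
    simp [satTarget, Function.comp_def]
  refine ⟨hnd, ⟨⟨?_, ?_⟩, ?_⟩, ⟨?_, ?_⟩, ?_⟩
  · rw [PState.vars, hinit]; exact hnd
  · intro x hx
    obtain ⟨y, hy, rfl⟩ := List.mem_map.1 hx
    refine ⟨y, hy, rfl, ?_⟩
    rcases List.mem_append.1 hy with h | h
    · obtain ⟨p, -, rfl⟩ := List.mem_map.1 h
      exact List.mem_cons_self
    · obtain ⟨p, -, rfl⟩ := List.mem_map.1 h
      exact List.mem_cons_self
  · intro v hv
    rw [PState.vars, hinit]; exact hv
  · have : (satTarget φ k n).goal.map Prod.fst = (satTests k n).map taskName := by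
      simp [satTarget, Function.comp_def]
    rw [PState.vars, this]
    exact (List.nodup_dedup _).map taskName_injective
  · intro x hx
    obtain ⟨t, ht, rfl⟩ := List.mem_map.1 hx
    exact ⟨_, satDoms_task ht, rfl, by simp⟩
  · intro a ha
    rcases List.mem_append.1 ha with h | h
    · obtain ⟨p, hp, h⟩ := List.mem_flatMap.1 h
      obtain ⟨u, hu, rfl⟩ := List.mem_map.1 h
      refine ⟨⟨by simp [chooseAction, PState.vars], fun x hx => ?_⟩,
        ⟨by simp [chooseAction, PState.vars], fun x hx => ?_⟩⟩
      · obtain rfl : x = (p, Data.nil) := by simpa [chooseAction] using hx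
        exact ⟨_, satDoms_position hp, rfl, by simp⟩
      · obtain rfl : x = (p, chosen u) := by simpa [chooseAction] using hx
        exact ⟨_, satDoms_position hp, rfl, List.mem_cons_of_mem _ (List.mem_map.2 ⟨u, hu, rfl⟩)⟩
    · obtain ⟨y, hy, rfl⟩ := List.mem_map.1 h
      obtain ⟨h1, h2, -, -⟩ := witnesses_spec hy
      refine ⟨⟨h1.keys_nodup, fun x hx => ?_⟩,
        ⟨by simp [testAction, PState.vars], fun x hx => ?_⟩⟩
      · obtain ⟨h3, u, hu, h4⟩ := h1.mem x hx
        exact ⟨_, satDoms_position h3, rfl, by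
          rw [h4]; exact List.mem_cons_of_mem _ (List.mem_map.2 ⟨u, hu, rfl⟩)⟩
      · obtain rfl : x = (taskName y.1, one) := by simpa [testAction] using hx
        exact ⟨_, satDoms_task h2, rfl, by simp⟩

theorem satCaseMod_valid (φ : CNF) (k n : ℕ) : (satCaseMod φ k n).Valid := by
  have h := satTarget_valid φ k n
  refine ⟨h, ⟨h.1, h.2.1, ⟨List.nodup_nil, fun _ hx => absurd hx List.not_mem_nil⟩, h.2.2.2⟩,
    ⟨by simp [satCaseMod], by simp [satCaseMod, CaseModData.caseInstance, Agrees, PState.vars]⟩,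
    fun a ha => ha⟩

/-- The formula influences the number of actions and the domains, but the variables are just the
positions and the tasks. -/
theorem satCaseMod_param_le (φ : CNF) (k n : ℕ) :
    (satCaseMod φ k n).maxGlue + (satCaseMod φ k n).glueVars.card ≤
      2 * (k + (k + 1) ^ n) := by
  have h1 : (satTests k n).length ≤ (k + 1) ^ n := by
    refine (List.dedup_sublist _).length_le.trans ?_
    simpa [length_positions] using length_tests_le (positions k) n
  have h2 : (satCaseMod φ k n).maxGlue = k + (satTests k n).length := by
    simp [satCaseMod, length_positions]
  have h3 : (satCaseMod φ k n).glueVars ⊆ ((satDoms φ k n).map Prod.fst).toFinset := by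
    intro v hv
    obtain ⟨a, ha, hv⟩ := List.mem_flatMap.1 (List.mem_toFinset.1 hv)
    obtain ⟨⟨-, hpre⟩, ⟨-, hpost⟩⟩ := (satTarget_valid φ k n).2.2.2 a ha
    rw [List.mem_toFinset]
    rcases List.mem_append.1 hv with h | h
    · obtain ⟨x, hx, rfl⟩ := List.mem_map.1 h
      obtain ⟨y, hy, h, -⟩ := hpre x hx
      exact List.mem_map.2 ⟨y, hy, h⟩
    · obtain ⟨x, hx, rfl⟩ := List.mem_map.1 h
      obtain ⟨y, hy, h, -⟩ := hpost x hx
      exact List.mem_map.2 ⟨y, hy, h⟩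
  have h4 := (Finset.card_le_card h3).trans (List.toFinset_card_le _)
  rw [satDoms_keys, List.length_append, List.length_map, length_positions] at h4
  omega

/-! ## Partial states and runs -/

theorem val_cons (x : Data × Data) (A : PState) (v : Data) :
    PState.val (x :: A) v = if v = x.1 then some x.2 else PState.val A v := by
  obtain ⟨a, d⟩ := x
  by_cases h : v = a
  · subst h; simp [PState.val]
  · have : (v == a) = false := by simpa using h
    simp [PState.val, List.lookup_cons, this, h]

theorem val_isSome_iff {A : PState} {v : Data} : (PState.val A v).isSome ↔ v ∈ PState.vars A := by
  induction A with
  | nil => simp [PState.val, PState.vars]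
  | cons x A ih =>
    rw [val_cons, PState.vars, List.map_cons, List.mem_cons, ← PState.vars]
    by_cases h : v = x.1
    · simp [h]
    · rw [if_neg h, ih]
      simp [h]

theorem val_eq_none_iff {A : PState} {v : Data} : PState.val A v = none ↔ v ∉ PState.vars A := by
  rw [← val_isSome_iff]; simp

theorem mem_of_val {A : PState} {v d : Data} (h : PState.val A v = some d) : (v, d) ∈ A := by
  induction A with
  | nil => simp [PState.val] at h
  | cons x A ih =>
    rw [val_cons] at h
    split_ifs at h with hv
    · rw [hv, ← Option.some.inj h]
      exact List.mem_cons_self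
    · exact List.mem_cons_of_mem _ (ih h)

theorem val_of_mem {A : PState} (hA : (PState.vars A).Nodup) {v d : Data} (h : (v, d) ∈ A) :
    PState.val A v = some d := by
  have hv : v ∈ PState.vars A := List.mem_map.2 ⟨_, h, rfl⟩
  obtain ⟨d', hd'⟩ := Option.isSome_iff_exists.1 (val_isSome_iff.2 hv)
  have := List.inj_on_of_nodup_map hA (mem_of_val hd') h rfl
  exact hd'.trans (congrArg (fun y => some y.2) this)

theorem agrees_iff {A : PState} (hA : (PState.vars A).Nodup) {s : Data → Option Data} :
    Agrees s A ↔ ∀ x ∈ A, s x.1 = some x.2 := by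
  constructor
  · intro h x hx
    rw [h x.1 (List.mem_map.2 ⟨x, hx, rfl⟩), val_of_mem hA hx]
  · intro h v hv
    obtain ⟨x, hx, rfl⟩ := List.mem_map.1 hv
    rw [h x hx, val_of_mem hA hx]

theorem run_append (p q : List Action) (s : Data → Option Data) :
    run (p ++ q) s = run q (run p s) := List.foldl_append

theorem run_cons (a : Action) (p : List Action) (s : Data → Option Data) :
    run (a :: p) s = run p (a.apply s) := rfl

theorem run_induction {I : (Data → Option Data) → Prop} {g : List Action}
    (hg : ∀ a ∈ g, ∀ s, I s → I (a.apply s)) {s : Data → Option Data} (hs : I s) : I (run g s) := by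
  induction g generalizing s with
  | nil => exact hs
  | cons a g ih =>
    exact ih (fun b hb => hg b (by simp [hb])) (hg a (by simp) s hs)

/-! ### Correctness of the construction -/

theorem chooseAction_apply (p u : Data) (s : Data → Option Data) :
    (chooseAction p u).apply s =
      if s p = some .nil then Function.update s p (some (chosen u)) else s := by
  have h : Agrees s (chooseAction p u).pre ↔ s p = some .nil := by
    rw [agrees_iff (by simp [chooseAction, PState.vars])]
    simp [chooseAction]
  unfold Action.apply
  simp only [h]
  split_ifs
  · funext v
    by_cases hv : v = p
    · subst hv; simp [chooseAction, PState.vars, PState.val]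
    · simp [chooseAction, PState.vars, hv]
  · rfl

theorem testAction_apply {y : List Data × PState} (hy : (y.2.map Prod.fst).Nodup)
    (s : Data → Option Data) [Decidable (∀ x ∈ y.2, s x.1 = some x.2)] :
    (testAction y).apply s = if ∀ x ∈ y.2, s x.1 = some x.2 then
      Function.update s (taskName y.1) (some one) else s := by
  have h : Agrees s (testAction y).pre ↔ ∀ x ∈ y.2, s x.1 = some x.2 := agrees_iff hy
  unfold Action.apply
  simp only [h]
  split_ifs
  · funext v
    by_cases hv : v = taskName y.1
    · subst hv; simp [testAction, PState.vars, PState.val]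
    · simp [testAction, PState.vars, hv]
  · rfl

/-- What holds in all reachable states. -/
structure Reachable (φ : CNF) (k n : ℕ) (s : Data → Option Data) : Prop where
  position : ∀ p ∈ positions k, s p = some .nil ∨ ∃ u ∈ occurring φ, s p = some (chosen u)
  task : ∀ t, s (taskName t) = some one →
    ∃ A, (t, A) ∈ witnesses φ k n ∧ ∀ x ∈ A, s x.1 = some x.2

theorem reachable_init (φ : CNF) (k n : ℕ) :
    Reachable φ k n (PState.val (satTarget φ k n).init) := by
  refine ⟨fun p hp => .inl ?_, fun t ht => ?_⟩
  · exact val_of_mem (satTarget_valid φ k n).2.1.1.1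
      (List.mem_map.2 ⟨_, satDoms_position hp, rfl⟩)
  · obtain ⟨y, -, hy⟩ := List.mem_map.1 (mem_of_val ht)
    simp [one] at hy

/-- A choice only overwrites `nil`, whereas witnesses consist of chosen values, so earlier witnesses
remain true. A test changes a task variable, which no witness mentions. -/
theorem Reachable.apply {φ : CNF} {k n : ℕ} {s : Data → Option Data} (h : Reachable φ k n s)
    {a : Action} (ha : a ∈ satActions φ k n) : Reachable φ k n (a.apply s) := by
  classical
  rcases List.mem_append.1 ha with ha | ha
  · obtain ⟨p, hp, ha⟩ := List.mem_flatMap.1 ha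
    obtain ⟨u, hu, rfl⟩ := List.mem_map.1 ha
    rw [chooseAction_apply]
    split_ifs with hs
    · refine ⟨fun p' hp' => ?_, fun t ht => ?_⟩
      · by_cases hpp : p' = p
        · subst hpp; exact .inr ⟨u, hu, by simp⟩
        · rw [Function.update_of_ne hpp]; exact h.position p' hp'
      · have hne : taskName t ≠ p := fun h => taskName_notMem_positions t k (h ▸ hp)
        rw [Function.update_of_ne hne] at ht
        obtain ⟨A, hA, hsA⟩ := h.task t ht
        refine ⟨A, hA, fun x hx => ?_⟩
        have hxp : x.1 ≠ p := fun hxp => by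
          have := hsA x hx
          obtain ⟨-, u, -, hu⟩ := (witnesses_spec hA).1.mem x hx
          rw [hxp, hs, hu] at this
          exact chosen_ne_nil u (Option.some.inj this).symm
        rw [Function.update_of_ne hxp]
        exact hsA x hx
    · exact h
  · obtain ⟨y, hy, rfl⟩ := List.mem_map.1 ha
    obtain ⟨hP, -, -, -⟩ := witnesses_spec hy
    rw [testAction_apply hP.keys_nodup]
    split_ifs with hs
    · have hne : ∀ (p : Data) (t : List Data), p ∈ positions k → p ≠ taskName t :=
        fun p t hp h => taskName_notMem_positions t k (h ▸ hp)
      refine ⟨fun p hp => ?_, fun t ht => ?_⟩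
      · rw [Function.update_of_ne (hne _ _ hp)]; exact h.position p hp
      · have key : ∃ A, (t, A) ∈ witnesses φ k n ∧ ∀ x ∈ A, s x.1 = some x.2 := by
          by_cases hty : t = y.1
          · subst hty; exact ⟨y.2, hy, hs⟩
          · rw [Function.update_of_ne (taskName_injective.ne hty)] at ht
            exact h.task t ht
        obtain ⟨A, hA, hsA⟩ := key
        refine ⟨A, hA, fun x hx => ?_⟩
        rw [Function.update_of_ne (hne _ _ ((witnesses_spec hA).1.mem x hx).1)]
        exact hsA x hx
    · exact h

theorem satTests_mem {k n : ℕ} {t : List Data} (ht : t.Nodup) (hV : ∀ p ∈ t, p ∈ positions k)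
    (hn : t.length ≤ n) : t ∈ satTests k n :=
  List.mem_dedup.2 (mem_tests ht hV hn)

/-- Tests of one position show that it is filled, tests of two positions that their values differ,
and tests of up to `q` positions that no clause is violated; `q + 2` covers all three. -/
theorem Reachable.satisfiable {φ : CNF} {k n q : ℕ} {s : Data → Option Data}
    (h : Reachable φ k n s) (hφ : ∀ C ∈ φ, C.length ≤ q) (hn : q + 2 ≤ n)
    (hs : ∀ t ∈ satTests k n, s (taskName t) = some one) :
    ∃ S : Finset Data, S ⊆ CNF.vars φ ∧ S.card = k ∧ CNF.SatisfiedBy φ S := by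
  classical
  have htest : ∀ t : List Data, t.Nodup → (∀ p ∈ t, p ∈ positions k) → t.length ≤ n →
      ∃ A, (IsPartial (positions k) (occurring φ) A ∧ violated φ A = []) ∧
        (∀ p ∈ t, ∃ d, (p, d) ∈ A) ∧ ∀ x ∈ A, s x.1 = some x.2 := by
    intro t h1 h2 h3
    obtain ⟨A, hA, hsA⟩ := h.task t (hs t (satTests_mem h1 h2 h3))
    obtain ⟨i1, -, i2, i3⟩ := witnesses_spec hA
    refine ⟨A, ⟨i1, i3⟩, fun p hp => ?_, hsA⟩
    obtain ⟨x, hx, rfl⟩ := List.mem_map.1 (i2 p hp)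
    exact ⟨x.2, hx⟩
  have hu : ∀ p ∈ positions k, ∃ u ∈ occurring φ, s p = some (chosen u) := by
    intro p hp
    obtain ⟨A, ⟨hA, -⟩, h1, h2⟩ := htest [p] (by simp) (by simpa using hp) (by simp; omega)
    obtain ⟨d, hd⟩ := h1 p (by simp)
    obtain ⟨-, u, hu, rfl⟩ := hA.mem _ hd
    exact ⟨u, hu, h2 _ hd⟩
  choose! u hu hsu using hu
  have hinj : Set.InjOn u {p | p ∈ positions k} := by
    intro p hp p' hp' heq
    by_contra hne
    -- Distinctness is inherited from the witness, which has no repeated values.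
    obtain ⟨A, ⟨hA, -⟩, h1, h2⟩ := htest [p, p'] (by simp [hne])
      (by simpa using ⟨hp, hp'⟩) (by simp; omega)
    obtain ⟨d, hd⟩ := h1 p (by simp)
    obtain ⟨d', hd'⟩ := h1 p' (by simp)
    have e1 : d = chosen (u p) := Option.some.inj ((h2 _ hd).symm.trans (hsu p hp))
    have e2 : d' = chosen (u p') := Option.some.inj ((h2 _ hd').symm.trans (hsu p' hp'))
    have := List.inj_on_of_nodup_map hA.values_nodup hd hd' (by rw [e1, e2, heq])
    exact hne (Prod.ext_iff.1 this).1
  refine ⟨(positions k).toFinset.image u, ?_, ?_, ?_⟩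
  · intro v hv
    obtain ⟨p, hp, rfl⟩ := Finset.mem_image.1 hv
    exact mem_vars.2 (mem_occurring.1 (hu p (List.mem_toFinset.1 hp)))
  · rw [Finset.card_image_of_injOn (fun p hp p' hp' => hinj (by simpa using hp)
      (by simpa using hp')), List.toFinset_card_of_nodup (positions_nodup k), length_positions]
  · intro C hC
    by_contra hcon
    push Not at hcon
    have hex : ∀ v, (false, v) ∈ C → ∃ p ∈ positions k, u p = v := by
      intro v hv
      have := hcon _ hv
      simpa using this
    choose! w hw huw using hex
    -- The positions that hold the variables negated in the violated clause, at most `q` of them.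
    set t := (((C.filter fun l => l.1 = false).map fun l => w l.2)).dedup with ht
    have hmem : ∀ p, p ∈ t ↔ ∃ v, (false, v) ∈ C ∧ w v = p := by
      intro p; simp [ht]
    obtain ⟨A, ⟨hA, hvio⟩, h1, h2⟩ := htest t (List.nodup_dedup _)
      (fun p hp => by obtain ⟨v, hv, rfl⟩ := (hmem p).1 hp; exact hw v hv) (by
        have := (List.dedup_sublist ((C.filter fun l => l.1 = false).map fun l => w l.2)).length_le
        rw [List.length_map] at this
        rw [← ht] at this
        have := List.length_filter_le (fun l => decide (l.1 = false)) C
        have := hφ C hC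
        omega)
    have hnv : C ∉ violated φ A := by simp [hvio]
    rw [mem_violated] at hnv
    push Not at hnv
    -- A literal of `C` that is true under `A`. If negative, its variable sits at a position of `t`
    -- and hence in `A`; if positive, its variable is one of the chosen ones. Both are impossible.
    obtain ⟨⟨b, v⟩, hl, hiff⟩ := hnv hC
    cases b
    · have hp : w v ∈ t := (hmem _).2 ⟨v, hl, rfl⟩
      obtain ⟨d, hd⟩ := h1 _ hp
      have e1 : d = chosen (u (w v)) := Option.some.inj ((h2 _ hd).symm.trans (hsu _ (hw v hl)))
      rw [huw v hl] at e1
      subst e1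
      simp only [Bool.false_eq_true, false_iff] at hiff
      exact hiff (List.mem_map.2 ⟨_, hd, rfl⟩)
    · simp only [true_iff] at hiff
      obtain ⟨x, hx, hxv⟩ := List.mem_map.1 hiff
      have hx1 := (hA.mem x hx).1
      have e1 : x.2 = chosen (u x.1) := Option.some.inj ((h2 _ hx).symm.trans (hsu _ hx1))
      rw [hxv] at e1
      have := hcon _ hl
      simp only [Finset.mem_image, List.mem_toFinset] at this
      have hmem : ∃ a ∈ positions k, u a = v := ⟨x.1, hx1, (chosen_injective e1).symm⟩
      simp [hmem] at this

/-! ### From satisfying assignments to plans -/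

section Completeness

variable {φ : CNF} {k n : ℕ} {S : Finset Data} {h : Data → Data}

theorem root_mem {V U : List Data} (hU : ∀ p ∈ V, h p ∈ U) (hinj : ∀ p ∈ V, ∀ p' ∈ V,
    h p = h p' → p = p') {n : ℕ} {t : List Data} (ht : t ∈ tests V n) :
    t.map (fun p => (p, chosen (h p))) ∈ roots V U n := by
  induction n generalizing t with
  | zero =>
    obtain rfl : t = [] := by simpa [tests] using ht
    simp [roots]
  | succ n ih =>
    rcases mem_tests_succ.1 ht with ht | ⟨t, ht', p, hp, h1, rfl⟩
    · exact mem_roots_succ.2 (.inl (ih ht))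
    · refine mem_roots_succ.2 (.inr ⟨_, ih ht', p, hp, h p, hU p hp, ?_, ?_, rfl⟩)
      · simpa using h1
      · simp only [List.map_map, List.mem_map, not_exists, not_and]
        intro p' hp' heq
        have := hinj p' ((subset_of_mem_tests ht').2.1 p' hp') p hp (chosen_injective heq)
        exact h1 (this ▸ hp')

/-- Along the search, one branch stays inside the assignment `h`. A clause violated by `A` but
satisfied by `S` has a positive literal in `S`, which can be added at its position under `h`. -/
theorem exists_witness (hU : ∀ p ∈ positions k, h p ∈ occurring φ)
    (hinj : ∀ p ∈ positions k, ∀ p' ∈ positions k, h p = h p' → p = p')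
    (hS : ∀ u, u ∈ S ↔ ∃ p ∈ positions k, h p = u) (hsat : CNF.SatisfiedBy φ S)
    {t : List Data} (ht : t ∈ satTests k n) :
    ∃ A, (t, A) ∈ witnesses φ k n ∧ ∀ x ∈ A, x.1 ∈ positions k ∧ x.2 = chosen (h x.1) := by
  have key : ∀ j, ∃ A, (t, A) ∈ (searchStep φ (positions k))^[j]
      (searchInit (positions k) (occurring φ) n) ∧
      (∀ x ∈ A, x.1 ∈ positions k ∧ x.2 = chosen (h x.1)) ∧
      (violated φ A = [] ∨ j ≤ A.length) := by
    intro j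
    induction j with
    | zero =>
      refine ⟨t.map fun p => (p, chosen (h p)), List.mem_map.2
        ⟨_, root_mem hU hinj (List.mem_dedup.1 ht), by simp [Function.comp_def]⟩, fun x hx => ?_,
        .inr (Nat.zero_le _)⟩
      obtain ⟨p, hp, rfl⟩ := List.mem_map.1 hx
      exact ⟨(subset_of_mem_tests (List.mem_dedup.1 ht)).2.1 p hp, rfl⟩
    | succ j ih =>
      obtain ⟨A, hA, hAh, hj⟩ := ih
      by_cases hv : violated φ A = []
      · refine ⟨A, ?_, hAh, .inl hv⟩
        rw [Function.iterate_succ_apply']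
        refine List.mem_flatMap.2 ⟨_, hA, List.mem_map.2 ⟨A, ?_, rfl⟩⟩
        simp [expand, hv]
      · obtain ⟨hC, hCv⟩ := mem_violated.1 (headD_violated_mem hv)
        obtain ⟨⟨b, u⟩, hl, hu⟩ := hsat _ hC
        have hnot := hCv _ hl
        have hvals : chosen u ∈ A.map Prod.snd → u ∈ S := by
          intro hm
          obtain ⟨x, hx, hxu⟩ := List.mem_map.1 hm
          rw [(hAh x hx).2] at hxu
          exact (hS u).2 ⟨x.1, (hAh x hx).1, chosen_injective hxu⟩
        cases b
        -- A negative literal cannot be the one satisfied by `S`: it is false under `A`, so its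
        -- variable is a value of `A` and thus lies in `S`.
        · simp only [Bool.false_eq_true, false_iff, not_not] at hu hnot
          exact absurd (hvals hnot) hu
        simp only [true_iff] at hu hnot
        obtain ⟨p, hp, rfl⟩ := (hS u).1 hu
        have hpA : p ∉ A.map Prod.fst := by
          intro hpA
          obtain ⟨x, hx, rfl⟩ := List.mem_map.1 hpA
          exact hnot (List.mem_map.2 ⟨x, hx, (hAh x hx).2⟩)
        refine ⟨(p, chosen (h p)) :: A, ?_, ?_, .inr ?_⟩
        · rw [Function.iterate_succ_apply']
          refine List.mem_flatMap.2 ⟨_, hA, List.mem_map.2 ⟨_, ?_, rfl⟩⟩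
          rw [expand, if_neg hv]
          refine List.mem_flatMap.2 ⟨_, hl, ?_⟩
          rw [if_pos rfl]
          refine List.mem_flatMap.2 ⟨p, hp, ?_⟩
          rw [if_neg hpA]
          simp
        · intro x hx
          rcases List.mem_cons.1 hx with rfl | hx
          · exact ⟨hp, rfl⟩
          · exact hAh x hx
        · rcases hj with hj | hj
          · exact absurd hj hv
          · simpa using hj
  obtain ⟨A, hA, hAh, hk⟩ := key k
  refine ⟨A, List.mem_filter.2 ⟨hA, decide_eq_true_iff.2 ?_⟩, hAh⟩
  rcases hk with hk | hk
  · exact hk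
  have hP := (search_iterate_isPartial hA).1
  -- Now `A` fills every position, so its values are exactly `S`, and `S` satisfies the formula.
  have hsub : positions k ⊆ A.map Prod.fst := by
    have h1 : A.map Prod.fst ⊆ positions k := fun p hp => by
      obtain ⟨x, hx, rfl⟩ := List.mem_map.1 hp
      exact (hAh x hx).1
    have h2 := (hP.keys_nodup.subperm h1).perm_of_length_le (by simpa [length_positions] using hk)
    exact h2.symm.subset
  have hvals : ∀ u, chosen u ∈ A.map Prod.snd ↔ u ∈ S := by
    intro u
    rw [hS]
    constructor
    · intro hm
      obtain ⟨x, hx, hxu⟩ := List.mem_map.1 hm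
      rw [(hAh x hx).2] at hxu
      exact ⟨x.1, (hAh x hx).1, chosen_injective hxu⟩
    · rintro ⟨p, hp, rfl⟩
      obtain ⟨x, hx, rfl⟩ := List.mem_map.1 (hsub hp)
      exact List.mem_map.2 ⟨x, hx, (hAh x hx).2⟩
  refine List.eq_nil_iff_forall_not_mem.2 fun C hC => ?_
  obtain ⟨hC, hCv⟩ := mem_violated.1 hC
  obtain ⟨l, hl, hlS⟩ := hsat C hC
  exact hCv l hl (hlS.trans (hvals l.2).symm)

theorem run_choose {L : List Data} (hL : L.Nodup) {s : Data → Option Data}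
    (hs : ∀ p ∈ L, s p = some .nil) :
    run (L.map fun p => chooseAction p (h p)) s =
      fun v => if v ∈ L then some (chosen (h v)) else s v := by
  induction L generalizing s with
  | nil => rfl
  | cons p L ih =>
    obtain ⟨h1, h2⟩ := List.nodup_cons.1 hL
    rw [List.map_cons, run_cons, chooseAction_apply, if_pos (hs p (by simp)), ih h2 ?_]
    · funext v
      by_cases hv : v = p
      · subst hv; simp [h1]
      · simp [hv]
    · intro p' hp'
      have hne : p' ≠ p := fun heq => h1 (heq ▸ hp')
      rw [Function.update_of_ne hne]
      exact hs p' (by simp [hp'])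

theorem run_tests {A : List Data → PState} {T : List (List Data)} {s : Data → Option Data}
    (hA : ∀ t ∈ T, ((A t).map Prod.fst).Nodup)
    (hs : ∀ t ∈ T, ∀ x ∈ A t, x.1 ∈ positions k ∧ s x.1 = some x.2) :
    run (T.map fun t => testAction (t, A t)) s =
      fun v => if v ∈ T.map taskName then some one else s v := by
  classical
  induction T generalizing s with
  | nil => rfl
  | cons t T ih =>
    rw [List.map_cons, run_cons, testAction_apply (hA t (by simp)),
      if_pos (fun x hx => (hs t (by simp) x hx).2),
      ih (fun t ht => hA t (by simp [ht])) ?_]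
    · funext v
      by_cases hv : v = taskName t
      · subst hv; simp
      · simp [hv]
    · intro t' ht' x hx
      obtain ⟨i1, i2⟩ := hs t' (by simp [ht']) x hx
      refine ⟨i1, ?_⟩
      have hne : x.1 ≠ taskName t := fun heq => taskName_notMem_positions t k (heq ▸ i1)
      rw [Function.update_of_ne hne]
      exact i2

end Completeness

theorem exists_bijection {L : List Data} (hL : L.Nodup) {S : Finset Data}
    (hS : S.card = L.length) : ∃ h : Data → Data, (∀ p ∈ L, ∀ p' ∈ L, h p = h p' → p = p') ∧
      ∀ u, u ∈ S ↔ ∃ p ∈ L, h p = u := by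
  classical
  have hc : L.toFinset.card = S.card := by rw [List.toFinset_card_of_nodup hL, hS]
  let f := Finset.equivOfCardEq hc
  refine ⟨fun p => if hp : p ∈ L.toFinset then (f ⟨p, hp⟩).1 else p, ?_, ?_⟩
  · intro p hp p' hp' heq
    have hp := List.mem_toFinset.2 hp
    have hp' := List.mem_toFinset.2 hp'
    simp only [hp, hp', dif_pos] at heq
    exact congrArg Subtype.val (f.injective (Subtype.ext heq))
  · intro u
    constructor
    · intro hu
      obtain ⟨p, hp⟩ := f.surjective ⟨u, hu⟩
      refine ⟨p.1, List.mem_toFinset.1 p.2, ?_⟩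
      simp [hp]
    · rintro ⟨p, hp, rfl⟩
      have hp := List.mem_toFinset.2 hp
      simp only [hp, dif_pos]
      exact (f ⟨p, hp⟩).2

theorem satTarget_goal_iff {φ : CNF} {k n : ℕ} {s : Data → Option Data} :
    Agrees s (satTarget φ k n).goal ↔ ∀ t ∈ satTests k n, s (taskName t) = some one := by
  rw [agrees_iff (satTarget_valid φ k n).2.2.1.1]
  simp [satTarget]

theorem satCaseMod_yes_iff {φ : CNF} {k n q : ℕ} (hφ : ∀ C ∈ φ, C.length ≤ q) (hn : q + 2 ≤ n) :
    (satCaseMod φ k n).Yes ↔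
      ∃ S : Finset Data, S ⊆ CNF.vars φ ∧ S.card = k ∧ CNF.SatisfiedBy φ S := by
  classical
  constructor
  · rintro ⟨g, -, hg, i, -, ⟨-, h2⟩, -⟩
    have h3 : g.take i ++ (satCaseMod φ k n).casePlan ++ g.drop i = g := by
      simp [satCaseMod]
    rw [h3] at h2
    have hr : Reachable φ k n (run g (PState.val (satTarget φ k n).init)) :=
      run_induction (fun a ha s hs => hs.apply (hg a ha)) (reachable_init φ k n)
    exact hr.satisfiable hφ hn (satTarget_goal_iff.1 h2)
  · rintro ⟨S, hSv, hSk, hsat⟩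
    obtain ⟨h, hinj, hS⟩ := exists_bijection (positions_nodup k)
      (hSk.trans (length_positions k).symm)
    have hU : ∀ p ∈ positions k, h p ∈ occurring φ := fun p hp =>
      mem_occurring.2 (mem_vars.1 (hSv ((hS _).2 ⟨p, hp, rfl⟩)))
    have hw : ∀ t, t ∈ satTests k n → ∃ A, (t, A) ∈ witnesses φ k n ∧
        ∀ x ∈ A, x.1 ∈ positions k ∧ x.2 = chosen (h x.1) :=
      fun t ht => exists_witness hU hinj hS hsat ht
    choose! A hA hAh using hw
    set g1 := (positions k).map fun p => chooseAction p (h p) with hg1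
    set g2 := (satTests k n).map fun t => testAction (t, A t) with hg2
    have hmem : ∀ a ∈ g1 ++ g2, a ∈ satActions φ k n := by
      intro a ha
      rcases List.mem_append.1 ha with ha | ha
      · obtain ⟨p, hp, rfl⟩ := List.mem_map.1 ha
        exact List.mem_append_left _ (List.mem_flatMap.2
          ⟨p, hp, List.mem_map.2 ⟨_, hU p hp, rfl⟩⟩)
      · obtain ⟨t, ht, rfl⟩ := List.mem_map.1 ha
        exact List.mem_append_right _ (List.mem_map.2 ⟨_, hA t ht, rfl⟩)
    -- The empty case is placed at the very beginning, where its initial state holds by definition.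
    refine ⟨g1 ++ g2, by simp [hg1, hg2, satCaseMod], hmem, 0, Nat.zero_le _, ⟨?_, ?_⟩, rfl⟩
    · intro a ha
      exact hmem a (by simpa [satCaseMod] using ha)
    · have h0 : (g1 ++ g2).take 0 ++ (satCaseMod φ k n).casePlan ++ (g1 ++ g2).drop 0 =
          g1 ++ g2 := by simp [satCaseMod]
      rw [h0]
      refine satTarget_goal_iff.2 fun t ht => ?_
      rw [run_append, hg1, run_choose (positions_nodup k), hg2, run_tests (k := k)]
      · exact if_pos (List.mem_map.2 ⟨t, ht, rfl⟩)
      · exact fun t ht => (witnesses_spec (hA t ht)).1.keys_nodup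
      · intro t ht x hx
        obtain ⟨i1, i2⟩ := hAh t ht x hx
        exact ⟨i1, by rw [i2]; exact if_pos i1⟩
      · intro p hp
        exact val_of_mem (satTarget_valid φ k n).2.1.1.1
          (List.mem_map.2 ⟨_, satDoms_position hp, rfl⟩)

/-! ### Hardness -/

theorem lvCaseMod_hard : W1Hard LVCaseMod := by
  rintro P ⟨q, hP⟩
  have hk : FC (WSatCNF q).param (WSatCNF q).input (fun x => x.2) :=
    (FC.fst_snd_self (F := fun x : (WSatCNF q).Inst => x.1.1) (G := fun x => x.2)).2.recode
      (fun _ => rfl) fun _ => rfl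
  have hφ : FC (WSatCNF q).param (WSatCNF q).input (fun x => x.1.1) :=
    (FC.fst_snd_self (F := fun x : (WSatCNF q).Inst => x.1.1) (G := fun x => x.2)).1.recode
      (fun _ => rfl) fun _ => rfl
  obtain ⟨h1, h2⟩ := FC.satCaseMod (fun x => x.1.2) hφ hk (fun _ => le_rfl) (q + 2)
  refine hP.trans_FC (fun x => ⟨satCaseMod x.1.1 x.2 (q + 2), satCaseMod_valid _ _ _⟩)
    (fun x => (satCaseMod_yes_iff x.1.2 le_rfl).symm) (g := fun k => 2 * (k + (k + 1) ^ (q + 2)))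
    ?_ ?_ (fun x => satCaseMod_param_le _ _ _) ((h1.pair h2).recode (fun _ => rfl) fun _ => rfl)
  · exact Primrec.nat_mul.comp (Primrec.const 2) (Primrec.nat_add.comp Primrec.id
      ((Primrec₂.unpaired'.1 Nat.Primrec.pow).comp Primrec.succ (Primrec.const _)))
  · intro a b hab
    dsimp only
    gcongr

/-! ## Constraint satisfaction as weighted satisfiability -/

/-- The propositional variable that stands for the assignment of a value to a slot. -/
def propVar (s d : Data) : Data := .cons s d

/-- The clauses saying that no slot has two values. All literals occur in them. -/
def slotClauses (L : List (Data × List Data)) : CNF :=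
  L.flatMap fun y => y.2.flatMap fun d =>
    [(true, propVar y.1 d), (false, propVar y.1 d)] :: y.2.flatMap fun d' =>
      if d = d' then [] else [[(false, propVar y.1 d), (false, propVar y.1 d')]]

/-- The clause that forbids a combination of values. -/
def forbid (c : List (Data × Data)) : Clause := c.map fun z => (false, propVar z.1 z.2)

def cspCNF (L : List (Data × List Data)) (F : List (List (Data × Data))) : CNF :=
  slotClauses L ++ F.map forbid

theorem mem_slotClauses {L : List (Data × List Data)} {C : Clause} :
    C ∈ slotClauses L ↔ ∃ y ∈ L, ∃ d ∈ y.2, C = [(true, propVar y.1 d), (false, propVar y.1 d)] ∨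
      ∃ d' ∈ y.2, d ≠ d' ∧ C = [(false, propVar y.1 d), (false, propVar y.1 d')] := by
  simp only [slotClauses, List.mem_flatMap, List.mem_cons]
  refine exists_congr fun y => and_congr_right fun _ => exists_congr fun d =>
    and_congr_right fun _ => or_congr_right (exists_congr fun d' => and_congr_right fun _ => ?_)
  split_ifs with h <;> simp [h]

theorem cspCNF_bounded {L : List (Data × List Data)} {F : List (List (Data × Data))} {q : ℕ}
    (hq : 2 ≤ q) (hF : ∀ c ∈ F, c.length ≤ q) : ∀ C ∈ cspCNF L F, C.length ≤ q := by
  intro C hC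
  rcases List.mem_append.1 hC with h | h
  · obtain ⟨y, -, d, -, rfl | ⟨d', -, -, rfl⟩⟩ := mem_slotClauses.1 h <;> simpa using hq
  · obtain ⟨c, hc, rfl⟩ := List.mem_map.1 h
    simpa [forbid] using hF c hc

theorem propVar_injective {s d s' d' : Data} (h : propVar s d = propVar s' d') :
    s = s' ∧ d = d' := by
  simpa [propVar] using h

theorem mem_vars_cspCNF {L : List (Data × List Data)} {F : List (List (Data × Data))}
    (hF : ∀ c ∈ F, ∀ z ∈ c, ∃ y ∈ L, y.1 = z.1 ∧ z.2 ∈ y.2) {u : Data} :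
    u ∈ CNF.vars (cspCNF L F) ↔ ∃ y ∈ L, ∃ d ∈ y.2, u = propVar y.1 d := by
  rw [mem_vars]
  constructor
  · rintro ⟨C, hC, b, hu⟩
    rcases List.mem_append.1 hC with h | h
    · obtain ⟨y, hy, d, hd, rfl | ⟨d', hd', -, rfl⟩⟩ := mem_slotClauses.1 h
      · simp only [List.mem_cons, Prod.mk.injEq, List.not_mem_nil, or_false] at hu
        exact ⟨y, hy, d, hd, by tauto⟩
      · simp only [List.mem_cons, Prod.mk.injEq, List.not_mem_nil, or_false] at hu
        rcases hu with hu | hu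
        · exact ⟨y, hy, d, hd, hu.2⟩
        · exact ⟨y, hy, d', hd', hu.2⟩
    · obtain ⟨c, hc, rfl⟩ := List.mem_map.1 h
      obtain ⟨z, hz, hzu⟩ := List.mem_map.1 hu
      obtain ⟨y, hy, h1, h2⟩ := hF c hc z hz
      exact ⟨y, hy, z.2, h2, by rw [h1]; exact (congrArg Prod.snd hzu).symm⟩
  · rintro ⟨y, hy, d, hd, rfl⟩
    exact ⟨_, List.mem_append_left _ (mem_slotClauses.2 ⟨y, hy, d, hd, .inl rfl⟩), true, by simp⟩

/-- No clause demands that a slot has a value. The weight does: at most one value per slot and as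
many true variables as slots leave exactly one value for each slot. -/
theorem cspCNF_satisfiable_iff {L : List (Data × List Data)} {F : List (List (Data × Data))}
    (hL : (L.map Prod.fst).Nodup) (hF : ∀ c ∈ F, ∀ z ∈ c, ∃ y ∈ L, y.1 = z.1 ∧ z.2 ∈ y.2) :
    (∃ S : Finset Data, S ⊆ CNF.vars (cspCNF L F) ∧ S.card = L.length ∧
      CNF.SatisfiedBy (cspCNF L F) S) ↔
    ∃ f : Data → Data, (∀ y ∈ L, f y.1 ∈ y.2) ∧ ∀ c ∈ F, ∃ z ∈ c, f z.1 ≠ z.2 := by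
  classical
  have hcard : (L.map Prod.fst).toFinset.card = L.length := by
    rw [List.toFinset_card_of_nodup hL, List.length_map]
  constructor
  · rintro ⟨S, hSv, hSc, hsat⟩
    have hS : ∀ u ∈ S, ∃ y ∈ L, ∃ d ∈ y.2, u = propVar y.1 d := fun u hu =>
      (mem_vars_cspCNF hF).1 (hSv hu)
    have huniq : ∀ y ∈ L, ∀ d ∈ y.2, ∀ d' ∈ y.2, propVar y.1 d ∈ S → propVar y.1 d' ∈ S →
        d = d' := by
      intro y hy d hd d' hd' h1 h2
      by_contra hne
      obtain ⟨l, hl, hlS⟩ := hsat [(false, propVar y.1 d), (false, propVar y.1 d')]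
        (List.mem_append_left _ (mem_slotClauses.2 ⟨y, hy, d, hd, .inr ⟨d', hd', hne, rfl⟩⟩))
      rcases List.mem_cons.1 hl with rfl | hl
      · simp [h1] at hlS
      · obtain rfl := List.mem_singleton.1 hl
        simp [h2] at hlS
    -- `Data.hd` reads off the slot of a propositional variable. It is injective on `S`, so the
    -- cardinality makes it hit all slots.
    have himg : S.image Data.hd = (L.map Prod.fst).toFinset := by
      refine Finset.eq_of_subset_of_card_le ?_ ?_
      · intro s hs
        obtain ⟨u, hu, rfl⟩ := Finset.mem_image.1 hs
        obtain ⟨y, hy, d, -, rfl⟩ := hS u hu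
        exact List.mem_toFinset.2 (List.mem_map.2 ⟨y, hy, rfl⟩)
      · rw [Finset.card_image_of_injOn, hSc, hcard]
        intro u hu u' hu' heq
        obtain ⟨y, hy, d, hd, rfl⟩ := hS u hu
        obtain ⟨y', hy', d', hd', rfl⟩ := hS u' hu'
        have h1 : y.1 = y'.1 := heq
        obtain rfl := List.inj_on_of_nodup_map hL hy hy' h1
        rw [huniq y hy d hd d' hd' hu hu']
    have hex : ∀ y ∈ L, ∃ d, d ∈ y.2 ∧ propVar y.1 d ∈ S := by
      intro y hy
      have : y.1 ∈ S.image Data.hd := by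
        rw [himg]; exact List.mem_toFinset.2 (List.mem_map.2 ⟨y, hy, rfl⟩)
      obtain ⟨u, hu, huy⟩ := Finset.mem_image.1 this
      obtain ⟨y', hy', d, hd, rfl⟩ := hS u hu
      have h1 : y'.1 = y.1 := huy
      obtain rfl := List.inj_on_of_nodup_map hL hy' hy h1
      exact ⟨d, hd, hu⟩
    have hex' : ∀ s, ∃ d, ∀ y ∈ L, y.1 = s → d ∈ y.2 ∧ propVar s d ∈ S := by
      intro s
      by_cases h : ∃ y ∈ L, y.1 = s
      · obtain ⟨y, hy, rfl⟩ := h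
        obtain ⟨d, hd⟩ := hex y hy
        refine ⟨d, fun y' hy' heq => ?_⟩
        obtain rfl := List.inj_on_of_nodup_map hL hy' hy heq
        exact hd
      · exact ⟨.nil, fun y hy hys => absurd ⟨y, hy, hys⟩ h⟩
    choose f hf using hex'
    refine ⟨f, fun y hy => (hf y.1 y hy rfl).1, fun c hc => ?_⟩
    obtain ⟨l, hl, hlS⟩ := hsat (forbid c) (List.mem_append_right _ (List.mem_map.2 ⟨c, hc, rfl⟩))
    obtain ⟨z, hz, rfl⟩ := List.mem_map.1 hl
    refine ⟨z, hz, fun heq => ?_⟩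
    obtain ⟨y, hy, h1, -⟩ := hF c hc z hz
    have := (hf z.1 y hy h1).2
    rw [heq] at this
    simp [this] at hlS
  · rintro ⟨f, hfL, hfF⟩
    have hmem : ∀ s d, propVar s d ∈ (L.map Prod.fst).toFinset.image (fun s => propVar s (f s)) ↔
        s ∈ L.map Prod.fst ∧ d = f s := by
      intro s d
      rw [Finset.mem_image]
      constructor
      · rintro ⟨s', hs', h⟩
        obtain ⟨rfl, rfl⟩ := propVar_injective h
        exact ⟨List.mem_toFinset.1 hs', rfl⟩
      · rintro ⟨hs, rfl⟩
        exact ⟨s, List.mem_toFinset.2 hs, rfl⟩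
    refine ⟨(L.map Prod.fst).toFinset.image fun s => propVar s (f s), ?_, ?_, ?_⟩
    · intro u hu
      obtain ⟨s, hs, rfl⟩ := Finset.mem_image.1 hu
      obtain ⟨y, hy, rfl⟩ := List.mem_map.1 (List.mem_toFinset.1 hs)
      exact (mem_vars_cspCNF hF).2 ⟨y, hy, _, hfL y hy, rfl⟩
    · rw [Finset.card_image_of_injective _ (fun s s' h => (propVar_injective h).1), hcard]
    · intro C hC
      rcases List.mem_append.1 hC with h | h
      · obtain ⟨y, hy, d, hd, rfl | ⟨d', hd', hne, rfl⟩⟩ := mem_slotClauses.1 h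
        -- The tautological clause, present only to make the variable occur in the formula.
        · by_cases hu : propVar y.1 d ∈
            (L.map Prod.fst).toFinset.image fun s => propVar s (f s)
          · exact ⟨_, List.mem_cons_self, by simpa only [true_iff] using hu⟩
          · exact ⟨_, List.mem_cons_of_mem _ List.mem_cons_self, by
              simpa only [Bool.false_eq_true, false_iff] using hu⟩
        · by_cases hu : d = f y.1
          · refine ⟨_, List.mem_cons_of_mem _ List.mem_cons_self, ?_⟩
            simp only [Bool.false_eq_true, false_iff, hmem, not_and]
            exact fun _ h => hne (hu.trans h.symm)
          · refine ⟨_, List.mem_cons_self, ?_⟩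
            simp only [Bool.false_eq_true, false_iff, hmem, not_and]
            exact fun _ => hu
      · obtain ⟨c, hc, rfl⟩ := List.mem_map.1 h
        obtain ⟨z, hz, hne⟩ := hfF c hc
        refine ⟨_, List.mem_map.2 ⟨z, hz, rfl⟩, ?_⟩
        simp only [Bool.false_eq_true, false_iff, hmem, not_and]
        exact fun _ h => hne h.symm

/-! ## From case modification to constraint satisfaction: the construction -/

/-- The effect of an action on a state that is given by a list. -/
def stepState (s : PState) (a : Action) : PState :=
  if ∀ v ∈ PState.vars a.pre, PState.val s v = PState.val a.pre v then a.post ++ s else s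

namespace CaseModData

variable (x : CaseModData)

/-- The final state of the case. -/
def caseResult : PState := x.casePlan.foldl stepState x.caseInit

def glueList : List Data := (x.glueActions.flatMap Action.vars).dedup

/-- A variable that tells whether the plan of the case has been executed. -/
def phase : Data := enc x.glueList

/-- The execution of the plan of the case, as a single action. -/
def caseAction : Action := ⟨(x.phase, .nil) :: x.caseInit, (x.phase, one) :: x.caseResult⟩

/-- The actions of the plans to be searched for. -/
def steps : List Action := ⟨[], []⟩ :: x.caseAction :: x.glueActions

def startState : PState := (x.phase, .nil) :: x.target.init

/-- Requiring the phase `one` at the end forces the case to be executed. -/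
def finalState : PState := (x.phase, one) :: x.target.goal

def stepVars : List Data := x.phase :: x.glueList

/-- A variable only ever holds its initial value or one written by a postcondition, so these values
suffice. -/
def stepValues : List Data :=
  x.startState.map Prod.snd ++ x.steps.flatMap fun a => a.post.map Prod.snd

end CaseModData

def eventSlot (j : ℕ) : Data := .cons .nil (enc j)

def stateSlot (j : ℕ) (v : Data) : Data := .cons (.cons .nil v) (enc j)

/-- The action `a` is applicable where `v` has the value `d`, and then `v` gets the value `d'`. -/
def Allowed (a : Action) (v d d' : Data) : Prop :=
  (PState.val a.pre v = none ∨ PState.val a.pre v = some d) ∧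
    PState.val (a.post ++ [(v, d)]) v = some d'

instance (a : Action) (v d d' : Data) : Decidable (Allowed a v d d') :=
  inferInstanceAs (Decidable (_ ∧ _))

namespace CaseModData

variable (x : CaseModData)

def slots : List (Data × List Data) :=
  (List.range (x.maxGlue + 1)).map (fun j => (eventSlot j, x.steps.map enc)) ++
    (List.range (x.maxGlue + 2)).flatMap fun j => x.stepVars.map fun v =>
      (stateSlot j v, x.stepValues)

def forbiddenSteps : List (List (Data × Data)) :=
  (List.range (x.maxGlue + 1)).flatMap fun j => x.stepVars.flatMap fun v =>
    x.steps.flatMap fun a => x.stepValues.flatMap fun d => x.stepValues.flatMap fun d' =>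
      if Allowed a v d d' then [] else
        [[(eventSlot j, enc a), (stateSlot j v, d), (stateSlot (j + 1) v, d')]]

def forbiddenStart : List (List (Data × Data)) :=
  x.stepVars.flatMap fun v => x.stepValues.flatMap fun d =>
    if PState.val x.startState v = some d then [] else [[(stateSlot 0 v, d)]]

def forbiddenFinal : List (List (Data × Data)) :=
  x.stepVars.flatMap fun v => x.stepValues.flatMap fun d =>
    if PState.val x.finalState v = none ∨ PState.val x.finalState v = some d then []
    else [[(stateSlot (x.maxGlue + 1) v, d)]]

/-- The variables that do not occur in glue steps need the right values from the start. -/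
def forbiddenElsewhere : List (List (Data × Data)) :=
  ((PState.vars x.target.init ++ PState.vars x.caseInit).flatMap fun v =>
    if v ∈ x.glueList ∨ PState.val x.target.init v = PState.val x.caseInit v then [] else [[]]) ++
  (PState.vars x.target.goal).flatMap fun v =>
    if v ∈ x.glueList ∨ PState.val x.caseResult v = PState.val x.target.goal v then [] else [[]]

def forbidden : List (List (Data × Data)) :=
  x.forbiddenSteps ++ (x.forbiddenStart ++ (x.forbiddenFinal ++ x.forbiddenElsewhere))

end CaseModData

/-! ### The construction can be computed -/

instance {α : Type} [Enc α] : Enc (Option α) :=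
  ⟨fun o => enc o.toList, fun a b h => by
    have := Enc.enc_injective (α := List α) h
    cases a <;> cases b <;> simp_all⟩

/-- Expresses lookup by operations already available in `FC`. -/
theorem val_eq_head? (A : PState) (v : Data) :
    PState.val A v = ((A.filter fun y => decide (y.1 = v)).map Prod.snd).head? := by
  induction A with
  | nil => rfl
  | cons x A ih =>
    rw [val_cons]
    by_cases h : x.1 = v
    · simp [h]
    · simp only [Ne.symm h, if_false, ih]
      simp [h]

namespace FC

variable {ι α : Type} [Enc α] {κ : ι → ℕ} {e : ι → α}

theorem some {β : Type} [Enc β] {a : ι → β} (ha : FC κ e a) :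
    FC κ e (fun x => Option.some (a x)) :=
  (ha.cons nil).recode (fun _ => rfl) (fun _ => rfl)

theorem none {β : Type} [Enc β] : FC κ e (fun _ => (Option.none : Option β)) := const _

theorem val {A : ι → PState} {v : ι → Data} (hA : FC κ e A) (hv : FC κ e v) :
    FC κ e (fun x => PState.val (A x) (v x)) := by
  have h := (hA.filter (p := fun x y => decide (y.1 = v x)) (arg.fst.eq hv.wk)).values
  have h2 := ite (h.eq nil) (nil (β := Data)) ((h.headD (d := Data.nil) rfl).cons nil)
  refine h2.recode (fun _ => rfl) fun x => ?_
  rw [val_eq_head?]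
  cases ((A x).filter fun y => decide (y.1 = v x)).map Prod.snd <;> rfl

theorem propVar {s d : ι → Data} (hs : FC κ e s) (hd : FC κ e d) :
    FC κ e (fun x => propVar (s x) (d x)) := hs.dataCons hd

theorem cspCNF {L : ι → List (Data × List Data)} {F : ι → List (List (Data × Data))}
    (hL : FC κ e L) (hF : FC κ e F) : FC κ e (fun x => cspCNF (L x) (F x)) := by
  have h1 : FC κ e (fun x => slotClauses (L x)) :=
    hL.flatMap (arg.snd.flatMap
      (((((const true).pair (arg.wk.fst.propVar arg)).cons
        (((const false).pair (arg.wk.fst.propVar arg)).cons nil))).cons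
      (arg.wk.snd.flatMap (ite (arg.wk.eq arg) nil
        ((((const false).pair (arg.wk.wk.fst.propVar arg.wk)).cons
          (((const false).pair (arg.wk.wk.fst.propVar arg)).cons nil)).cons nil)))))
  have h2 : FC κ e (fun x => (F x).map forbid) :=
    hF.map (arg.map ((const false).pair (arg.fst.propVar arg.snd)))
  exact h1.append h2

theorem stepState {s : ι → PState} {a : ι → Action} (hs : FC κ e s) (ha : FC κ e a) :
    FC κ e (fun x => stepState (s x) (a x)) :=
  ite (ha.pre.keys.forall_mem ((hs.wk.val arg).eq (ha.pre.wk.val arg)))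
    (ha.post.append hs) hs

/-- Each step at most prepends a postcondition, so the growth is additive and simulating the case is
cheap. -/
theorem sz_foldl_stepState_le (s : PState) (c : List Action) :
    sz (c.foldl CaseReuse.stepState s) ≤ sz s + sz c := by
  induction c generalizing s with
  | nil => simp
  | cons a c ih =>
    refine (ih _).trans ?_
    have h1 : sz (CaseReuse.stepState s a) ≤ sz s + sz a := by
      have h2 : sz a = sz a.pre + sz a.post + 1 := rfl
      have h3 := sz_append a.post s
      unfold CaseReuse.stepState
      split_ifs <;> omega
    rw [sz_cons]; omega

theorem caseMod_proj {x : ι → CaseModData} (hx : FC κ e x) :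
    (FC κ e (fun i => (x i).target.init) ∧ FC κ e (fun i => (x i).target.goal)) ∧
      FC κ e (fun i => (x i).caseInit) ∧ FC κ e (fun i => (x i).casePlan) ∧
      FC κ e (fun i => (x i).glueActions) ∧ FC κ e (fun i => (x i).maxGlue) := by
  have h : FC κ e (fun i => (((x i).target.doms, (x i).target.init, (x i).target.goal,
      (x i).target.actions), (x i).caseInit, (x i).caseGoal, (x i).casePlan, (x i).glueActions,
      (x i).maxGlue)) := hx.recode (fun _ => rfl) (fun _ => rfl)
  exact ⟨⟨h.fst.snd.fst, h.fst.snd.snd.fst⟩, h.snd.fst, h.snd.snd.snd.fst, h.snd.snd.snd.snd.fst,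
    h.snd.snd.snd.snd.snd⟩

theorem caseResult {x : ι → CaseModData} (hx : FC κ e x) :
    FC κ e (fun i => (x i).caseResult) := by
  obtain ⟨-, hJ, hc, -, -⟩ := caseMod_proj hx
  refine FC.foldl (B := fun i => sz (x i).caseInit + sz (x i).casePlan)
    (hJ.size_bound.add hc.size_bound) (fun i pre hpre => ?_) hc hJ (arg.fst.stepState arg.snd)
  refine (sz_foldl_stepState_le _ _).trans (Nat.add_le_add_left ?_ _)
  obtain ⟨suf, h⟩ := hpre
  have := sz_append pre suf
  rw [h] at this
  have := one_le_sz suf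
  omega

theorem eventSlot {j : ι → ℕ} (hj : FC κ e j) : FC κ e (fun i => eventSlot (j i)) :=
  (const _).dataCons hj.encode

theorem stateSlot {j : ι → ℕ} {v : ι → Data} (hj : FC κ e j) (hv : FC κ e v) :
    FC κ e (fun i => stateSlot (j i) (v i)) :=
  ((const _).dataCons hv).dataCons hj.encode

theorem allowed {a : ι → Action} {v d d' : ι → Data} (ha : FC κ e a) (hv : FC κ e v)
    (hd : FC κ e d) (hd' : FC κ e d') :
    FC κ e (fun i => decide (Allowed (a i) (v i) (d i) (d' i))) :=
  and (or ((ha.pre.val hv).eq none) ((ha.pre.val hv).eq hd.some))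
    (((ha.post.append ((hv.pair hd).cons nil)).val hv).eq hd'.some)

theorem slots_forbidden {x : ι → CaseModData} (hx : FC κ e x) :
    FC κ e (fun i => (x i).slots) ∧ FC κ e (fun i => (x i).forbidden) := by
  obtain ⟨⟨hI, hG⟩, hJ, hc, hA, hM⟩ := caseMod_proj hx
  have hR := hx.caseResult
  have hglue : FC κ e (fun i => (x i).glueList) :=
    (hA.flatMap (f := fun _ a => Action.vars a) arg.action_vars).dedup
  have hph : FC κ e (fun i => (x i).phase) := hglue.encode
  have hcase : FC κ e (fun i => (x i).caseAction) :=
    ((hph.pair (const Data.nil)).cons hJ).action ((hph.pair (const one)).cons hR)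
  have hsteps : FC κ e (fun i => (x i).steps) := (const _).cons (hcase.cons hA)
  have hstart : FC κ e (fun i => (x i).startState) := (hph.pair (const Data.nil)).cons hI
  have hfinal : FC κ e (fun i => (x i).finalState) := (hph.pair (const one)).cons hG
  have hvars : FC κ e (fun i => (x i).stepVars) := hph.cons hglue
  have hvalues : FC κ e (fun i => (x i).stepValues) :=
    hstart.values.append (hsteps.flatMap arg.post.values)
  have hT := hM.succ
  constructor
  · exact (hT.range.map (arg.eventSlot.pair (hsteps.wk.map arg.encode))).append
      (hT.succ.range.flatMap (hvars.wk.map ((arg.wk.stateSlot arg).pair hvalues.wk.wk)))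
  · have h1 : FC κ e (fun i => (x i).forbiddenSteps) :=
      hT.range.flatMap (hvars.wk.flatMap (hsteps.wk.wk.flatMap (hvalues.wk.wk.wk.flatMap
        (hvalues.wk.wk.wk.wk.flatMap (ite (arg.wk.wk.allowed arg.wk.wk.wk arg.wk arg) nil
          (((arg.wk.wk.wk.wk.eventSlot.pair arg.wk.wk.encode).cons
            (((arg.wk.wk.wk.wk.stateSlot arg.wk.wk.wk).pair arg.wk).cons
              (((arg.wk.wk.wk.wk.succ.stateSlot arg.wk.wk.wk).pair arg).cons nil))).cons nil))))))
    have h2 : FC κ e (fun i => (x i).forbiddenStart) :=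
      hvars.flatMap (hvalues.wk.flatMap (ite ((hstart.wk.wk.val arg.wk).eq arg.some) nil
        (((((const 0).stateSlot arg.wk).pair arg).cons nil).cons nil)))
    have h3 : FC κ e (fun i => (x i).forbiddenFinal) :=
      hvars.flatMap (hvalues.wk.flatMap (ite (((hfinal.wk.wk.val arg.wk).eq none).or
        ((hfinal.wk.wk.val arg.wk).eq arg.some)) nil
        ((((hT.wk.wk.stateSlot arg.wk).pair arg).cons nil).cons nil)))
    have h4 : FC κ e (fun i => (x i).forbiddenElsewhere) :=
      ((hI.keys.append hJ.keys).flatMap (ite ((arg.mem hglue.wk).or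
        ((hI.wk.val arg).eq (hJ.wk.val arg))) nil (const [[]]))).append
      (hG.keys.flatMap (ite ((arg.mem hglue.wk).or
        ((hR.wk.val arg).eq (hG.wk.val arg))) nil (const [[]])))
    exact h1.append (h2.append (h3.append h4))

end FC

/-! ### Correctness of the construction -/

theorem val_append (A B : PState) (v : Data) :
    PState.val (A ++ B) v = if v ∈ PState.vars A then PState.val A v else PState.val B v := by
  induction A with
  | nil => simp [PState.vars]
  | cons x A ih =>
    rw [List.cons_append, val_cons, val_cons, ih]
    have h2 : v ∈ PState.vars (x :: A) ↔ v = x.1 ∨ v ∈ PState.vars A := List.mem_cons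
    simp only [h2]
    by_cases h : v = x.1 <;> simp [h]

/-- Lookup returns the first entry for a variable, so a prepended postcondition overrides older
values. -/
theorem run_val (c : List Action) (s : PState) :
    run c (PState.val s) = PState.val (c.foldl stepState s) := by
  induction c generalizing s with
  | nil => rfl
  | cons a c ih =>
    rw [run_cons, List.foldl_cons, ← ih]
    congr 1
    have h : Agrees (PState.val s) a.pre ↔
      ∀ v ∈ PState.vars a.pre, PState.val s v = PState.val a.pre v := Iff.rfl
    unfold Action.apply stepState
    simp only [h]
    split_ifs
    · funext v
      rw [val_append]
    · rfl

theorem allowed_iff {a : Action} {v d d' : Data} : Allowed a v d d' ↔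
    (v ∈ PState.vars a.pre → PState.val a.pre v = some d) ∧
      (if v ∈ PState.vars a.post then PState.val a.post v else some d) = some d' := by
  have h : PState.val [(v, d)] v = some d := by simp [val_cons]
  rw [Allowed, val_append, h, val_eq_none_iff, or_iff_not_imp_left, not_not]

/-! ### Schedules as solutions of the constraints -/

namespace CaseModData

variable (x : CaseModData)

/-- The phase is named by the encoding of the whole list, which is larger than that of any entry. -/
theorem phase_notMem : x.phase ∉ x.glueList := fun h => by
  have := sz_le_of_mem h
  have h2 : sz x.phase = sz x.glueList := rfl
  omega

theorem mem_glueList {v : Data} : v ∈ x.glueList ↔ ∃ a ∈ x.glueActions, v ∈ a.vars := by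
  simp [glueList]

theorem stepVars_nodup : x.stepVars.Nodup :=
  List.nodup_cons.2 ⟨x.phase_notMem, List.nodup_dedup _⟩

/-- A sequence of steps, with all intermediate states. -/
structure Schedule (ev : ℕ → Action) (st : ℕ → Data → Data) (T : ℕ) : Prop where
  mem : ∀ j < T, ev j ∈ x.steps
  allowed : ∀ j < T, ∀ v ∈ x.stepVars, Allowed (ev j) v (st j v) (st (j + 1) v)

/-- The conditions on the variables that do not occur in glue steps. -/
def Elsewhere : Prop :=
  (∀ v ∉ x.glueList, PState.val x.target.init v = PState.val x.caseInit v) ∧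
    ∀ v ∈ PState.vars x.target.goal, v ∉ x.glueList →
      PState.val x.caseResult v = PState.val x.target.goal v

/-- There is a schedule of `maxGlue + 1` steps from the initial state to the goal. -/
def Schedulable : Prop :=
  x.Elsewhere ∧ ∃ (ev : ℕ → Action) (st : ℕ → Data → Data),
    x.Schedule ev st (x.maxGlue + 1) ∧
    (∀ v ∈ x.stepVars, PState.val x.startState v = some (st 0 v)) ∧
    ∀ v ∈ x.stepVars, PState.val x.finalState v = none ∨
      PState.val x.finalState v = some (st (x.maxGlue + 1) v)

variable {x}

theorem Schedule.values_mem {ev : ℕ → Action} {st : ℕ → Data → Data} {T : ℕ}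
    (h : x.Schedule ev st T) (h0 : ∀ v ∈ x.stepVars, PState.val x.startState v = some (st 0 v)) :
    ∀ j ≤ T, ∀ v ∈ x.stepVars, st j v ∈ x.stepValues := by
  intro j
  induction j with
  | zero =>
    intro _ v hv
    exact List.mem_append_left _ (List.mem_map.2 ⟨_, mem_of_val (h0 v hv), rfl⟩)
  | succ j ih =>
    intro hj v hv
    rcases List.mem_append.1 (mem_of_val (h.allowed j hj v hv).2) with h1 | h1
    · exact List.mem_append_right _ (List.mem_flatMap.2
        ⟨ev j, h.mem j hj, List.mem_map.2 ⟨_, h1, rfl⟩⟩)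
    · have : st (j + 1) v = st j v := by simpa using h1
      rw [this]
      exact ih (by omega) v hv

theorem slots_keys : x.slots.map Prod.fst = (List.range (x.maxGlue + 1)).map eventSlot ++
    (List.range (x.maxGlue + 2)).flatMap fun j => x.stepVars.map (stateSlot j) := by
  simp [slots, List.map_flatMap, Function.comp_def]

theorem stateSlot_inj {j j' : ℕ} {v v' : Data} (h : stateSlot j v = stateSlot j' v') :
    j = j' ∧ v = v' := by
  simp only [stateSlot, Data.cons.injEq, true_and] at h
  exact ⟨Enc.enc_injective h.2, h.1⟩

theorem slots_nodup : (x.slots.map Prod.fst).Nodup := by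
  rw [slots_keys]
  refine (List.nodup_range.map ?_).append (List.nodup_flatMap.2 ⟨fun j _ => ?_, ?_⟩) ?_
  · intro i j h
    simp only [eventSlot, Data.cons.injEq, true_and] at h
    exact Enc.enc_injective h
  · exact x.stepVars_nodup.map fun v v' h => (stateSlot_inj h).2
  · refine List.nodup_range.imp fun hne => ?_
    intro s h1 h2
    obtain ⟨v, -, rfl⟩ := List.mem_map.1 h1
    obtain ⟨v', -, h⟩ := List.mem_map.1 h2
    exact hne (stateSlot_inj h).1.symm
  · intro s h1 h2
    obtain ⟨i, -, rfl⟩ := List.mem_map.1 h1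
    obtain ⟨j, -, h2⟩ := List.mem_flatMap.1 h2
    obtain ⟨v, -, h⟩ := List.mem_map.1 h2
    simp [stateSlot, eventSlot] at h

theorem length_slots :
    x.slots.length = (x.maxGlue + 1) + (x.maxGlue + 2) * (x.glueVars.card + 1) := by
  have h : x.glueVars.card = x.glueList.length := List.card_toFinset _
  simp [slots, stepVars, h, List.length_flatMap]

theorem event_slot_mem {j : ℕ} (hj : j < x.maxGlue + 1) :
    (eventSlot j, x.steps.map enc) ∈ x.slots :=
  List.mem_append_left _ (List.mem_map.2 ⟨j, List.mem_range.2 hj, rfl⟩)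

theorem state_slot_mem {j : ℕ} (hj : j < x.maxGlue + 2) {v : Data} (hv : v ∈ x.stepVars) :
    (stateSlot j v, x.stepValues) ∈ x.slots :=
  List.mem_append_right _ (List.mem_flatMap.2
    ⟨j, List.mem_range.2 hj, List.mem_map.2 ⟨v, hv, rfl⟩⟩)

theorem mem_slots {y : Data × List Data} : y ∈ x.slots ↔
    (∃ j < x.maxGlue + 1, y = (eventSlot j, x.steps.map enc)) ∨
      ∃ j < x.maxGlue + 2, ∃ v ∈ x.stepVars, y = (stateSlot j v, x.stepValues) := by
  simp [slots, eq_comm]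

theorem mem_forbiddenSteps {c : List (Data × Data)} : c ∈ x.forbiddenSteps ↔
    ∃ j < x.maxGlue + 1, ∃ v ∈ x.stepVars, ∃ a ∈ x.steps, ∃ d ∈ x.stepValues,
      ∃ d' ∈ x.stepValues, ¬ Allowed a v d d' ∧
        c = [(eventSlot j, enc a), (stateSlot j v, d), (stateSlot (j + 1) v, d')] := by
  simp only [forbiddenSteps, List.mem_flatMap, List.mem_range]
  refine exists_congr fun j => and_congr_right fun _ => exists_congr fun v => and_congr_right
    fun _ => exists_congr fun a => and_congr_right fun _ => exists_congr fun d => and_congr_right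
    fun _ => exists_congr fun d' => and_congr_right fun _ => ?_
  split_ifs with h <;> simp [h]

theorem mem_forbiddenStart {c : List (Data × Data)} : c ∈ x.forbiddenStart ↔
    ∃ v ∈ x.stepVars, ∃ d ∈ x.stepValues, PState.val x.startState v ≠ some d ∧
      c = [(stateSlot 0 v, d)] := by
  simp only [forbiddenStart, List.mem_flatMap]
  refine exists_congr fun v => and_congr_right fun _ => exists_congr fun d => and_congr_right
    fun _ => ?_
  split_ifs with h <;> simp [h]

theorem mem_forbiddenFinal {c : List (Data × Data)} : c ∈ x.forbiddenFinal ↔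
    ∃ v ∈ x.stepVars, ∃ d ∈ x.stepValues, ¬ (PState.val x.finalState v = none ∨
      PState.val x.finalState v = some d) ∧ c = [(stateSlot (x.maxGlue + 1) v, d)] := by
  simp only [forbiddenFinal, List.mem_flatMap]
  refine exists_congr fun v => and_congr_right fun _ => exists_congr fun d => and_congr_right
    fun _ => ?_
  split_ifs with h
  · simp only [List.not_mem_nil, h, not_true, false_and]
  · simp only [List.mem_singleton, h, not_false_iff, true_and]

/-- The empty combination cannot be avoided, and it becomes an empty clause. One occurrence makes
the instance negative, as a failure outside the glue variables should. -/
theorem mem_forbiddenElsewhere {c : List (Data × Data)} : c ∈ x.forbiddenElsewhere ↔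
    ¬ x.Elsewhere ∧ c = [] := by
  have h1 : ∀ (l : List Data) (p : Data → Prop) [DecidablePred p], c ∈ (l.flatMap fun v =>
      if p v then ([] : List (List (Data × Data))) else [[]]) ↔ (¬ ∀ v ∈ l, p v) ∧ c = [] := by
    intro l p _
    rw [List.mem_flatMap]
    constructor
    · rintro ⟨v, hv, h⟩
      split_ifs at h with hp
      · simp at h
      · exact ⟨fun hall => hp (hall v hv), by simpa using h⟩
    · rintro ⟨h, rfl⟩
      push Not at h
      obtain ⟨v, hv, hp⟩ := h
      exact ⟨v, hv, by simp [hp]⟩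
  rw [forbiddenElsewhere, List.mem_append, h1, h1, ← or_and_right, ← not_and_or]
  refine and_congr_left fun _ => not_congr (and_congr ?_ ?_)
  · refine ⟨fun h v hv => ?_, fun h v _ => or_iff_not_imp_left.2 (h v)⟩
    by_cases hm : v ∈ PState.vars x.target.init ++ PState.vars x.caseInit
    · exact (h v hm).resolve_left hv
    · rw [List.mem_append, not_or] at hm
      rw [val_eq_none_iff.2 hm.1, val_eq_none_iff.2 hm.2]
  · exact forall₂_congr fun v _ => or_iff_not_imp_left

theorem forbidden_slots : ∀ c ∈ x.forbidden, c.length ≤ 3 ∧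
    ∀ z ∈ c, ∃ y ∈ x.slots, y.1 = z.1 ∧ z.2 ∈ y.2 := by
  intro c hc
  simp only [forbidden, List.mem_append] at hc
  rcases hc with h | h | h | h
  · obtain ⟨j, hj, v, hv, a, ha, d, hd, d', hd', -, rfl⟩ := mem_forbiddenSteps.1 h
    refine ⟨le_rfl, fun z hz => ?_⟩
    simp only [List.mem_cons, List.not_mem_nil, or_false] at hz
    rcases hz with rfl | rfl | rfl
    · exact ⟨_, event_slot_mem hj, rfl, List.mem_map.2 ⟨a, ha, rfl⟩⟩
    · exact ⟨_, state_slot_mem (by omega) hv, rfl, hd⟩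
    · exact ⟨_, state_slot_mem (by omega) hv, rfl, hd'⟩
  · obtain ⟨v, hv, d, hd, -, rfl⟩ := mem_forbiddenStart.1 h
    refine ⟨by simp, fun z hz => ?_⟩
    obtain rfl := List.mem_singleton.1 hz
    exact ⟨_, state_slot_mem (by omega) hv, rfl, hd⟩
  · obtain ⟨v, hv, d, hd, -, rfl⟩ := mem_forbiddenFinal.1 h
    refine ⟨by simp, fun z hz => ?_⟩
    obtain rfl := List.mem_singleton.1 hz
    exact ⟨_, state_slot_mem (by omega) hv, rfl, hd⟩
  · obtain ⟨-, rfl⟩ := mem_forbiddenElsewhere.1 h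
    simp

/-- Applicability and effect of a step are conditions on one variable at a time, so each constraint
concerns one event and one variable before and after it. -/
theorem schedulable_iff : x.Schedulable ↔
    ∃ f : Data → Data, (∀ y ∈ x.slots, f y.1 ∈ y.2) ∧ ∀ c ∈ x.forbidden, ∃ z ∈ c, f z.1 ≠ z.2 := by
  constructor
  · rintro ⟨hE, ev, st, hS, h0, hT⟩
    have hval := hS.values_mem h0
    -- Slot names are decoded: a first component `nil` marks an event, and otherwise it contains the
    -- variable.
    let dec : Data → ℕ := Function.invFun encNat
    have hdec : ∀ n : ℕ, dec (enc n) = n := Function.leftInverse_invFun encNat_injective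
    let f : Data → Data := fun d =>
      match d with
      | .cons .nil n => enc (ev (dec n))
      | .cons (.cons _ v) n => st (dec n) v
      | .nil => .nil
    have f1 : ∀ j, f (eventSlot j) = enc (ev j) := fun j => congrArg (fun n => enc (ev n)) (hdec j)
    have f2 : ∀ j v, f (stateSlot j v) = st j v := fun j v => congrArg (fun n => st n v) (hdec j)
    refine ⟨f, fun y hy => ?_, fun c hc => ?_⟩
    · rcases mem_slots.1 hy with ⟨j, hj, rfl⟩ | ⟨j, hj, v, hv, rfl⟩
      · rw [f1]; exact List.mem_map.2 ⟨_, hS.mem j hj, rfl⟩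
      · rw [f2]; exact hval j (by omega) v hv
    · simp only [forbidden, List.mem_append] at hc
      rcases hc with h | h | h | h
      · obtain ⟨j, hj, v, hv, a, ha, d, hd, d', hd', hna, rfl⟩ := mem_forbiddenSteps.1 h
        by_contra hcon
        push Not at hcon
        have e1 := hcon _ (List.mem_cons_self)
        have e2 := hcon (stateSlot j v, d) (by simp)
        have e3 := hcon (stateSlot (j + 1) v, d') (by simp)
        rw [f1] at e1
        rw [f2] at e2 e3
        have e1 := Enc.enc_injective e1
        dsimp only at e2 e3
        subst e1 e2 e3
        exact hna (hS.allowed j hj v hv)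
      · obtain ⟨v, hv, d, hd, hne, rfl⟩ := mem_forbiddenStart.1 h
        refine ⟨_, List.mem_cons_self, fun heq => hne ?_⟩
        rw [f2] at heq
        rw [h0 v hv, heq]
      · obtain ⟨v, hv, d, hd, hne, rfl⟩ := mem_forbiddenFinal.1 h
        refine ⟨_, List.mem_cons_self, fun heq => hne ?_⟩
        rw [f2] at heq
        dsimp only at heq
        rw [← heq]
        exact hT v hv
      · exact absurd hE (mem_forbiddenElsewhere.1 h).1
  · rintro ⟨f, hf, hF⟩
    have hE : x.Elsewhere := by
      by_contra hE
      obtain ⟨z, hz, -⟩ := hF [] (by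
        simp only [forbidden, List.mem_append]
        exact .inr (.inr (.inr (mem_forbiddenElsewhere.2 ⟨hE, rfl⟩))))
      simp at hz
    have hev : ∀ j, ∃ a, j < x.maxGlue + 1 → a ∈ x.steps ∧ enc a = f (eventSlot j) := by
      intro j
      by_cases hj : j < x.maxGlue + 1
      · obtain ⟨a, ha, h⟩ := List.mem_map.1 (hf _ (event_slot_mem hj))
        exact ⟨a, fun _ => ⟨ha, h⟩⟩
      · exact ⟨⟨[], []⟩, fun h => absurd h hj⟩
    choose ev hev using hev
    have hst : ∀ j < x.maxGlue + 2, ∀ v ∈ x.stepVars, f (stateSlot j v) ∈ x.stepValues :=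
      fun j hj v hv => hf _ (state_slot_mem hj hv)
    refine ⟨hE, ev, fun j v => f (stateSlot j v), ⟨fun j hj => (hev j hj).1, fun j hj v hv => ?_⟩,
      fun v hv => ?_, fun v hv => ?_⟩
    · by_contra hna
      obtain ⟨z, hz, hne⟩ := hF _ (by
        simp only [forbidden, List.mem_append]
        exact .inl (mem_forbiddenSteps.2 ⟨j, hj, v, hv, ev j, (hev j hj).1, _,
          hst j (by omega) v hv, _, hst (j + 1) (by omega) v hv, hna, rfl⟩))
      simp only [List.mem_cons, List.not_mem_nil, or_false] at hz
      rcases hz with rfl | rfl | rfl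
      · exact hne (hev j hj).2.symm
      · exact hne rfl
      · exact hne rfl
    · by_contra hna
      obtain ⟨z, hz, hne⟩ := hF _ (by
        simp only [forbidden, List.mem_append]
        exact .inr (.inl (mem_forbiddenStart.2 ⟨v, hv, _, hst 0 (by omega) v hv, hna, rfl⟩)))
      obtain rfl := List.mem_singleton.1 hz
      exact hne rfl
    · by_contra hna
      obtain ⟨z, hz, hne⟩ := hF _ (by
        simp only [forbidden, List.mem_append]
        exact .inr (.inr (.inl (mem_forbiddenFinal.2
          ⟨v, hv, _, hst (x.maxGlue + 1) (by omega) v hv, hna, rfl⟩))))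
      obtain rfl := List.mem_singleton.1 hz
      exact hne rfl

/-! ### Schedules and plans -/

theorem vars_subset_glueList {a : Action} (ha : a ∈ x.glueActions) :
    (∀ v ∈ PState.vars a.pre, v ∈ x.glueList) ∧ ∀ v ∈ PState.vars a.post, v ∈ x.glueList :=
  ⟨fun _ hv => x.mem_glueList.2 ⟨a, ha, List.mem_append_left _ hv⟩,
    fun _ hv => x.mem_glueList.2 ⟨a, ha, List.mem_append_right _ hv⟩⟩

theorem Valid.isSome (hx : x.Valid) {v : Data} (hv : v ∈ x.glueList) :
    (PState.val x.target.init v).isSome ∧ (PState.val x.caseInit v).isSome := by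
  obtain ⟨h1, h2, -, h4⟩ := hx
  obtain ⟨a, ha, hva⟩ := x.mem_glueList.1 hv
  obtain ⟨hpre, hpost⟩ := h1.2.2.2 a (h4 a ha)
  have hV : v ∈ x.target.vars := by
    rcases List.mem_append.1 hva with h | h
    · obtain ⟨y, hy, rfl⟩ := List.mem_map.1 h
      obtain ⟨z, hz, hzy, -⟩ := hpre.2 y hy
      exact List.mem_map.2 ⟨z, hz, hzy⟩
    · obtain ⟨y, hy, rfl⟩ := List.mem_map.1 h
      obtain ⟨z, hz, hzy, -⟩ := hpost.2 y hy
      exact List.mem_map.2 ⟨z, hz, hzy⟩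
  exact ⟨val_isSome_iff.2 (h1.2.1.2 v hV), val_isSome_iff.2 (h2.2.1.2 v hV)⟩

theorem apply_isSome (a : Action) {s : Data → Option Data} {v : Data} (h : (s v).isSome) :
    (a.apply s v).isSome := by
  unfold Action.apply
  split_ifs with h1
  · dsimp only
    split_ifs with h2
    · exact val_isSome_iff.2 h2
    · exact h
  · exact h

theorem run_isSome (p : List Action) {s : Data → Option Data} {v : Data} (h : (s v).isSome) :
    (run p s v).isSome := by
  induction p generalizing s with
  | nil => exact h
  | cons a p ih => exact ih (apply_isSome a h)

theorem run_elsewhere {p : List Action} (hp : ∀ a ∈ p, a ∈ x.glueActions) {v : Data}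
    (hv : v ∉ x.glueList) (s : Data → Option Data) : run p s v = s v := by
  induction p generalizing s with
  | nil => rfl
  | cons a p ih =>
    rw [run_cons, ih fun b hb => hp b (by simp [hb])]
    have : v ∉ PState.vars a.post := fun h => hv ((vars_subset_glueList (hp a (by simp))).2 v h)
    unfold Action.apply
    split_ifs <;> simp [this]

theorem caseResult_isSome (hx : x.Valid) {v : Data} (hv : v ∈ x.glueList) :
    (PState.val x.caseResult v).isSome := by
  rw [caseResult, ← run_val]
  exact run_isSome _ (hx.isSome hv).2

/-- In a schedule, glue steps act like they do in a plan. -/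
theorem apply_of_allowed {a : Action} (ha : a ∈ x.glueActions) {f f' : Data → Data}
    (h : ∀ v ∈ x.stepVars, Allowed a v (f v) (f' v)) {s : Data → Option Data}
    (hs : ∀ v ∈ x.glueList, s v = some (f v)) (v : Data) :
    a.apply s v = if v ∈ x.glueList then some (f' v) else s v := by
  obtain ⟨hpre, hpost⟩ := vars_subset_glueList ha
  have hmem : ∀ v ∈ x.glueList, v ∈ x.stepVars := fun v hv => List.mem_cons_of_mem _ hv
  have hag : Agrees s a.pre := fun v hv => by
    rw [hs v (hpre v hv), (allowed_iff.1 (h v (hmem v (hpre v hv)))).1 hv]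
  unfold Action.apply
  rw [if_pos hag]
  by_cases hv : v ∈ x.glueList
  · rw [if_pos hv, ← (allowed_iff.1 (h v (hmem v hv))).2, hs v hv]
  · rw [if_neg hv, if_neg (fun h => hv (hpost v h))]

/-- No-ops are dropped and the other steps form the plan, so it may be shorter than the segment. -/
theorem Schedule.run_glue {ev : ℕ → Action} {st : ℕ → Data → Data} {T : ℕ}
    (h : x.Schedule ev st T) {j m : ℕ} (hT : j + m ≤ T)
    (hev : ∀ i, j ≤ i → i < j + m → ev i ≠ x.caseAction) {s : Data → Option Data}
    (hs : ∀ v ∈ x.glueList, s v = some (st j v)) :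
    ∃ g : List Action, g.length ≤ m ∧ (∀ a ∈ g, a ∈ x.glueActions) ∧
      ∀ v, run g s v = if v ∈ x.glueList then some (st (j + m) v) else s v := by
  induction m with
  | zero =>
    refine ⟨[], le_rfl, by simp, fun v => ?_⟩
    by_cases hv : v ∈ x.glueList
    · rw [if_pos hv]; exact hs v hv
    · rw [if_neg hv]; rfl
  | succ m ih =>
    obtain ⟨g, hg1, hg2, hg3⟩ := ih (by omega) (fun i h1 h2 => hev i h1 (by omega))
    have hal := h.allowed (j + m) (by omega)
    rcases List.mem_cons.1 (h.mem (j + m) (by omega)) with hnop | hc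
    · refine ⟨g, by omega, hg2, fun v => ?_⟩
      rw [hg3]
      by_cases hv : v ∈ x.glueList
      · rw [if_pos hv, if_pos hv]
        have := (allowed_iff.1 (hal v (List.mem_cons_of_mem _ hv))).2
        rw [hnop] at this
        simpa [PState.vars, ← add_assoc] using this
      · rw [if_neg hv, if_neg hv]
    rcases List.mem_cons.1 hc with hc | hglue
    · exact absurd hc (hev (j + m) (by omega) (by omega))
    · refine ⟨g ++ [ev (j + m)], by simpa using hg1, fun a ha => ?_, fun v => ?_⟩
      · rcases List.mem_append.1 ha with ha | ha
        · exact hg2 a ha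
        · rw [List.mem_singleton.1 ha]; exact hglue
      · rw [run_append]
        change (ev (j + m)).apply _ v = _
        rw [apply_of_allowed hglue hal (fun v hv => by rw [hg3, if_pos hv]), hg3]
        by_cases hv : v ∈ x.glueList
        · rw [if_pos hv, if_pos hv]; rfl
        · rw [if_neg hv, if_neg hv, if_neg hv]

theorem phase_of_ne_caseAction {a : Action} (ha : a ∈ x.steps) (hne : a ≠ x.caseAction)
    {d d' : Data} (h : Allowed a x.phase d d') : d' = d := by
  have h2 := (allowed_iff.1 h).2
  rcases List.mem_cons.1 ha with rfl | ha
  · simpa [PState.vars, eq_comm] using h2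
  rcases List.mem_cons.1 ha with ha | ha
  · exact absurd ha hne
  · rw [if_neg fun hp => x.phase_notMem ((vars_subset_glueList ha).2 _ hp)] at h2
    exact (Option.some.inj h2).symm

theorem allowed_caseAction_phase {d d' : Data} (h : Allowed x.caseAction x.phase d d') :
    d = .nil ∧ d' = one := by
  obtain ⟨h1, h2⟩ := allowed_iff.1 h
  have e1 := h1 (by simp [caseAction, PState.vars])
  rw [if_pos (by simp [caseAction, PState.vars])] at h2
  simp only [caseAction, val_cons, if_true, Option.some.injEq] at e1 h2
  exact ⟨e1.symm, h2.symm⟩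

theorem val_cons_phase {v : Data} (hv : v ∈ x.glueList) (d : Data) (A : PState) :
    PState.val ((x.phase, d) :: A) v = PState.val A v := by
  rw [val_cons, if_neg]
  rintro rfl
  exact x.phase_notMem hv

/-- Only the case action changes the phase, and it needs phase `nil` and leaves `one`. It therefore
occurs exactly once and separates the glue steps into those before and after the case. -/
theorem Schedulable.yes (hx : x.Valid) (h : x.Schedulable) : x.Yes := by
  classical
  obtain ⟨⟨hE1, hE2⟩, ev, st, hS, h0, hT⟩ := h
  have hph : x.phase ∈ x.stepVars := List.mem_cons_self
  have hglue : ∀ v ∈ x.glueList, v ∈ x.stepVars := fun v hv => List.mem_cons_of_mem _ hv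
  have p0 : st 0 x.phase = .nil := by
    have := h0 _ hph
    simp only [startState, val_cons, if_true, Option.some.injEq] at this
    exact this.symm
  have pT : st (x.maxGlue + 1) x.phase = one := by
    have := hT _ hph
    simp only [finalState, val_cons, if_true, Option.some.injEq, reduceCtorEq, false_or] at this
    exact this.symm
  have hex : ∃ j, j < x.maxGlue + 1 ∧ ev j = x.caseAction := by
    by_contra hcon
    push Not at hcon
    have : ∀ j ≤ x.maxGlue + 1, st j x.phase = .nil := by
      intro j
      induction j with
      | zero => exact fun _ => p0
      | succ j ih =>
        intro hj
        rw [phase_of_ne_caseAction (hS.mem j hj) (hcon j hj) (hS.allowed j hj _ hph)]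
        exact ih (by omega)
    have := this _ le_rfl
    rw [pT] at this
    exact absurd this (by simp [one])
  obtain ⟨hj, hcase⟩ := Nat.find_spec hex
  have hbefore : ∀ i < Nat.find hex, ev i ≠ x.caseAction := fun i hi heq =>
    Nat.find_min hex hi ⟨by omega, heq⟩
  set j := Nat.find hex
  have hal := hS.allowed j hj
  rw [hcase] at hal
  have hafter' : ∀ m, j + 1 + m ≤ x.maxGlue + 1 → st (j + 1 + m) x.phase = one := by
    intro m
    induction m with
    | zero => exact fun _ => (allowed_caseAction_phase (hal _ hph)).2
    | succ m ih =>
      intro hm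
      have h1 := ih (by omega)
      have h2 := hS.allowed (j + 1 + m) (by omega) _ hph
      by_cases hc : ev (j + 1 + m) = x.caseAction
      · rw [hc] at h2
        exact (allowed_caseAction_phase h2).2
      · rw [← h1]
        exact phase_of_ne_caseAction (hS.mem _ (by omega)) hc h2
  -- The `M + 1` steps minus the case leave `j` glue steps before it and `M - j` after it.
  have hafter : ∀ i, j + 1 ≤ i → i < j + 1 + (x.maxGlue - j) → ev i ≠ x.caseAction := by
    intro i h1 h2 hc
    have h3 := hS.allowed i (by omega) _ hph
    rw [hc] at h3
    have h4 := hafter' (i - (j + 1)) (by omega)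
    rw [show j + 1 + (i - (j + 1)) = i by omega, (allowed_caseAction_phase h3).1] at h4
    exact absurd h4 (by simp [one])
  obtain ⟨g1, l1, m1, r1⟩ := hS.run_glue (j := 0) (m := j) (by omega)
    (fun i _ hi => hbefore i (by omega)) (s := PState.val x.target.init) (fun v hv => by
      rw [← h0 v (hglue v hv), startState, val_cons_phase hv])
  have hJ : run g1 (PState.val x.target.init) = PState.val x.caseInit := by
    funext v
    rw [r1]
    split_ifs with hv
    -- On glue variables the precondition of the case action enforces the initial state of the case;
    -- on all others `Elsewhere` does.
    · have h1 := (allowed_iff.1 (hal v (hglue v hv))).1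
      have h2 : v ∈ PState.vars x.caseAction.pre :=
        List.mem_cons_of_mem _ (val_isSome_iff.1 (hx.isSome hv).2)
      rw [zero_add, ← h1 h2]
      exact val_cons_phase hv _ _
    · exact hE1 v hv
  have hc : run x.casePlan (PState.val x.caseInit) = PState.val x.caseResult := run_val _ _
  obtain ⟨g2, l2, m2, r2⟩ := hS.run_glue (j := j + 1) (m := x.maxGlue - j) (by omega)
    hafter (s := PState.val x.caseResult) (fun v hv => by
      have h1 := (allowed_iff.1 (hal v (hglue v hv))).2
      have h2 : v ∈ PState.vars x.caseAction.post :=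
        List.mem_cons_of_mem _ (val_isSome_iff.1 (caseResult_isSome hx hv))
      rw [if_pos h2] at h1
      rw [← h1]
      exact (val_cons_phase hv _ _).symm)
  have hT' : j + 1 + (x.maxGlue - j) = x.maxGlue + 1 := by omega
  refine ⟨g1 ++ g2, by rw [List.length_append]; omega, fun a ha => ?_, g1.length, by simp,
    ⟨fun a ha => ?_, ?_⟩, by simpa using hJ⟩
  · rcases List.mem_append.1 ha with ha | ha
    · exact m1 a ha
    · exact m2 a ha
  · simp only [List.take_left, List.drop_left, List.mem_append] at ha
    rcases ha with (ha | ha) | ha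
    · exact hx.2.2.2 a (m1 a ha)
    · exact hx.2.2.1.1 a ha
    · exact hx.2.2.2 a (m2 a ha)
  · simp only [List.take_left, List.drop_left]
    rw [run_append, run_append, hJ, hc]
    intro v hv
    rw [r2, hT']
    split_ifs with hg
    · have := hT v (hglue v hg)
      rw [finalState, val_cons_phase hg, val_eq_none_iff] at this
      exact (this.resolve_left (not_not.2 hv)).symm
    · exact hE2 v hv hg

/-! ### From plans to schedules -/

/-- Sequences of steps of a given length between two states. -/
inductive Path (x : CaseModData) : ℕ → (Data → Data) → (Data → Data) → Prop where
  | refl (f : Data → Data) : Path x 0 f f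
  | snoc {m : ℕ} {f g h : Data → Data} (a : Action) : Path x m f g → a ∈ x.steps →
      (∀ v ∈ x.stepVars, Allowed a v (g v) (h v)) → Path x (m + 1) f h

theorem Path.trans {m n : ℕ} {f g h : Data → Data} (h1 : x.Path m f g) (h2 : x.Path n g h) :
    x.Path (m + n) f h := by
  induction h2 with
  | refl => exact h1
  | snoc a _ ha hal ih => exact (ih h1).snoc a ha hal

theorem allowed_nop (v d : Data) : Allowed ⟨[], []⟩ v d d :=
  allowed_iff.2 ⟨by simp [PState.vars], by simp [PState.vars]⟩

theorem Path.pad {m n : ℕ} {f g : Data → Data} (h : x.Path m f g) (hn : m ≤ n) :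
    x.Path n f g := by
  induction n, hn using Nat.le_induction with
  | base => exact h
  | succ n _ ih => exact ih.snoc ⟨[], []⟩ List.mem_cons_self fun v _ => allowed_nop _ _

theorem Path.schedule {m : ℕ} {f g : Data → Data} (h : x.Path m f g) :
    ∃ ev st, x.Schedule ev st m ∧ st 0 = f ∧ st m = g := by
  induction h with
  | refl f => exact ⟨fun _ => ⟨[], []⟩, fun _ => f, ⟨by simp, by simp⟩, rfl, rfl⟩
  | @snoc m f g h a _ ha hal ih =>
    obtain ⟨ev, st, hS, h0, hm⟩ := ih
    refine ⟨Function.update ev m a, Function.update st (m + 1) h, ⟨fun j hj => ?_, fun j hj => ?_⟩,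
      by rw [Function.update_of_ne (by omega), h0], by simp⟩
    · by_cases hjm : j = m
      · subst hjm; simpa using ha
      · rw [Function.update_of_ne hjm]; exact hS.mem j (by omega)
    · rw [Function.update_of_ne (show j ≠ m + 1 by omega)]
      by_cases hjm : j = m
      · subst hjm
        simpa [hm] using hal
      · rw [Function.update_of_ne hjm, Function.update_of_ne (show j + 1 ≠ m + 1 by omega)]
        exact hS.allowed j (by omega)

/-- A state, together with the value of the phase. -/
def withPhase (x : CaseModData) (d : Data) (s : Data → Option Data) : Data → Data :=
  fun v => if v = x.phase then d else (s v).getD .nil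

theorem withPhase_glue {v : Data} (hv : v ∈ x.glueList) (d : Data) {s : Data → Option Data}
    (hs : (s v).isSome) : some (x.withPhase d s v) = s v := by
  rw [withPhase, if_neg (fun h : v = x.phase => x.phase_notMem (h ▸ hv))]
  cases h : s v with
  | none => simp [h] at hs
  | some e => rfl

/-- Steps of a schedule must be applicable, so an inapplicable action of the plan is replaced by a
no-op. -/
theorem path_glue {a : Action} (ha : a ∈ x.glueActions) (d : Data) {s : Data → Option Data}
    (hs : ∀ v ∈ x.glueList, (s v).isSome) :
    x.Path 1 (x.withPhase d s) (x.withPhase d (a.apply s)) := by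
  by_cases hag : Agrees s a.pre
  · refine (Path.refl _).snoc a (List.mem_cons_of_mem _ (List.mem_cons_of_mem _ ha))
      fun v hv => allowed_iff.2 ?_
    obtain ⟨hpre, hpost⟩ := vars_subset_glueList ha
    rcases List.mem_cons.1 hv with rfl | hv
    · refine ⟨fun h => absurd (hpre _ h) x.phase_notMem, ?_⟩
      rw [if_neg fun h => x.phase_notMem (hpost _ h)]
      simp [withPhase]
    · refine ⟨fun h => ?_, ?_⟩
      · rw [withPhase_glue hv d (hs v hv), hag v h]
      · rw [withPhase_glue hv d (hs v hv), withPhase_glue hv d (apply_isSome a (hs v hv))]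
        simp only [Action.apply, if_pos hag]
  · have : a.apply s = s := by rw [Action.apply, if_neg hag]
    rw [this]
    exact (Path.refl _).pad (Nat.zero_le 1)

theorem path_run {p : List Action} (hp : ∀ a ∈ p, a ∈ x.glueActions) (d : Data)
    {s : Data → Option Data} (hs : ∀ v ∈ x.glueList, (s v).isSome) :
    x.Path p.length (x.withPhase d s) (x.withPhase d (run p s)) := by
  induction p generalizing s with
  | nil => exact .refl _
  | cons a p ih =>
    have h1 := path_glue (hp a (by simp)) d hs
    have h2 := ih (fun b hb => hp b (by simp [hb])) (s := a.apply s)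
      (fun v hv => apply_isSome a (hs v hv))
    have := h1.trans h2
    rwa [add_comm] at this

theorem path_case (hx : x.Valid) : x.Path 1 (x.withPhase .nil (PState.val x.caseInit))
    (x.withPhase one (PState.val x.caseResult)) := by
  refine (Path.refl _).snoc x.caseAction (List.mem_cons_of_mem _ List.mem_cons_self)
    fun v hv => allowed_iff.2 ?_
  rcases List.mem_cons.1 hv with rfl | hv
  · refine ⟨fun _ => by simp [caseAction, withPhase, val_cons], ?_⟩
    rw [if_pos (by simp [caseAction, PState.vars])]
    simp [caseAction, withPhase, val_cons]
  · refine ⟨fun _ => ?_, ?_⟩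
    · rw [withPhase_glue hv _ (hx.isSome hv).2]
      exact val_cons_phase hv _ _
    · have h2 : v ∈ PState.vars x.caseAction.post :=
        List.mem_cons_of_mem _ (val_isSome_iff.1 (caseResult_isSome hx hv))
      rw [if_pos h2, withPhase_glue hv _ (caseResult_isSome hx hv)]
      exact val_cons_phase hv _ _

theorem Yes.schedulable (hx : x.Valid) (h : x.Yes) : x.Schedulable := by
  obtain ⟨g, hgM, hg, i, hi, ⟨-, hgoal⟩, hJ⟩ := h
  have hg1 : ∀ a ∈ g.take i, a ∈ x.glueActions := fun a ha => hg a (List.mem_of_mem_take ha)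
  have hg2 : ∀ a ∈ g.drop i, a ∈ x.glueActions := fun a ha => hg a (List.mem_of_mem_drop ha)
  have hc : run x.casePlan (PState.val x.caseInit) = PState.val x.caseResult := run_val _ _
  rw [run_append, run_append, hJ, hc] at hgoal
  have hE : x.Elsewhere := by
    refine ⟨fun v hv => ?_, fun v hv hvg => ?_⟩
    · rw [← hJ, run_elsewhere hg1 hv]
    · rw [← hgoal v hv, run_elsewhere hg2 hvg]
  have hpath := ((path_run hg1 .nil fun v hv => (hx.isSome hv).1).trans
    (hJ ▸ path_case hx)).trans (path_run hg2 one fun v hv => caseResult_isSome hx hv)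
  -- The glue steps and the single case step number at most `M + 1`; no-ops fill up the rest.
  obtain ⟨ev, st, hS, h0, hT⟩ := (hpath.pad (n := x.maxGlue + 1) (by
    rw [List.length_take, List.length_drop]; omega)).schedule
  refine ⟨hE, ev, st, hS, fun v hv => ?_, fun v hv => ?_⟩
  · rw [h0]
    rcases List.mem_cons.1 hv with rfl | hv
    · simp [startState, withPhase, val_cons]
    · rw [withPhase_glue hv _ (hx.isSome hv).1]
      exact val_cons_phase hv _ _
  · rw [hT]
    rcases List.mem_cons.1 hv with rfl | hv
    · exact .inr (by simp [finalState, withPhase, val_cons])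
    · rw [withPhase_glue hv _ (run_isSome _ (caseResult_isSome hx hv)), finalState,
        val_cons_phase hv, val_eq_none_iff, or_iff_not_imp_left, not_not]
      exact fun h => (hgoal v h).symm

end CaseModData

/-! ### Membership -/

/-- The constant 3 is the largest number of slots in a constraint: an event and a variable before
and after it. -/
theorem lvCaseMod_mem : InW1 LVCaseMod := by
  refine ⟨3, ?_⟩
  have hx : FC LVCaseMod.param LVCaseMod.input (fun x => x.1) :=
    (FC.fst_snd_self (F := fun x : LVCaseMod.Inst => x.1) (G := LVCaseMod.param)).1.recode
      (fun _ => rfl) fun _ => rfl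
  obtain ⟨hs, hf⟩ := hx.slots_forbidden
  refine (FPTReducible.refl LVCaseMod).trans_FC (R := WSatCNF 3)
    (fun x => (⟨cspCNF x.1.slots x.1.forbidden, cspCNF_bounded (by omega)
      fun c hc => (CaseModData.forbidden_slots c hc).1⟩, x.1.slots.length)) (fun x => ?_)
    (g := fun k => (k + 1) + (k + 2) * (k + 1)) ?_ ?_ (fun x => ?_)
    (((hs.cspCNF hf).pair hs.length).recode (fun _ => rfl) fun _ => rfl)
  · refine Iff.trans ⟨CaseModData.Yes.schedulable x.2, CaseModData.Schedulable.yes x.2⟩ ?_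
    rw [CaseModData.schedulable_iff]
    exact (cspCNF_satisfiable_iff CaseModData.slots_nodup
      fun c hc => (CaseModData.forbidden_slots c hc).2).symm
  · exact Primrec.nat_add.comp Primrec.succ (Primrec.nat_mul.comp
      (Primrec.succ.comp Primrec.succ) Primrec.succ)
  · intro a b hab
    dsimp only
    gcongr
  · have h : LVCaseMod.param x = x.1.maxGlue + x.1.glueVars.card := rfl
    change x.1.slots.length ≤ _
    rw [CaseModData.length_slots, h]
    gcongr <;> omega

end CaseReuse

theorem mainTheorem2 : CaseReuse.W1Complete CaseReuse.LVCaseMod := by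
  exact ⟨CaseReuse.lvCaseMod_mem, CaseReuse.lvCaseMod_hard⟩
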